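/- Let $(X,d)$ be a locally compact connected metric space with a non-zero Borel measure $\mu$ that is inner regular with respect to compact sets, finite on compact sets, and satisfies $\operatorname{supp}\mu=X$. For $\rho>0$ let $D_\rho\in[1,\infty]$ be the least number such that $\mu(B(x,2s))\le D_\rho\,\mu(B(x,s))$ for all $x\in X$ and $s\in(0,\rho]$. Let $p'$ denote the conjugate exponent of $p$, and put $$\phi(r,p)=\inf_{q\in(1,p)}\Bigl(q'+\tfrac1{r/q-1}\Bigr)^{(1/p-1/r)/(1-q/r)}\quad(1<p\le r\le\infty),\qquad \phi(r,p)=\phi(r',p')\quad(r\le p).$$ Let $B_1,B_2$ be Banach spaces, $R>0$, $r\in[1,\infty)$, $\kappa>2$ with $D_{3\kappa R}<\infty$, let $E\subseteq X$ be $\mu$-measurable with $\operatorname{diam}E<R$, and write $V=B(E,R/2)=\{x: d(x,E)<R/2\}$. Let $T:\chi_E L^r(\mu;B_1)\to\chi_V L^r(\mu;B_2)$ be a continuous linear map and let $K:V\times E\to\mathcal L(B_1;B_2)$ be $(\mu\otimes\mu)$-measurable. Let $A_R,C_R>0$ be constants, and assume: (i) for every open $F\subseteq V$, $K$ is $(\mu\otimes\mu)$-integrable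 on $F\times(E\setminus F)$, and $(Tf)(x)=\int_{E\setminus F}K(x,y)f(y)\,d\mu(y)$ for $\mu$-a.e. $x\in F$ and every $f\in\chi_{E\setminus F}L^\infty(\mu;B_1)$; (ii) $\|Tf\|_{L^r(\mu;B_2)}\le A_R\|f\|_{L^r(\mu;B_1)}$ for every $f\in\chi_EL^r(\mu;B_1)$; (iii) $\int_{E\setminus B(x,2d(x,x'))}\|K(x,y)-K(x',y)\|\,d\mu(y)\le C_R$ for $\mu$-almost every $x,x'\in V$ with $d(x,x')<R$. Then, for every $p\in[r,\infty)$ and every $f\in\chi_EL^\infty(\mu;B_1)$, $$\|\chi_E Tf\|_{L^p(\mu;B_2)}\le 16\,\phi(r,p)\,\bigl(D_{3\kappa R}^9A_R+C_R\bigr)\,\|f\|_{L^p(\mu;B_1)}.$$ -/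

import Mathlib

open MeasureTheory Set
open scoped NNReal ENNReal

noncomputable section

/-- The doubling constant of `μ` up to the radius `R`: the least `D ∈ [1, ∞]` such that
`μ (B(x, 2 r)) ≤ D μ (B(x, r))` for every point `x` and every `r ∈ (0, R]`. -/
def localDoublingConst {X : Type*} [MetricSpace X] [MeasurableSpace X]
    (μ : Measure X) (R : ℝ) : ℝ≥0∞ :=
  sInf {D : ℝ≥0∞ | 1 ≤ D ∧ ∀ (x : X) (r : ℝ), 0 < r → r ≤ R →
    μ (Metric.ball x (2 * r)) ≤ D * μ (Metric.ball x r)}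

/-- The function `φ` in the range `1 < p ≤ r ≤ ∞`, that is,
`inf_{1 < q < p} (q' + 1 / (r / q - 1)) ^ ((1 / p - 1 / r) / (1 - q / r))`,
where `q'` is the conjugate exponent of `q`. -/
def phiLow (r p : ℝ≥0∞) : ℝ≥0∞ :=
  ⨅ q ∈ Ioo 1 p, (q.conjExponent + (r / q - 1)⁻¹) ^
    (((1 / p).toReal - (1 / r).toReal) / (1 - (q / r).toReal))

/-- The function `φ`: it is `phiLow r p` for `1 < p ≤ r`, and `phiLow r' p'` for `r ≤ p`. (The two
expressions both equal `1` for `1 < p = r < ∞`.) -/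
def phiConst (r p : ℝ≥0∞) : ℝ≥0∞ :=
  open Classical in
  if 1 < p ∧ p ≤ r then phiLow r p else phiLow r.conjExponent p.conjExponent

end

/-!
# `L^p` bounds, `p ≥ r`, for singular integral operators on a locally doubling space

Write `ν = μ|_E` and `σ = μ|_V`, where `V` is the thickening of `E`. At `p = r` the bound is the
hypothesis on `T`, because `φ(r, r) = 1`. For `p > r` the proof passes to the adjoint, which maps
functions on `V` with values in the dual of `B₂` to functions on `E`, and shows that it is of weak
type `(1, 1)`.

*Scalar input.* A bounded `f` is `‖f‖ u` with `‖u‖ ≤ 1`. The operator `U h = T (h u)` acts on real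
functions, has the same norm bound as `T` and satisfies `U ‖f‖ = T f`
(`exists_scalar_operator_apply_eq`). It thus suffices to bound `U`, and no duality theory for
Bochner spaces is needed on the input side: for a bounded dual-valued `g` the functional
`h ↦ ∫ ⟨g, U h⟩ ∂σ` lives on a real `L^r` and has a density `k` by the Radon–Nikodym theorem, with
`‖k‖_{r'} ≤ A ‖g‖_{r'}` (`IsDualDensity`, `IsDualDensity.eLpNorm_le`).

*Weak type.* The kernel enters only through `HasSmallOscillation`: if `|h| ≤ 1` vanishes near a
ball, then `U h` oscillates by at most `C` on a smaller ball, by the representation of `T` off the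
diagonal and the regularity of `K` (`hasSmallOscillation_of_kernel`). In a Calderón–Zygmund
decomposition of `g` at height `t / (2 D² A)` the good part is bounded, so that Chebyshev's
inequality in `L^{r'}` applies; the bad part has mean zero on each piece, so that pairing it with
`U h` sees only the oscillation. This gives the constant `4 D⁶ A + 2 C`
(`IsDualDensity.mul_measure_le`).

*Interpolation.* The Marcinkiewicz theorem yields `L^q` bounds of the adjoint for `1 < q < r'`, with
the factor `q' + 1 / (r' / q - 1)` of the definition of `φ`, and a second real interpolation, between
`L^q` and `L^{r'}`, yields the `L^{p'}` bound with the exponent of that factor as in `φ`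
(`IsSublinearOn.lintegral_rpow_le_of_weak_of_strong`,
`IsSublinearOn.lintegral_rpow_le_of_strong_of_strong`). Each of the two loses a factor `2`; the
infimum over `q` is `φ(r, p)`. Finally `lintegral_enorm_rpow_le_of_dual` returns to `U`.

The doubling condition is used for radii up to `R` only, and, since `X` is connected, it forces `X`
to be second countable (`secondCountableTopology_of_measure_ball_lt_top`), which gives Lebesgue
differentiation and Fubini's theorem.
-/

/-! ### Geometry of locally doubling measures -/

/-- The infimum that defines the doubling constant is attained, because balls have positive measure.
-/
theorem exists_nnreal_localDoublingConst {X : Type*} [MetricSpace X] [MeasurableSpace X]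
    {μ : Measure X} [IsLocallyFiniteMeasure μ] [μ.IsOpenPosMeasure] {ρ : ℝ}
    (hD : localDoublingConst μ ρ < ∞) :
    ∃ D : ℝ≥0, (D : ℝ≥0∞) = localDoublingConst μ ρ ∧ 1 ≤ D ∧
      ∀ (x : X) (s : ℝ), 0 < s → s ≤ ρ →
        μ (Metric.ball x (2 * s)) ≤ D * μ (Metric.ball x s) := by
  have h1 : 1 ≤ localDoublingConst μ ρ := le_sInf fun D hD => hD.1
  refine ⟨(localDoublingConst μ ρ).toNNReal, ENNReal.coe_toNNReal hD.ne, ?_, ?_⟩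
  · rw [← ENNReal.coe_le_coe, ENNReal.coe_toNNReal hD.ne]
    exact h1
  · intro x s hs hsρ
    rw [ENNReal.coe_toNNReal hD.ne]
    by_cases hm : μ (Metric.ball x s) = ∞
    · rw [hm, ENNReal.mul_top (by positivity)]
      exact le_top
    · rw [← ENNReal.div_le_iff_le_mul (Or.inl (Metric.measure_ball_pos μ x hs).ne') (Or.inl hm)]
      exact le_sInf fun D' hD' => ENNReal.div_le_of_le_mul (hD'.2 x s hs hsρ)

section Doubling

variable {X : Type*} [MetricSpace X] [MeasurableSpace X] {μ : Measure X} {ρ : ℝ} {D : ℝ≥0}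

theorem measure_ball_two_pow_le
    (hdbl : ∀ (x : X) (s : ℝ), 0 < s → s ≤ ρ →
      μ (Metric.ball x (2 * s)) ≤ D * μ (Metric.ball x s)) (x : X) (n : ℕ) :
    ∀ s : ℝ, 0 < s → 2 ^ n * s ≤ 2 * ρ →
      μ (Metric.ball x (2 ^ n * s)) ≤ D ^ n * μ (Metric.ball x s) := by
  induction n with
  | zero => intro s _ _; simp
  | succ n ih =>
    intro s hs hsρ
    have h2 : (0 : ℝ) < 2 ^ n * s := by positivity
    have e : (2 : ℝ) ^ (n + 1) * s = 2 * (2 ^ n * s) := by ring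
    rw [e] at hsρ ⊢
    calc μ (Metric.ball x (2 * (2 ^ n * s))) ≤ D * μ (Metric.ball x (2 ^ n * s)) :=
          hdbl x _ h2 (by linarith)
      _ ≤ D * (D ^ n * μ (Metric.ball x s)) := by
          gcongr
          exact ih s hs (by linarith)
      _ = D ^ (n + 1) * μ (Metric.ball x s) := by rw [← mul_assoc, ← pow_succ']

/-- Doubling a small ball of finite measure finitely often reaches the radius `2 ρ`. -/
theorem measure_ball_lt_top_of_doubling [IsLocallyFiniteMeasure μ]
    (hdbl : ∀ (x : X) (s : ℝ), 0 < s → s ≤ ρ →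
      μ (Metric.ball x (2 * s)) ≤ D * μ (Metric.ball x s)) (x : X) {s : ℝ} (hs : s ≤ 2 * ρ) :
    μ (Metric.ball x s) < ∞ := by
  rcases le_or_gt s 0 with h0 | h0
  · simp [Metric.ball_eq_empty.2 h0]
  obtain ⟨o, hxo, ho, hofin⟩ := μ.exists_isOpen_measure_lt_top x
  obtain ⟨ε, hε, hsub⟩ := Metric.isOpen_iff.1 ho x hxo
  obtain ⟨n, hn⟩ := pow_unbounded_of_one_lt (s / ε) one_lt_two
  have h2 : (0 : ℝ) < 2 ^ n := by positivity
  have key := measure_ball_two_pow_le hdbl x n (s / 2 ^ n) (by positivity)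
    (by rwa [mul_div_cancel₀ _ h2.ne'])
  rw [mul_div_cancel₀ _ h2.ne'] at key
  refine key.trans_lt (ENNReal.mul_lt_top (by simp) ((measure_mono ?_).trans_lt hofin))
  refine (Metric.ball_subset_ball ?_).trans hsub
  rw [div_lt_iff₀ hε] at hn
  rw [div_le_iff₀ h2]
  linarith

/-- Disjoint balls of a fixed radius with centres in `B(x, s)` have positive measure and lie in a set
of finite measure, so a maximal family of them is countable. -/
theorem isSeparable_ball_of_measure_lt_top [OpensMeasurableSpace X] [μ.IsOpenPosMeasure]
    {x : X} {s t : ℝ} (hst : s < t) (hfin : μ (Metric.ball x t) < ∞) :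
    TopologicalSpace.IsSeparable (Metric.ball x s) := by
  have key : ∀ n : ℕ, ∃ u : Set X, u.Countable ∧
      ∀ y ∈ Metric.ball x s, ∃ z ∈ u, dist y z < 4 * min (t - s) (1 / (n + 1)) := by
    intro n
    have hε : 0 < min (t - s) (1 / ((n : ℝ) + 1)) := lt_min (by linarith) (by positivity)
    set ε := min (t - s) (1 / ((n : ℝ) + 1))
    obtain ⟨u, hu, hdisj, hcov⟩ := Vitali.exists_disjoint_subfamily_covering_enlargement_ball
      (Metric.ball x s) id (fun _ => ε) ε (fun _ _ => le_rfl) 4 (by norm_num)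
    refine ⟨u, ?_, fun y hy => ?_⟩
    · have hc := Measure.countable_meas_pos_of_disjoint_of_meas_iUnion_ne_top μ
        (As := fun z : u => Metric.ball (z : X) ε) (fun _ => Metric.isOpen_ball.measurableSet)
        (fun a b hab => hdisj a.2 b.2 (fun h => hab (Subtype.ext h)))
        ((measure_mono (iUnion_subset fun z => ?_)).trans_lt hfin).ne
      · have : {i : u | 0 < μ (Metric.ball (i : X) ε)} = univ :=
          eq_univ_of_forall fun i => Metric.measure_ball_pos μ _ hε
        rw [this] at hc
        exact countable_coe_iff.1 (countable_univ_iff.1 hc)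
      · refine Metric.ball_subset_ball' ?_
        have h1 := Metric.mem_ball.1 (hu z.2)
        have h2 : ε ≤ t - s := min_le_left _ _
        linarith
    · obtain ⟨z, hz, hsub⟩ := hcov y hy
      exact ⟨z, hz, Metric.mem_ball.1 (hsub (Metric.mem_ball_self hε))⟩
  choose u huc hu using key
  refine ⟨⋃ n, u n, countable_iUnion huc, fun y hy => Metric.mem_closure_iff.2 fun δ hδ => ?_⟩
  obtain ⟨n, hn⟩ := exists_nat_one_div_lt (show (0 : ℝ) < δ / 4 by positivity)
  obtain ⟨z, hz, hyz⟩ := hu n y hy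
  refine ⟨z, mem_iUnion.2 ⟨n, hz⟩, hyz.trans ?_⟩
  have := min_le_right (t - s) (1 / ((n : ℝ) + 1))
  linarith

/-- A connected metric space carrying a measure of full support that is finite on all balls of a
fixed radius is separable: the points reachable from a given one by chains of steps shorter than
`ρ` form a clopen set, which is exhausted by countably many separable balls. -/
theorem secondCountableTopology_of_measure_ball_lt_top [ConnectedSpace X] [OpensMeasurableSpace X]
    [μ.IsOpenPosMeasure] {ρ : ℝ} (hρ : 0 < ρ)
    (hfin : ∀ x : X, μ (Metric.ball x (3 * ρ)) < ∞) : SecondCountableTopology X := by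
  obtain ⟨x₀⟩ := (inferInstance : Nonempty X)
  set N : ℕ → Set X := fun n => (Metric.thickening ρ)^[n] {x₀} with hN
  have hsucc : ∀ n, N (n + 1) = Metric.thickening ρ (N n) := fun n => by
    simp only [hN, Function.iterate_succ_apply']
  have hsep : ∀ n, TopologicalSpace.IsSeparable (N n) := by
    intro n
    induction n with
    | zero => exact (countable_singleton x₀).isSeparable
    | succ n ih =>
      obtain ⟨t, -, htc, hcl⟩ := ih.exists_countable_dense_subset
      have : Countable t := htc.to_subtype
      refine (TopologicalSpace.IsSeparable.iUnion (ι := t) fun z =>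
        isSeparable_ball_of_measure_lt_top (s := 2 * ρ) (by linarith) (hfin z)).mono ?_
      intro y hy
      rw [hsucc] at hy
      obtain ⟨w, hw, hyw⟩ := Metric.mem_thickening_iff.1 hy
      obtain ⟨z, hz, hwz⟩ := Metric.mem_closure_iff.1 (hcl hw) ρ hρ
      refine mem_iUnion.2 ⟨⟨z, hz⟩, ?_⟩
      rw [Metric.mem_ball]
      linarith [dist_triangle y w z]
  have hclopen : IsClopen (⋃ n, N n) := by
    constructor
    · refine isClosed_of_closure_subset fun y hy => ?_
      obtain ⟨z, hz, hyz⟩ := Metric.mem_closure_iff.1 hy ρ hρ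
      obtain ⟨n, hn⟩ := mem_iUnion.1 hz
      refine mem_iUnion.2 ⟨n + 1, ?_⟩
      rw [hsucc]
      exact Metric.mem_thickening_iff.2 ⟨z, hn, hyz⟩
    · refine Metric.isOpen_iff.2 fun y hy => ⟨ρ, hρ, fun z hz => ?_⟩
      obtain ⟨n, hn⟩ := mem_iUnion.1 hy
      refine mem_iUnion.2 ⟨n + 1, ?_⟩
      rw [hsucc]
      exact Metric.mem_thickening_iff.2 ⟨y, hn, hz⟩
  have huniv : ⋃ n, N n = univ := hclopen.eq_univ ⟨x₀, mem_iUnion.2 ⟨0, rfl⟩⟩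
  have : TopologicalSpace.SeparableSpace X := by
    rw [← TopologicalSpace.isSeparable_univ_iff, ← huniv]
    exact TopologicalSpace.IsSeparable.iUnion hsep
  exact UniformSpace.secondCountable_of_separable X

theorem measure_closedBall_two_mul_le
    (hdbl : ∀ (x : X) (s : ℝ), 0 < s → s ≤ ρ →
      μ (Metric.ball x (2 * s)) ≤ D * μ (Metric.ball x s)) (x : X) {s : ℝ} (hs : 0 < s)
    (hsρ : 2 * s ≤ ρ) :
    μ (Metric.closedBall x (2 * s)) ≤ D ^ 2 * μ (Metric.closedBall x s) :=
  calc μ (Metric.closedBall x (2 * s)) ≤ μ (Metric.ball x (2 ^ 2 * s)) :=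
        measure_mono (Metric.closedBall_subset_ball (by linarith))
    _ ≤ D ^ 2 * μ (Metric.ball x s) := measure_ball_two_pow_le hdbl x 2 s hs (by linarith)
    _ ≤ D ^ 2 * μ (Metric.closedBall x s) := by gcongr; exact Metric.ball_subset_closedBall

theorem isUnifLocDoublingMeasure_of_doubling (hρ : 0 < ρ)
    (hdbl : ∀ (x : X) (s : ℝ), 0 < s → s ≤ ρ →
      μ (Metric.ball x (2 * s)) ≤ D * μ (Metric.ball x s)) : IsUnifLocDoublingMeasure μ := by
  refine ⟨D ^ 2, ?_⟩
  filter_upwards [Ioo_mem_nhdsGT (show (0 : ℝ) < ρ / 2 by positivity)] with s hs x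
  have := measure_closedBall_two_mul_le hdbl x hs.1 (by linarith [hs.2])
  exact_mod_cast this

end Doubling

/-! ### Calderón–Zygmund balls -/

section CalderonZygmund

open Filter Topology

variable {X : Type*} [MetricSpace X] [MeasurableSpace X] [BorelSpace X] {μ : Measure X}
  {H : Type*} [NormedAddCommGroup H]

/-- Lebesgue differentiation along the dyadic radii `ρ / 2 ^ k`. -/
theorem ae_enorm_le_of_forall_setLIntegral_closedBall_le [SecondCountableTopology X]
    [IsLocallyFiniteMeasure μ] [IsUnifLocDoublingMeasure μ] [μ.IsOpenPosMeasure]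
    {g : X → H} (hg : Integrable g μ) {ρ : ℝ} (hρ : 0 < ρ) (l : ℝ≥0)
    (hfin : ∀ x, μ (Metric.closedBall x ρ) < ∞) :
    ∀ᵐ x ∂μ, (∀ k : ℕ, ∫⁻ y in Metric.closedBall x (ρ / 2 ^ k), ‖g y‖ₑ ∂μ ≤
      l * μ (Metric.closedBall x (ρ / 2 ^ k))) → ‖g x‖ₑ ≤ l := by
  filter_upwards [IsUnifLocDoublingMeasure.ae_tendsto_average μ hg.norm.locallyIntegrable 1]
    with x hx hk
  have hlim : Tendsto (fun k : ℕ => ρ / 2 ^ k) atTop (𝓝[>] 0) := by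
    refine tendsto_nhdsWithin_iff.2 ⟨?_, Eventually.of_forall fun k => by
      simp only [mem_Ioi]; positivity⟩
    have := (tendsto_pow_atTop_nhds_zero_of_lt_one (r := (1 / 2 : ℝ)) (by norm_num)
      (by norm_num)).const_mul ρ
    simpa [div_eq_mul_inv] using this
  have h := hx (fun _ => x) _ hlim (Eventually.of_forall fun k =>
    Metric.mem_closedBall_self (by positivity))
  have hle : ‖g x‖ ≤ l := by
    refine le_of_tendsto h (Eventually.of_forall fun k => ?_)
    have hpos : 0 < ρ / 2 ^ k := by positivity
    have hm0 : μ (Metric.closedBall x (ρ / 2 ^ k)) ≠ 0 :=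
      ((Metric.measure_ball_pos μ x hpos).trans_le
        (measure_mono Metric.ball_subset_closedBall)).ne'
    have hmt : μ (Metric.closedBall x (ρ / 2 ^ k)) ≠ ∞ :=
      ((measure_mono (Metric.closedBall_subset_closedBall
        (div_le_self hρ.le (one_le_pow₀ one_le_two)))).trans_lt (hfin x)).ne
    have hm : 0 < μ.real (Metric.closedBall x (ρ / 2 ^ k)) := ENNReal.toReal_pos hm0 hmt
    rw [setAverage_eq, smul_eq_mul, inv_mul_le_iff₀ hm,
      integral_norm_eq_lintegral_enorm hg.1.restrict]
    have := ENNReal.toReal_mono (ENNReal.mul_ne_top ENNReal.coe_ne_top hmt) (hk k)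
    rw [ENNReal.toReal_mul] at this
    rw [mul_comm]
    exact this
  rw [← ofReal_norm, ← ENNReal.ofReal_coe_nnreal]
  exact ENNReal.ofReal_le_ofReal hle

/-- The Calderón–Zygmund balls of `g` at height `l`: disjoint balls on which the mean of `‖g‖` is
about `l`, whose doubles contain the points of `E` where some dyadic mean exceeds `l`. Because the
radii are dyadic, the selected ball met by a given one is at least as large, so doubling the
radius suffices to cover the centres. -/
theorem exists_calderonZygmund_balls [SecondCountableTopology X]
    [IsLocallyFiniteMeasure μ] [IsUnifLocDoublingMeasure μ] [μ.IsOpenPosMeasure]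
    {g : X → H} (hg : Integrable g μ) {ρ : ℝ} (hρ : 0 < ρ) (l : ℝ≥0)
    (hfin : ∀ x, μ (Metric.closedBall x ρ) < ∞) (E : Set X)
    (hE : ∀ x ∈ E, ∫⁻ y in Metric.closedBall x ρ, ‖g y‖ₑ ∂μ ≤ l * μ (Metric.closedBall x ρ)) :
    ∃ (u : Set X) (δ : X → ℝ), u ⊆ E ∧ u.Countable ∧ (∀ c ∈ u, 0 < δ c ∧ 2 * δ c ≤ ρ) ∧
      u.PairwiseDisjoint (fun c => Metric.closedBall c (δ c)) ∧
      (∀ c ∈ u, l * μ (Metric.closedBall c (δ c)) ≤ ∫⁻ y in Metric.closedBall c (δ c), ‖g y‖ₑ ∂μ) ∧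
      (∀ c ∈ u, ∫⁻ y in Metric.closedBall c (2 * δ c), ‖g y‖ₑ ∂μ ≤
        l * μ (Metric.closedBall c (2 * δ c))) ∧
      ∀ᵐ x ∂μ, x ∈ E → x ∉ ⋃ c ∈ u, Metric.closedBall c (2 * δ c) → ‖g x‖ₑ ≤ l := by
  set bad : X → ℕ → Prop := fun x k => l * μ (Metric.closedBall x (ρ / 2 ^ k)) <
    ∫⁻ y in Metric.closedBall x (ρ / 2 ^ k), ‖g y‖ₑ ∂μ with hbad
  set t : Set X := {x ∈ E | ∃ k, bad x k} with ht
  have key : ∀ x ∈ t, ∃ k : ℕ, bad x (k + 1) ∧ ¬ bad x k := by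
    classical
    intro x hx
    rcases hn : Nat.find hx.2 with _ | k
    · have h0 := Nat.find_spec hx.2
      rw [hn] at h0
      simp only [hbad, pow_zero, div_one] at h0
      exact absurd (hE x hx.1) (not_le.2 h0)
    · refine ⟨k, hn ▸ Nat.find_spec hx.2, Nat.find_min hx.2 (hn ▸ k.lt_succ_self)⟩
  choose! κ hκ using key
  set δ : X → ℝ := fun x => ρ / 2 ^ (κ x + 1) with hδ
  have hδpos : ∀ x, 0 < δ x := fun x => by positivity
  have h2δ : ∀ x, 2 * δ x = ρ / 2 ^ κ x := fun x => by
    simp only [hδ, pow_succ]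
    field_simp
  obtain ⟨u, hut, hdisj, hcov⟩ := Vitali.exists_disjoint_subfamily_covering_enlargement
    (fun x => Metric.closedBall x (δ x)) t δ (3 / 2) (by norm_num) (fun x _ => (hδpos x).le) ρ
    (fun x _ => div_le_self hρ.le (one_le_pow₀ one_le_two))
    (fun x _ => ⟨x, Metric.mem_closedBall_self (hδpos x).le⟩)
  have hcov' : t ⊆ ⋃ c ∈ u, Metric.closedBall c (2 * δ c) := by
    intro a ha
    obtain ⟨b, hb, ⟨z, hza, hzb⟩, hab⟩ := hcov a ha
    refine mem_biUnion hb ?_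
    have hle : δ a ≤ δ b := by
      by_contra! hlt
      have hk : κ a < κ b := by
        by_contra! hk
        refine absurd hlt (not_lt.2 ?_)
        simp only [hδ]
        gcongr
        norm_num
      have : 2 * δ b ≤ δ a := by
        rw [h2δ]
        simp only [hδ]
        gcongr
        · norm_num
        · omega
      linarith [hδpos b]
    rw [Metric.mem_closedBall] at hza hzb ⊢
    linarith [dist_triangle_left a b z]
  refine ⟨u, δ, fun x hx => (hut hx).1, ?_, fun c _ => ⟨hδpos c, ?_⟩, hdisj, fun c hc => ?_,
    fun c hc => ?_, ?_⟩
  · refine hdisj.countable_of_nonempty_interior fun c _ => ?_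
    exact ⟨c, Metric.ball_subset_interior_closedBall (Metric.mem_ball_self (hδpos c))⟩
  · rw [h2δ]
    exact div_le_self hρ.le (one_le_pow₀ one_le_two)
  · exact (hκ c (hut hc)).1.le
  · rw [h2δ]
    exact not_lt.1 (hκ c (hut hc)).2
  · filter_upwards [ae_enorm_le_of_forall_setLIntegral_closedBall_le hg hρ l hfin] with x hx hxE hxu
    refine hx fun k => not_lt.1 fun hk => hxu (hcov' ⟨hxE, k, hk⟩)

/-- A countable family of measurable sets can be cut down to a disjoint one with the same union. -/
theorem exists_disjoint_measurable_subsets {X ι : Type*} [MeasurableSpace X] [Countable ι]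
    (S : ι → Set X) (hS : ∀ i, MeasurableSet (S i)) :
    ∃ Q : ι → Set X, (∀ i, MeasurableSet (Q i)) ∧ (∀ i, Q i ⊆ S i) ∧
      Pairwise (Function.onFun Disjoint Q) ∧ ⋃ i, Q i = ⋃ i, S i := by
  classical
  obtain ⟨e, he⟩ := Countable.exists_injective_nat ι
  refine ⟨fun i => S i \ ⋃ (j) (_ : e j < e i), S j, fun i => (hS i).diff
    (MeasurableSet.iUnion fun j => MeasurableSet.iUnion fun _ => hS j), fun i => sdiff_subset,
    ?_, ?_⟩
  · have key : ∀ i j, e i < e j → Disjoint (S i \ ⋃ (k) (_ : e k < e i), S k)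
        (S j \ ⋃ (k) (_ : e k < e j), S k) := fun i j hij =>
      disjoint_left.2 fun x hx hx' => hx'.2 (mem_iUnion₂.2 ⟨i, hij, hx.1⟩)
    intro i j hij
    rcases lt_or_gt_of_ne (he.ne hij) with h | h
    · exact key i j h
    · exact (key j i h).symm
  · refine Subset.antisymm (iUnion_mono fun i => sdiff_subset) fun x hx => ?_
    have hne : ∃ n, ∃ i, e i = n ∧ x ∈ S i := by
      obtain ⟨i, hi⟩ := mem_iUnion.1 hx
      exact ⟨e i, i, rfl, hi⟩
    obtain ⟨i, hi, hxi⟩ := Nat.find_spec hne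
    refine mem_iUnion.2 ⟨i, hxi, fun h => ?_⟩
    obtain ⟨j, hj, hxj⟩ := mem_iUnion₂.1 h
    exact Nat.find_min hne (hi ▸ hj) ⟨j, rfl, hxj⟩

end CalderonZygmund

/-! ### Duality for scalar `L^r` spaces -/

section LpDuality

open Filter Topology

variable {X : Type*} [MeasurableSpace X] {ν : Measure X}

/-- The `L^p` norm of a nonnegative function is controlled by testing against bounded functions:
the test function `(v ∧ n) ^ (p - 1)` is bounded, and its `L^q` norm is a finite power of the `L^p`
norm of `v ∧ n`. -/
theorem lintegral_rpow_le_of_forall_bounded [IsFiniteMeasure ν] {p q : ℝ}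
    (hpq : p.HolderConjugate q) {v : X → ℝ≥0∞} (hv : Measurable v) (c : ℝ≥0∞)
    (h : ∀ w : X → ℝ≥0, Measurable w → (∃ M : ℝ≥0, ∀ x, w x ≤ M) →
      ∫⁻ x, w x * v x ∂ν ≤ c * (∫⁻ x, (w x : ℝ≥0∞) ^ q ∂ν) ^ (1 / q)) :
    ∫⁻ x, v x ^ p ∂ν ≤ c ^ p := by
  have hp0 : 0 < p := hpq.pos
  have hq0 : 0 < q := hpq.symm.pos
  have hp1 : 0 < p - 1 := hpq.sub_one_pos
  have key : ∀ n : ℕ, ∫⁻ x, (min (v x) n) ^ p ∂ν ≤ c ^ p := by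
    intro n
    have hfin : ∀ x, (min (v x) n) ^ (p - 1) ≠ ∞ := fun x =>
      ENNReal.rpow_ne_top_of_nonneg hp1.le
        ((min_le_right _ _).trans_lt (ENNReal.natCast_lt_top n)).ne
    have hw := h (fun x => ((min (v x) n) ^ (p - 1)).toNNReal)
      (((hv.min measurable_const).pow_const _).ennreal_toNNReal)
      ⟨((n : ℝ≥0∞) ^ (p - 1)).toNNReal, fun x => ENNReal.toNNReal_mono
        (ENNReal.rpow_ne_top_of_nonneg hp1.le (ENNReal.natCast_ne_top n))
        (ENNReal.rpow_le_rpow (min_le_right _ _) hp1.le)⟩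
    simp only [ENNReal.coe_toNNReal (hfin _), ← ENNReal.rpow_mul] at hw
    rw [show (p - 1) * q = p from hpq.sub_one_mul_conj] at hw
    set I := ∫⁻ x, (min (v x) n) ^ p ∂ν with hI
    have hIle : I ≤ c * I ^ (1 / q) := by
      refine le_trans (lintegral_mono fun x => ?_) hw
      calc (min (v x) n) ^ p = (min (v x) n) ^ ((p - 1) + 1) := by ring_nf
        _ = (min (v x) n) ^ (p - 1) * min (v x) n := by
            rw [ENNReal.rpow_add_of_nonneg _ _ hp1.le zero_le_one, ENNReal.rpow_one]
        _ ≤ _ := by gcongr; exact min_le_left _ _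
    have hIfin : I ≠ ∞ := by
      refine ne_top_of_le_ne_top ?_ (lintegral_mono (g := fun _ => (n : ℝ≥0∞) ^ p) fun x =>
        ENNReal.rpow_le_rpow (min_le_right _ _) hp0.le)
      rw [lintegral_const]
      exact ENNReal.mul_ne_top (ENNReal.rpow_ne_top_of_nonneg hp0.le (ENNReal.natCast_ne_top n))
        (measure_ne_top _ _)
    rcases eq_or_ne I 0 with h0 | h0
    · rw [h0]; exact zero_le
    have h1 : I ^ (1 / p) ≤ c := by
      have e : I = I ^ (1 / p) * I ^ (1 / q) := by
        rw [← ENNReal.rpow_add _ _ h0 hIfin, one_div, one_div, hpq.inv_add_inv_eq_one,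
          ENNReal.rpow_one]
      have h3 : I ^ (1 / q) ≠ 0 := by
        simp only [ne_eq, ENNReal.rpow_eq_zero_iff, not_or]
        exact ⟨fun h => h0 h.1, fun h => hIfin h.1⟩
      have h4 : I ^ (1 / q) ≠ ∞ := ENNReal.rpow_ne_top_of_nonneg (by positivity) hIfin
      exact (ENNReal.mul_le_mul_iff_left h3 h4).1 (e.symm.le.trans hIle)
    calc I = (I ^ (1 / p)) ^ p := by
          rw [← ENNReal.rpow_mul, one_div_mul_cancel hp0.ne', ENNReal.rpow_one]
      _ ≤ c ^ p := ENNReal.rpow_le_rpow h1 hp0.le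
  have hsup : ∀ x, v x ^ p = ⨆ n : ℕ, (min (v x) n) ^ p := by
    intro x
    refine le_antisymm ?_ (iSup_le fun n => ENNReal.rpow_le_rpow (min_le_left _ _) hp0.le)
    have hlim : Tendsto (fun n : ℕ => (min (v x) n) ^ p) atTop (𝓝 ((min (v x) ∞) ^ p)) :=
      ((tendsto_const_nhds.min ENNReal.tendsto_nat_nhds_top)).ennrpow_const p
    rw [min_top_right] at hlim
    exact le_of_tendsto' hlim fun n => le_iSup (fun n : ℕ => (min (v x) n) ^ p) n
  simp only [hsup]
  rw [lintegral_iSup (fun n => (hv.min measurable_const).pow_const p)]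
  · exact iSup_le key
  · intro m n hmn x
    exact ENNReal.rpow_le_rpow (min_le_min_left _ (Nat.cast_le.2 hmn)) hp0.le

/-- A continuous linear functional on `L^r` of a finite measure, evaluated at indicators, is a
signed measure. -/
noncomputable def Lp.signedMeasure [IsFiniteMeasure ν] {r : ℝ≥0∞} [Fact (1 ≤ r)] (hr : r ≠ ∞)
    (Λ : Lp ℝ r ν →L[ℝ] ℝ) : SignedMeasure X :=
  open Classical in
  { measureOf' := fun S =>
      if hS : MeasurableSet S then Λ (indicatorConstLp r hS (measure_ne_top ν S) 1) else 0
    empty' := by simp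
    not_measurable' := fun S hS => dif_neg hS
    m_iUnion' := by
      intro S hS hdisj
      simp only [dif_pos (hS _), dif_pos (MeasurableSet.iUnion hS)]
      refine Λ.hasSum (f := fun i => indicatorConstLp r (hS i) (measure_ne_top ν _) 1) ?_
      have hfin : ∀ F : Finset ℕ, ∑ i ∈ F, indicatorConstLp r (hS i) (measure_ne_top ν _) (1 : ℝ)
          = indicatorConstLp r (F.measurableSet_biUnion fun i _ => hS i)
            (measure_ne_top ν (⋃ i ∈ F, S i)) 1 := by
        intro F
        induction F using Finset.induction_on with
        | empty => simp
        | insert a F ha ih =>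
          rw [Finset.sum_insert ha, ih, ← indicatorConstLp_disjoint_union]
          · congr 1
            simp
          · rw [disjoint_iUnion₂_right]
            intro i hi
            exact hdisj (fun h => ha (h ▸ hi))
      rw [HasSum]
      simp only [hfin]
      refine tendsto_indicatorConstLp_set hr ?_
      have h1 : Tendsto (fun F : Finset ℕ => ν (⋃ i, S i) - ∑ i ∈ F, ν (S i)) atTop
          (𝓝 (ν (⋃ i, S i) - ν (⋃ i, S i))) := by
        refine ENNReal.Tendsto.sub tendsto_const_nhds ?_ (Or.inl (measure_ne_top _ _))
        rw [measure_iUnion hdisj hS]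
        exact ENNReal.summable.hasSum
      rw [tsub_self] at h1
      refine h1.congr fun F => ?_
      have hsub : ⋃ i ∈ F, S i ⊆ ⋃ i, S i := iUnion₂_subset fun i _ => subset_iUnion S i
      rw [symmDiff_of_le hsub, measure_sdiff hsub
        (F.measurableSet_biUnion fun i _ => hS i).nullMeasurableSet (measure_ne_top _ _),
        measure_biUnion_finset (fun i _ j _ hij => hdisj hij) fun i _ => hS i] }

theorem Lp.signedMeasure_apply [IsFiniteMeasure ν] {r : ℝ≥0∞} [Fact (1 ≤ r)] (hr : r ≠ ∞)
    (Λ : Lp ℝ r ν →L[ℝ] ℝ) {S : Set X} (hS : MeasurableSet S) :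
    Lp.signedMeasure hr Λ S = Λ (indicatorConstLp r hS (measure_ne_top ν S) 1) :=
  dif_pos hS

/-- The density of the signed measure of a functional represents it on bounded functions. -/
theorem exists_integrable_forall_eq_integral_mul [IsFiniteMeasure ν] {r : ℝ≥0∞} [Fact (1 ≤ r)]
    (hr : r ≠ ∞) (Λ : Lp ℝ r ν →L[ℝ] ℝ) :
    ∃ k : X → ℝ, Measurable k ∧ Integrable k ν ∧
      ∀ h : Lp ℝ r ν, (∃ M : ℝ, ∀ᵐ x ∂ν, ‖h x‖ ≤ M) → Λ h = ∫ x, h x * k x ∂ν := by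
  set s := Lp.signedMeasure hr Λ with hs
  have hac : s ≪ᵥ ν.toENNRealVectorMeasure := by
    refine VectorMeasure.AbsolutelyContinuous.mk fun S hS h0 => ?_
    rw [Measure.toENNRealVectorMeasure_apply_measurable hS] at h0
    rw [hs, Lp.signedMeasure_apply hr Λ hS]
    have : indicatorConstLp r hS (measure_ne_top ν S) (1 : ℝ) = 0 := by
      rw [← norm_eq_zero, norm_indicatorConstLp (one_pos.trans_le Fact.out).ne' hr]
      have hr0 : r.toReal ≠ 0 :=
        (ENNReal.toReal_pos (one_pos.trans_le (Fact.out : 1 ≤ r)).ne' hr).ne'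
      simp [Measure.real, h0, hr0]
    rw [this, map_zero]
  have hk := SignedMeasure.withDensityᵥ_rnDeriv_eq s ν hac
  set k := s.rnDeriv ν with hkdef
  have hki : Integrable k ν := SignedMeasure.integrable_rnDeriv s ν
  have hind : ∀ S (hS : MeasurableSet S),
      Λ (indicatorConstLp r hS (measure_ne_top ν S) 1) = ∫ x in S, k x ∂ν := by
    intro S hS
    rw [← Lp.signedMeasure_apply hr Λ hS, ← hs, ← hk, withDensityᵥ_apply hki hS]
  have hsimple : ∀ (σ : SimpleFunc X ℝ) (hσ : MemLp σ r ν),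
      Λ (hσ.toLp σ) = ∫ x, σ x * k x ∂ν := by
    intro σ
    induction σ using SimpleFunc.induction with
    | const c hS =>
      rename_i S
      intro hσ
      have e : hσ.toLp _ = c • indicatorConstLp r hS (measure_ne_top ν S) (1 : ℝ) := by
        rw [indicatorConstLp, ← MemLp.toLp_const_smul]
        refine MemLp.toLp_congr _ _ (Eventually.of_forall fun x => ?_)
        by_cases hx : x ∈ S <;> simp [hx]
      rw [e, map_smul, hind S hS, smul_eq_mul, ← integral_const_mul, ← integral_indicator hS]
      refine integral_congr_ae (Eventually.of_forall fun x => ?_)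
      by_cases hx : x ∈ S <;> simp [hx]
    | @add f g hfg hf hg =>
      intro hσ
      have hfm : MemLp f r ν := f.memLp_of_isFiniteMeasure r ν
      have hgm : MemLp g r ν := g.memLp_of_isFiniteMeasure r ν
      have e : hσ.toLp _ = hfm.toLp f + hgm.toLp g := rfl
      rw [e, map_add, hf hfm, hg hgm, ← integral_add]
      · simp [add_mul]
      · obtain ⟨C, hC⟩ := f.exists_forall_norm_le
        exact hki.bdd_mul f.aestronglyMeasurable (Eventually.of_forall hC)
      · obtain ⟨C, hC⟩ := g.exists_forall_norm_le
        exact hki.bdd_mul g.aestronglyMeasurable (Eventually.of_forall hC)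
  refine ⟨k, SignedMeasure.measurable_rnDeriv s ν, hki, ?_⟩
  rintro h ⟨M, hM⟩
  have hM' : ∀ᵐ x ∂ν, ‖h x‖ ≤ max M 0 := hM.mono fun x hx => hx.trans (le_max_left _ _)
  set S : Set ℝ := Metric.closedBall 0 (max M 0)
  have h0 : (0 : ℝ) ∈ S := Metric.mem_closedBall_self (le_max_right _ _)
  have hhm : Measurable h := (Lp.stronglyMeasurable h).measurable
  set σ : ℕ → SimpleFunc X ℝ := SimpleFunc.approxOn h hhm S 0 h0 with hσ
  have hmem : ∀ᵐ x ∂ν, h x ∈ closure S := hM'.mono fun x hx => subset_closure (by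
    simpa [S] using hx)
  have hσm : ∀ n, MemLp (σ n) r ν := fun n => (σ n).memLp_of_isFiniteMeasure r ν
  have hlim : Tendsto (fun n => (hσm n).toLp (σ n)) atTop (𝓝 h) := by
    rw [Lp.tendsto_Lp_iff_tendsto_eLpNorm']
    have := SimpleFunc.tendsto_approxOn_Lp_eLpNorm hhm h0 hr hmem (by
      simpa using (Lp.memLp h).2)
    refine this.congr fun n => eLpNorm_congr_ae ?_
    filter_upwards [(hσm n).coeFn_toLp] with x hx
    rw [Pi.sub_apply, Pi.sub_apply, hx]
  have h1 := (Λ.continuous.tendsto h).comp hlim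
  refine tendsto_nhds_unique h1 ?_
  have e : (Λ ∘ fun n => (hσm n).toLp (σ n)) = fun n => ∫ x, σ n x * k x ∂ν :=
    funext fun n => hsimple (σ n) (hσm n)
  rw [e]
  refine tendsto_integral_of_dominated_convergence (fun x => max M 0 * ‖k x‖)
    (fun n => (σ n).aestronglyMeasurable.mul hki.1) (hki.norm.const_mul _) (fun n => ?_) ?_
  · refine Eventually.of_forall fun x => ?_
    have : σ n x ∈ S := SimpleFunc.approxOn_mem hhm h0 n x
    rw [norm_mul]
    gcongr
    simpa [S] using this
  · filter_upwards [hmem] with x hx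
    exact (SimpleFunc.tendsto_approxOn hhm h0 hx).mul_const _

theorem lintegral_mul_enorm_le_of_forall_eq_integral_mul [IsFiniteMeasure ν] {r : ℝ≥0∞}
    [Fact (1 ≤ r)] {Λ : Lp ℝ r ν →L[ℝ] ℝ} {a : ℝ≥0} (ha : ∀ h, ‖Λ h‖ ≤ a * ‖h‖)
    {k : X → ℝ} (hkm : Measurable k) (hki : Integrable k ν)
    (hk : ∀ h : Lp ℝ r ν, (∃ M : ℝ, ∀ᵐ x ∂ν, ‖h x‖ ≤ M) → Λ h = ∫ x, h x * k x ∂ν)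
    (w : X → ℝ≥0) (hw : Measurable w) (hM : ∃ M : ℝ≥0, ∀ x, w x ≤ M) :
    ∫⁻ x, w x * ‖k x‖ₑ ∂ν ≤ a * eLpNorm (fun x => (w x : ℝ)) r ν := by
  obtain ⟨M, hM⟩ := hM
  set g : X → ℝ := fun x => w x * SignType.sign (k x) with hg
  have hgm : Measurable g := by
    have : g = fun x => if 0 < k x then (w x : ℝ) else if k x < 0 then -(w x : ℝ) else 0 := by
      funext x
      rcases lt_trichotomy (k x) 0 with h | h | h
      · simp [hg, h, h.not_gt]
      · simp [hg, h]
      · simp [hg, h]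
    rw [this]
    have hw' : Measurable fun x => (w x : ℝ) := hw.coe_nnreal_real
    exact Measurable.ite (measurableSet_lt measurable_const hkm) hw'
      (Measurable.ite (measurableSet_lt hkm measurable_const) hw'.neg measurable_const)
  have hgw : ∀ x, ‖g x‖ ≤ w x := fun x => by
    rcases lt_trichotomy (k x) 0 with h | h | h <;> simp [hg, h]
  have hgk : ∀ x, g x * k x = w x * ‖k x‖ := fun x => by
    rw [hg, Real.norm_eq_abs, ← sign_mul_self (k x)]
    ring
  have hgL : MemLp g r ν := MemLp.of_bound hgm.aestronglyMeasurable M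
    (Eventually.of_forall fun x => (hgw x).trans (by exact_mod_cast hM x))
  have h1 : Λ (hgL.toLp g) = ∫ x, w x * ‖k x‖ ∂ν := by
    rw [hk]
    · refine integral_congr_ae ?_
      filter_upwards [hgL.coeFn_toLp] with x hx
      rw [hx, hgk]
    · refine ⟨M, ?_⟩
      filter_upwards [hgL.coeFn_toLp] with x hx
      rw [hx]
      exact (hgw x).trans (by exact_mod_cast hM x)
  have hint : Integrable (fun x => w x * ‖k x‖) ν :=
    hki.norm.bdd_mul hw.coe_nnreal_real.aestronglyMeasurable (c := M)
      (Eventually.of_forall fun x => by simpa using hM x)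
  have h2 : ∫⁻ x, w x * ‖k x‖ₑ ∂ν = ENNReal.ofReal (Λ (hgL.toLp g)) := by
    rw [h1, ofReal_integral_eq_lintegral_ofReal hint (Eventually.of_forall fun x => by positivity)]
    refine lintegral_congr fun x => ?_
    rw [ENNReal.ofReal_mul (by positivity), ENNReal.ofReal_coe_nnreal, ofReal_norm]
  rw [h2]
  calc ENNReal.ofReal (Λ (hgL.toLp g)) ≤ ENNReal.ofReal (a * ‖hgL.toLp g‖) :=
        ENNReal.ofReal_le_ofReal ((Real.le_norm_self _).trans (ha _))
    _ = a * eLpNorm g r ν := by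
        rw [ENNReal.ofReal_mul (NNReal.coe_nonneg a), ENNReal.ofReal_coe_nnreal, Lp.norm_toLp,
          ENNReal.ofReal_toReal hgL.2.ne]
    _ ≤ a * eLpNorm (fun x => (w x : ℝ)) r ν := by
        gcongr
        exact eLpNorm_mono_real hgw

/-- **Dual of `L^r`**: a density representing a functional on `L^r` lies in `L^s`, with `s` the
conjugate exponent, and its norm there is at most that of the functional. -/
theorem eLpNorm_le_of_forall_eq_integral_mul [IsFiniteMeasure ν] {r s : ℝ≥0∞}
    [Fact (1 ≤ r)] (hr : r ≠ ∞) (hrs : ENNReal.HolderConjugate r s)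
    {Λ : Lp ℝ r ν →L[ℝ] ℝ} {a : ℝ≥0} (ha : ∀ h, ‖Λ h‖ ≤ a * ‖h‖)
    {k : X → ℝ} (hkm : Measurable k) (hki : Integrable k ν)
    (hk : ∀ h : Lp ℝ r ν, (∃ M : ℝ, ∀ᵐ x ∂ν, ‖h x‖ ≤ M) → Λ h = ∫ x, h x * k x ∂ν) :
    eLpNorm k s ν ≤ a := by
  have key := lintegral_mul_enorm_le_of_forall_eq_integral_mul ha hkm hki hk
  have hr0 : r ≠ 0 := (one_pos.trans_le (Fact.out : 1 ≤ r)).ne'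
  rcases eq_or_ne s ∞ with rfl | hs
  · have hr1 : r = 1 := by simpa using ENNReal.holderConjugate_iff.1 hrs
    subst hr1
    rw [eLpNorm_exponent_top]
    refine essSup_le_of_ae_le _ ?_
    refine ae_le_of_forall_setLIntegral_le_of_sigmaFinite (g := fun _ => (a : ℝ≥0∞))
      hkm.enorm fun S hS _ => ?_
    have h1 := key (S.indicator fun _ => 1) (measurable_const.indicator hS)
      ⟨1, fun x => indicator_apply_le' (fun _ => le_rfl) fun _ => zero_le_one⟩
    have e1 : ∫⁻ x, ((S.indicator (fun _ => (1 : ℝ≥0)) x : ℝ≥0) : ℝ≥0∞) * ‖k x‖ₑ ∂ν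
        = ∫⁻ x in S, ‖k x‖ₑ ∂ν := by
      rw [← lintegral_indicator hS]
      refine lintegral_congr fun x => ?_
      by_cases hx : x ∈ S <;> simp [hx]
    have e2 : eLpNorm (fun x => ((S.indicator (fun _ => (1 : ℝ≥0)) x : ℝ≥0) : ℝ)) 1 ν = ν S := by
      have : (fun x => ((S.indicator (fun _ => (1 : ℝ≥0)) x : ℝ≥0) : ℝ))
          = S.indicator fun _ => (1 : ℝ) := by
        funext x
        by_cases hx : x ∈ S <;> simp [hx]
      rw [this, eLpNorm_indicator_const hS (by simp) (by simp)]
      simp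
    rw [e1, e2] at h1
    rw [setLIntegral_const]
    exact h1
  · have hs1 : s ≠ 0 := by
      rintro rfl
      simpa using ENNReal.holderConjugate_iff.1 hrs
    have hpq : s.toReal.HolderConjugate r.toReal := by
      have e := ENNReal.holderConjugate_iff.1 hrs
      have e' : r.toReal⁻¹ + s.toReal⁻¹ = 1 := by
        rw [← ENNReal.toReal_inv, ← ENNReal.toReal_inv, ← ENNReal.toReal_add, e,
          ENNReal.toReal_one] <;> simpa
      have h1 : 0 < r.toReal := ENNReal.toReal_pos hr0 hr
      have h2 : 0 < s.toReal := ENNReal.toReal_pos hs1 hs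
      exact ⟨by rw [add_comm, e', inv_one], h2, h1⟩
    have hspos : 0 < s.toReal := hpq.pos
    have h1 := lintegral_rpow_le_of_forall_bounded hpq hkm.enorm (a : ℝ≥0∞) (ν := ν)
      fun w hw hM => by
        refine (key w hw hM).trans_eq ?_
        rw [eLpNorm_eq_lintegral_rpow_enorm_toReal hr0 hr]
        simp
    rw [eLpNorm_eq_lintegral_rpow_enorm_toReal hs1 hs]
    calc _ ≤ ((a : ℝ≥0∞) ^ s.toReal) ^ (1 / s.toReal) :=
          ENNReal.rpow_le_rpow h1 (by positivity)
      _ = a := by rw [← ENNReal.rpow_mul, mul_one_div_cancel hspos.ne', ENNReal.rpow_one]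

end LpDuality

/-! ### The adjoint of an operator with scalar input -/

section DualDensity

open Filter Topology

variable {X : Type*} [MeasurableSpace X] {ν σ : Measure X}
  {B : Type*} [NormedAddCommGroup B] [NormedSpace ℝ B] {r : ℝ≥0∞} [Fact (1 ≤ r)]

/-- `k` is the adjoint of `U` evaluated at the dual-valued function `g`: it is the function such
that `∫ ⟨g, U h⟩ = ∫ h k` for all bounded `h`. -/
structure IsDualDensity (U : Lp ℝ r ν →L[ℝ] Lp B r σ) (g : X → StrongDual ℝ B) (k : X → ℝ) :
    Prop where
  measurable : Measurable k
  integrable : Integrable k ν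
  integral_eq : ∀ h : Lp ℝ r ν, (∃ M : ℝ, ∀ᵐ x ∂ν, ‖h x‖ ≤ M) →
    ∫ x, g x (U h x) ∂σ = ∫ x, h x * k x ∂ν

theorem memLp_of_stronglyMeasurable_of_forall_norm_le {H : Type*} [NormedAddCommGroup H]
    [IsFiniteMeasure σ] {g : X → H} (hg : StronglyMeasurable g) {M : ℝ} (hM : ∀ x, ‖g x‖ ≤ M)
    (p : ℝ≥0∞) : MemLp g p σ :=
  MemLp.of_bound hg.aestronglyMeasurable M (Eventually.of_forall hM)

theorem integrable_apply_of_memLp_top [IsFiniteMeasure σ] {g : X → StrongDual ℝ B} {u : X → B}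
    (hg : MemLp g ∞ σ) (hu : MemLp u r σ) : Integrable (fun x => g x (u x)) σ := by
  rw [← memLp_one_iff_integrable]
  exact (ContinuousLinearMap.id ℝ (StrongDual ℝ B)).memLp_of_bilin 1 hg
    (hu.mono_exponent (Fact.out : 1 ≤ r))

/-- The functional `h ↦ ∫ ⟨g, U h⟩` has norm at most `‖U‖ ‖g‖_s`. -/
theorem exists_clm_eq_integral_apply {s : ℝ≥0∞} [hrs : ENNReal.HolderConjugate r s]
    {U : Lp ℝ r ν →L[ℝ] Lp B r σ} {A : ℝ≥0} (hU : ∀ h, ‖U h‖ ≤ A * ‖h‖)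
    {g : X → StrongDual ℝ B} (hg : MemLp g s σ) :
    ∃ Λ : Lp ℝ r ν →L[ℝ] ℝ, (∀ h, Λ h = ∫ x, g x (U h x) ∂σ) ∧
      ∀ h, ‖Λ h‖ ≤ (A * (eLpNorm g s σ).toNNReal : ℝ≥0) * ‖h‖ := by
  have : Fact (1 ≤ s) := ⟨ENNReal.HolderConjugate.one_le s r⟩
  set ι := ContinuousLinearMap.id ℝ (StrongDual ℝ B)
  have hΛ : ∀ h, ((ι.lpPairing σ s r (hg.toLp g)).comp U) h = ∫ x, g x (U h x) ∂σ := by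
    intro h
    rw [ContinuousLinearMap.comp_apply, ContinuousLinearMap.lpPairing_eq_integral]
    refine integral_congr_ae ?_
    filter_upwards [hg.coeFn_toLp] with x hx
    rw [hx]
    rfl
  refine ⟨_, hΛ, fun h => ?_⟩
  rw [ContinuousLinearMap.comp_apply, ContinuousLinearMap.lpPairing_eq_integral]
  have h1 : ‖∫ x, ι (hg.toLp g x) (U h x) ∂σ‖ ≤ ‖ι.holder 1 (hg.toLp g) (U h)‖ := by
    rw [← integral_congr_ae (ι.coeFn_holder (r := 1) (hg.toLp g) (U h)), L1.norm_eq_integral_norm]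
    exact norm_integral_le_integral_norm _
  refine h1.trans ((ι.norm_holder_apply_apply_le _ _).trans ?_)
  have h2 : ‖ι‖ ≤ 1 := ContinuousLinearMap.norm_id_le
  rw [Lp.norm_toLp]
  calc ‖ι‖ * (eLpNorm g s σ).toReal * ‖U h‖ ≤ 1 * (eLpNorm g s σ).toReal * (A * ‖h‖) := by
        gcongr
        exact hU h
    _ = _ := by
        rw [NNReal.coe_mul]
        change _ = A * (eLpNorm g s σ).toReal * ‖h‖
        ring

theorem exists_isDualDensity [IsFiniteMeasure ν] (hr : r ≠ ∞) {s : ℝ≥0∞}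
    [hrs : ENNReal.HolderConjugate r s] (U : Lp ℝ r ν →L[ℝ] Lp B r σ)
    {g : X → StrongDual ℝ B} (hg : MemLp g s σ) : ∃ k, IsDualDensity U g k := by
  obtain ⟨Λ, hΛ, -⟩ := exists_clm_eq_integral_apply (A := ‖U‖₊) U.le_opNorm hg
  obtain ⟨k, hkm, hki, hk⟩ := exists_integrable_forall_eq_integral_mul hr Λ
  exact ⟨k, hkm, hki, fun h hh => by rw [← hΛ, hk h hh]⟩

theorem IsDualDensity.eLpNorm_le [IsFiniteMeasure ν] (hr : r ≠ ∞) {s : ℝ≥0∞}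
    [hrs : ENNReal.HolderConjugate r s] {U : Lp ℝ r ν →L[ℝ] Lp B r σ}
    {A : ℝ≥0} (hU : ∀ h, ‖U h‖ ≤ A * ‖h‖) {g : X → StrongDual ℝ B} (hg : MemLp g s σ)
    {k : X → ℝ} (hk : IsDualDensity U g k) : eLpNorm k s ν ≤ A * eLpNorm g s σ := by
  obtain ⟨Λ, hΛ, hΛle⟩ := exists_clm_eq_integral_apply hU hg
  have := eLpNorm_le_of_forall_eq_integral_mul hr hrs hΛle hk.measurable hk.integrable
    fun h hh => by rw [hΛ, hk.integral_eq h hh]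
  rwa [ENNReal.coe_mul, ENNReal.coe_toNNReal hg.2.ne] at this

theorem IsDualDensity.add_ae_eq [IsFiniteMeasure ν] [IsFiniteMeasure σ]
    {U : Lp ℝ r ν →L[ℝ] Lp B r σ} {g₁ g₂ : X → StrongDual ℝ B}
    (hg₁ : MemLp g₁ ∞ σ) (hg₂ : MemLp g₂ ∞ σ) {k k₁ k₂ : X → ℝ}
    (hk : IsDualDensity U (g₁ + g₂) k) (hk₁ : IsDualDensity U g₁ k₁)
    (hk₂ : IsDualDensity U g₂ k₂) : k =ᵐ[ν] k₁ + k₂ := by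
  refine hk.integrable.ae_eq_of_forall_setIntegral_eq _ _ (hk₁.integrable.add hk₂.integrable)
    fun S hS _ => ?_
  have hb : ∃ M : ℝ, ∀ᵐ x ∂ν, ‖indicatorConstLp r hS (measure_ne_top ν S) (1 : ℝ) x‖ ≤ M := by
    refine ⟨1, ?_⟩
    filter_upwards [indicatorConstLp_coeFn (p := r) (hs := hS) (hμs := measure_ne_top ν S)
      (c := (1 : ℝ))] with x hx
    rw [hx]
    by_cases hxS : x ∈ S <;> simp [hxS]
  have key : ∀ k' : X → ℝ,
      ∫ x, indicatorConstLp r hS (measure_ne_top ν S) (1 : ℝ) x * k' x ∂ν = ∫ x in S, k' x ∂ν := by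
    intro k'
    rw [← integral_indicator hS]
    refine integral_congr_ae ?_
    filter_upwards [indicatorConstLp_coeFn (p := r) (hs := hS) (hμs := measure_ne_top ν S)
      (c := (1 : ℝ))] with x hx
    rw [hx]
    by_cases hxS : x ∈ S <;> simp [hxS]
  rw [← key k, ← hk.integral_eq _ hb, integral_add' hk₁.integrable.integrableOn
    hk₂.integrable.integrableOn, ← key k₁, ← key k₂, ← hk₁.integral_eq _ hb,
    ← hk₂.integral_eq _ hb, ← integral_add (integrable_apply_of_memLp_top hg₁ (Lp.memLp _))
      (integrable_apply_of_memLp_top hg₂ (Lp.memLp _))]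
  simp

/-- Chebyshev's inequality for the dual density of a bounded `g`, at a level `τ` above
`A * ‖g‖_∞`; the exponent `s` has disappeared from the bound. -/
theorem IsDualDensity.mul_measure_le_of_bounded [IsFiniteMeasure ν] [IsFiniteMeasure σ]
    (hr : r ≠ ∞) {s : ℝ≥0∞} [hrs : ENNReal.HolderConjugate r s] {U : Lp ℝ r ν →L[ℝ] Lp B r σ}
    {A : ℝ≥0} (hU : ∀ h, ‖U h‖ ≤ A * ‖h‖) {g : X → StrongDual ℝ B}
    (hg : AEStronglyMeasurable g σ)
    {m τ : ℝ≥0} (hm : ∀ᵐ x ∂σ, ‖g x‖ₑ ≤ m) (hτ : 0 < τ) (hAm : A * m ≤ τ)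
    {k : X → ℝ} (hk : IsDualDensity U g k) :
    τ * ν {x | (τ : ℝ≥0∞) < ‖k x‖ₑ} ≤ A * ∫⁻ x, ‖g x‖ₑ ∂σ := by
  have hgs : MemLp g s σ := MemLp.of_enorm_bound hg ENNReal.coe_ne_top hm
  have hle := hk.eLpNorm_le hr hU hgs
  have hs0 : s ≠ 0 := (ENNReal.HolderConjugate.pos s r).ne'
  rcases eq_or_ne s ∞ with rfl | hs
  · have h1 : eLpNorm k ∞ ν ≤ τ := by
      refine hle.trans ((mul_le_mul_right (essSup_le_of_ae_le _ hm) _).trans ?_)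
      exact_mod_cast hAm
    have h2 : ν {x | (τ : ℝ≥0∞) < ‖k x‖ₑ} = 0 := by
      have : ∀ᵐ x ∂ν, ‖k x‖ₑ ≤ τ := by
        rw [eLpNorm_exponent_top] at h1
        filter_upwards [enorm_ae_le_eLpNormEssSup k ν] with x hx using hx.trans h1
      simpa only [not_le] using ae_iff.1 this
    rw [h2, mul_zero]
    exact zero_le
  · have hs1 : 1 ≤ s.toReal := by
      rw [← ENNReal.toReal_one]
      exact ENNReal.toReal_mono hs (ENNReal.HolderConjugate.one_le s r)
    have hspos : 0 < s.toReal := by linarith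
    have hτ0 : (τ : ℝ≥0∞) ≠ 0 := by exact_mod_cast hτ.ne'
    have h1 : (τ : ℝ≥0∞) ^ s.toReal * ν {x | (τ : ℝ≥0∞) < ‖k x‖ₑ} ≤
        ∫⁻ x, ‖k x‖ₑ ^ s.toReal ∂ν := by
      refine le_trans ?_ (mul_meas_ge_le_lintegral (hk.measurable.enorm.pow_const _)
        ((τ : ℝ≥0∞) ^ s.toReal))
      gcongr with x
      exact fun hx => ENNReal.rpow_le_rpow (le_of_lt hx) hspos.le
    have h2 : ∫⁻ x, ‖k x‖ₑ ^ s.toReal ∂ν ≤ A ^ s.toReal * ∫⁻ x, ‖g x‖ₑ ^ s.toReal ∂σ := by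
      rw [eLpNorm_eq_lintegral_rpow_enorm_toReal hs0 hs,
        eLpNorm_eq_lintegral_rpow_enorm_toReal hs0 hs] at hle
      have := ENNReal.rpow_le_rpow hle hspos.le
      rwa [ENNReal.mul_rpow_of_nonneg _ _ hspos.le, ← ENNReal.rpow_mul, ← ENNReal.rpow_mul,
        one_div_mul_cancel hspos.ne', ENNReal.rpow_one, ENNReal.rpow_one] at this
    have hsplit : ∀ a : ℝ≥0∞, a ^ s.toReal = a ^ (s.toReal - 1) * a := fun a => by
      conv_lhs => rw [← sub_add_cancel s.toReal 1,
        ENNReal.rpow_add_of_nonneg _ _ (by linarith) zero_le_one, ENNReal.rpow_one]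
    have h3 : ∫⁻ x, ‖g x‖ₑ ^ s.toReal ∂σ ≤ (m : ℝ≥0∞) ^ (s.toReal - 1) * ∫⁻ x, ‖g x‖ₑ ∂σ := by
      rw [← lintegral_const_mul' _ _ (ENNReal.rpow_ne_top_of_nonneg (by linarith)
        ENNReal.coe_ne_top)]
      refine lintegral_mono_ae ?_
      filter_upwards [hm] with x hx
      rw [hsplit]
      gcongr
    have h4 : (τ : ℝ≥0∞) ^ (s.toReal - 1) * (τ * ν {x | (τ : ℝ≥0∞) < ‖k x‖ₑ}) ≤
        (τ : ℝ≥0∞) ^ (s.toReal - 1) * (A * ∫⁻ x, ‖g x‖ₑ ∂σ) := by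
      rw [← mul_assoc, ← hsplit]
      refine (h1.trans (h2.trans (mul_le_mul_right h3 _))).trans ?_
      have hAm' : (A : ℝ≥0∞) * m ≤ τ := by exact_mod_cast hAm
      calc (A : ℝ≥0∞) ^ s.toReal * ((m : ℝ≥0∞) ^ (s.toReal - 1) * ∫⁻ x, ‖g x‖ₑ ∂σ)
          = ((A : ℝ≥0∞) * m) ^ (s.toReal - 1) * (A * ∫⁻ x, ‖g x‖ₑ ∂σ) := by
            rw [hsplit A, ENNReal.mul_rpow_of_nonneg _ _ (by linarith)]
            ring
        _ ≤ _ := by gcongr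
    refine (ENNReal.mul_le_mul_iff_right ?_ ?_).1 h4
    · simp [ENNReal.rpow_eq_zero_iff, hτ0]
    · exact ENNReal.rpow_ne_top_of_nonneg (by linarith) ENNReal.coe_ne_top

end DualDensity

/-! ### Oscillation and the bad part -/

section WeakType

open Filter Topology

/-- If `u` oscillates by at most `C` on `S`, then replacing a dual-valued `g` on `Q ⊆ S` by a
constant of the same integral on `P ⊆ S` changes the pairing with `u` by at most `C ∫ ‖g‖`. -/
theorem norm_setIntegral_apply_sub_le {X : Type*} [MeasurableSpace X] {μ : Measure X}
    {B : Type*} [NormedAddCommGroup B] [NormedSpace ℝ B] [CompleteSpace B]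
    {Q P S : Set X} (hQS : Q ⊆ S) (hPS : P ⊆ S)
    (hP0 : μ P ≠ 0) (hS : μ S ≠ ∞) {u : X → B} (hu : IntegrableOn u S μ)
    {g : X → StrongDual ℝ B} (hg : StronglyMeasurable g) {M : ℝ} (hM : ∀ x, ‖g x‖ ≤ M) {C : ℝ}
    (hosc : ∀ᵐ x ∂μ.restrict S, ∀ᵐ x' ∂μ.restrict S, ‖u x - u x'‖ ≤ C) :
    ‖∫ x in Q, g x (u x) ∂μ - ∫ x in P, ((μ.real P)⁻¹ • ∫ y in Q, g y ∂μ) (u x) ∂μ‖ ≤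
      C * ∫ x in Q, ‖g x‖ ∂μ := by
  have hPt : μ P ≠ ∞ := measure_ne_top_of_subset hPS hS
  have hQt : μ Q ≠ ∞ := measure_ne_top_of_subset hQS hS
  have : IsFiniteMeasure (μ.restrict Q) := ⟨by simpa using hQt.lt_top⟩
  have hgQ : Integrable g (μ.restrict Q) :=
    Integrable.of_bound hg.aestronglyMeasurable M (Eventually.of_forall hM)
  set m : B := ⨍ x in P, u x ∂μ with hm
  have e1 : ∫ x in P, ((μ.real P)⁻¹ • ∫ y in Q, g y ∂μ) (u x) ∂μ = ∫ x in Q, g x m ∂μ := by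
    rw [ContinuousLinearMap.integral_comp_comm _ (hu.mono_set hPS),
      ← ContinuousLinearMap.integral_apply hgQ, hm, setAverage_eq, map_smul,
      smul_apply]
  have hgu : Integrable (fun x => g x (u x)) (μ.restrict Q) :=
    integrable_apply_of_memLp_top (r := 1)
      (memLp_top_of_bound hg.aestronglyMeasurable M (Eventually.of_forall hM))
      (memLp_one_iff_integrable.2 (hu.mono_set hQS))
  have hgm : Integrable (fun x => g x m) (μ.restrict Q) := hgQ.apply_continuousLinearMap m
  rw [e1, ← integral_sub hgu hgm, ← integral_const_mul]
  refine norm_integral_le_of_norm_le (hgQ.norm.const_mul C) ?_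
  filter_upwards [ae_restrict_of_ae_restrict_of_subset hQS hosc] with x hx
  have hxm : m ∈ Metric.closedBall (u x) C := by
    refine (convex_closedBall (u x) C).set_average_mem Metric.isClosed_closedBall hP0 hPt ?_
      (hu.mono_set hPS)
    filter_upwards [ae_restrict_of_ae_restrict_of_subset hPS hx] with x' hx'
    rwa [Metric.mem_closedBall, dist_comm, dist_eq_norm]
  rw [← map_sub, mul_comm]
  refine ((g x).le_opNorm _).trans ?_
  gcongr
  rwa [← dist_eq_norm, dist_comm]

variable {X : Type*} {H : Type*} [NormedAddCommGroup H] {ι : Type*}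

theorem tsum_indicator_const_eq {P : ι → Set X} (hP : Pairwise (Function.onFun Disjoint P))
    (α : ι → H) {c : ι} {x : X} (hx : x ∈ P c) : ∑' i, (P i).indicator (fun _ => α i) x = α c := by
  rw [tsum_eq_single c, indicator_of_mem hx]
  intro i hi
  exact indicator_of_notMem (fun h => disjoint_left.1 (hP hi) h hx) _

theorem tsum_indicator_const_eq_zero {P : ι → Set X} (α : ι → H) {x : X} (hx : x ∉ ⋃ i, P i) :
    ∑' i, (P i).indicator (fun _ => α i) x = 0 := by
  rw [mem_iUnion, not_exists] at hx
  simp [indicator_of_notMem (hx _)]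

variable [MeasurableSpace X] {μ : Measure X}

theorem stronglyMeasurable_tsum_indicator [Countable ι] {P : ι → Set X}
    (hPm : ∀ i, MeasurableSet (P i)) (hP : Pairwise (Function.onFun Disjoint P)) (α : ι → H) :
    StronglyMeasurable fun x => ∑' i, (P i).indicator (fun _ => α i) x := by
  refine stronglyMeasurable_of_tendsto (u := atTop)
    (f := fun (F : Finset ι) x => ∑ i ∈ F, (P i).indicator (fun _ => α i) x)
    (fun F => Finset.stronglyMeasurable_fun_sum F fun i _ =>
      stronglyMeasurable_const.indicator (hPm i)) ?_
  refine tendsto_pi_nhds.2 fun x => ?_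
  refine Summable.hasSum ?_
  by_cases hx : x ∈ ⋃ i, P i
  · obtain ⟨c, hc⟩ := mem_iUnion.1 hx
    refine (hasSum_single c fun i hi => ?_).summable
    exact indicator_of_notMem (fun h => disjoint_left.1 (hP hi) h hc) _
  · rw [mem_iUnion, not_exists] at hx
    simp only [indicator_of_notMem (hx _)]
    exact summable_zero

theorem lintegral_enorm_tsum_indicator_le [Countable ι] {P : ι → Set X}
    (hPm : ∀ i, MeasurableSet (P i)) (hP : Pairwise (Function.onFun Disjoint P)) (α : ι → H) :
    ∫⁻ x, ‖∑' i, (P i).indicator (fun _ => α i) x‖ₑ ∂μ ≤ ∑' i, ‖α i‖ₑ * μ (P i) := by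
  have : ∀ x, ‖∑' i, (P i).indicator (fun _ => α i) x‖ₑ ≤
      ∑' i, (P i).indicator (fun _ => ‖α i‖ₑ) x := by
    intro x
    by_cases hx : x ∈ ⋃ i, P i
    · obtain ⟨c, hc⟩ := mem_iUnion.1 hx
      rw [tsum_indicator_const_eq hP α hc]
      refine le_trans ?_ (ENNReal.le_tsum c)
      rw [indicator_of_mem hc]
    · rw [tsum_indicator_const_eq_zero α hx]
      simp
  refine (lintegral_mono this).trans_eq ?_
  rw [lintegral_tsum fun i => (measurable_const.indicator (hPm i)).aemeasurable]
  simp [hPm]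

end WeakType

section WeakType

open Filter Topology

/-- Off the exceptional set `Ω`, the adjoint of the bad part of a Calderón–Zygmund decomposition is
integrable: tested against a bounded `h` vanishing on `Ω`, each piece only sees the oscillation of
`U h`. -/
theorem setLIntegral_compl_enorm_le_of_oscillation {X : Type*} [MeasurableSpace X]
    {μ ν : Measure X} {V : Set X} (hV : MeasurableSet V) [IsFiniteMeasure (μ.restrict V)]
    [IsFiniteMeasure ν] {B : Type*} [NormedAddCommGroup B] [NormedSpace ℝ B] [CompleteSpace B]
    {r : ℝ≥0∞} [Fact (1 ≤ r)] {ι : Type*} [Countable ι] {P Q S : ι → Set X}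
    (hPm : ∀ i, MeasurableSet (P i)) (hPd : Pairwise (Function.onFun Disjoint P))
    (hQm : ∀ i, MeasurableSet (Q i)) (hQd : Pairwise (Function.onFun Disjoint Q))
    (hQS : ∀ i, Q i ⊆ S i) (hPS : ∀ i, P i ⊆ S i) (hSV : ∀ i, S i ⊆ V) (hP0 : ∀ i, μ (P i) ≠ 0)
    {g : X → StrongDual ℝ B} (hg : StronglyMeasurable g) {M : ℝ} (hM : ∀ x, ‖g x‖ ≤ M)
    (hgi : Integrable g μ) {β : X → StrongDual ℝ B}
    (hβ : β = fun x => ∑' i, (P i).indicator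
      (fun _ => (μ.real (P i))⁻¹ • ∫ y in Q i, g y ∂μ) x)
    {M' : ℝ} (hM' : ∀ x, ‖β x‖ ≤ M')
    {U : Lp ℝ r ν →L[ℝ] Lp B r (μ.restrict V)} {C : ℝ≥0} {Ω : Set X} (hΩ : MeasurableSet Ω)
    (hosc : ∀ (i : ι) (h : Lp ℝ r ν), (∀ᵐ y ∂ν, ‖h y‖ ≤ 1) → (∀ᵐ y ∂ν, y ∈ Ω → h y = 0) →
      ∀ᵐ x ∂μ.restrict (S i), ∀ᵐ x' ∂μ.restrict (S i), ‖U h x - U h x'‖ ≤ C)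
    {k : X → ℝ} (hk : IsDualDensity U ((⋃ i, Q i).indicator g - β) k) :
    ∫⁻ x in Ωᶜ, ‖k x‖ₑ ∂ν ≤ C * ∫⁻ x, ‖g x‖ₑ ∂μ := by
  have hkm := hk.measurable
  set h₀ : X → ℝ := Ωᶜ.indicator fun x => (SignType.sign (k x) : ℝ) with hh₀
  have hsm : Measurable fun x => (SignType.sign (k x) : ℝ) := by
    have : (fun x => (SignType.sign (k x) : ℝ))
        = fun x => if 0 < k x then 1 else if k x < 0 then -1 else 0 := by
      funext x
      rcases lt_trichotomy (k x) 0 with h | h | h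
      · simp [h, h.not_gt]
      · simp [h]
      · simp [h]
    rw [this]
    exact Measurable.ite (measurableSet_lt measurable_const hkm) measurable_const
      (Measurable.ite (measurableSet_lt hkm measurable_const) measurable_const measurable_const)
  have h1 : ∀ x, ‖h₀ x‖ ≤ 1 := fun x => by
    by_cases hx : x ∈ Ωᶜ
    · rw [hh₀, indicator_of_mem hx]
      rcases lt_trichotomy (k x) 0 with h | h | h <;> simp [h]
    · rw [hh₀, indicator_of_notMem hx]
      simp
  have hL : MemLp h₀ r ν := MemLp.of_bound (hsm.indicator hΩ.compl).aestronglyMeasurable 1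
    (Eventually.of_forall h1)
  set h : Lp ℝ r ν := hL.toLp h₀ with hh
  have hae : ∀ᵐ y ∂ν, h y = h₀ y := hL.coeFn_toLp
  have hb : ∀ᵐ y ∂ν, ‖h y‖ ≤ 1 := by
    filter_upwards [hae] with y hy
    rw [hy]
    exact h1 y
  have hz : ∀ᵐ y ∂ν, y ∈ Ω → h y = 0 := by
    filter_upwards [hae] with y hy hyΩ
    rw [hy, hh₀, indicator_of_notMem (notMem_compl_iff.2 hyΩ)]
  set u : X → B := ⇑(U h) with hu
  have hui : Integrable u (μ.restrict V) :=
    memLp_one_iff_integrable.1 ((Lp.memLp (U h)).mono_exponent (Fact.out : 1 ≤ r))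
  have hQV : ⋃ i, Q i ⊆ V := iUnion_subset fun i => (hQS i).trans (hSV i)
  have hPV : ⋃ i, P i ⊆ V := iUnion_subset fun i => (hPS i).trans (hSV i)
  have hVfin : μ V ≠ ∞ := by
    have := measure_ne_top (μ.restrict V) univ
    rwa [Measure.restrict_apply_univ] at this
  have hUQ : MeasurableSet (⋃ i, Q i) := MeasurableSet.iUnion hQm
  have hUP : MeasurableSet (⋃ i, P i) := MeasurableSet.iUnion hPm
  have hβm : StronglyMeasurable β := hβ ▸ stronglyMeasurable_tsum_indicator hPm hPd _
  have hgu : Integrable (fun x => g x (u x)) (μ.restrict V) :=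
    integrable_apply_of_memLp_top (memLp_of_stronglyMeasurable_of_forall_norm_le hg hM _)
      (Lp.memLp (U h))
  have hβu : Integrable (fun x => β x (u x)) (μ.restrict V) :=
    integrable_apply_of_memLp_top (memLp_of_stronglyMeasurable_of_forall_norm_le hβm hM' _)
      (Lp.memLp (U h))
  have hpair : ∫ x, ((⋃ i, Q i).indicator g - β) x (u x) ∂μ.restrict V
      = ∫ x in ⋃ i, Q i, g x (u x) ∂μ - ∫ x in ⋃ i, P i, β x (u x) ∂μ := by
    have e1 : ∫ x in ⋃ i, Q i, g x (u x) ∂μ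
        = ∫ x in V, (⋃ i, Q i).indicator (fun x => g x (u x)) x ∂μ := by
      rw [setIntegral_indicator hUQ, inter_eq_right.2 hQV]
    have e2 : ∫ x in ⋃ i, P i, β x (u x) ∂μ = ∫ x in V, β x (u x) ∂μ := by
      symm
      refine setIntegral_eq_of_subset_of_forall_sdiff_eq_zero hV hPV fun x hx => ?_
      rw [hβ]
      simp only [tsum_indicator_const_eq_zero _ hx.2, zero_apply]
    rw [e1, e2, ← integral_sub (hgu.indicator hUQ) hβu]
    refine integral_congr_ae (Eventually.of_forall fun x => ?_)
    by_cases hx : x ∈ ⋃ i, Q i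
    · simp only [Pi.sub_apply, indicator_of_mem hx, sub_apply]
    · simp only [Pi.sub_apply, indicator_of_notMem hx, sub_apply, zero_apply]
  have hs1 := hasSum_integral_iUnion hQm hQd (f := fun x => g x (u x)) (μ := μ)
    (IntegrableOn.mono_set hgu hQV)
  have hs2 := hasSum_integral_iUnion hPm hPd (f := fun x => β x (u x)) (μ := μ)
    (IntegrableOn.mono_set hβu hPV)
  have hs3 := (hasSum_integral_iUnion hQm hQd (f := fun x => ‖g x‖) (μ := μ)
    hgi.norm.integrableOn).mul_left (C : ℝ)
  have hbound : ‖∫ x, ((⋃ i, Q i).indicator g - β) x (u x) ∂μ.restrict V‖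
      ≤ C * ∫ x in ⋃ i, Q i, ‖g x‖ ∂μ := by
    rw [hpair]
    refine (hs1.sub hs2).norm_le_of_bounded hs3 fun i => ?_
    have e : ∫ x in P i, β x (u x) ∂μ
        = ∫ x in P i, ((μ.real (P i))⁻¹ • ∫ y in Q i, g y ∂μ) (u x) ∂μ := by
      refine setIntegral_congr_fun (hPm i) fun x hx => ?_
      simp only [hβ, tsum_indicator_const_eq hPd _ hx]
    rw [e]
    exact norm_setIntegral_apply_sub_le (hQS i) (hPS i) (hP0 i)
      (measure_ne_top_of_subset (hSV i) hVfin) (IntegrableOn.mono_set hui (hSV i)) hg hM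
      (hosc i h hb hz)
  have hki : ∫ x in Ωᶜ, ‖k x‖ ∂ν = ∫ x, ((⋃ i, Q i).indicator g - β) x (u x) ∂μ.restrict V := by
    rw [hk.integral_eq h ⟨1, hb⟩, ← integral_indicator hΩ.compl]
    refine integral_congr_ae ?_
    filter_upwards [hae] with y hy
    rw [hy]
    by_cases hyΩ : y ∈ Ωᶜ
    · simp only [hh₀, indicator_of_mem hyΩ, sign_mul_self, Real.norm_eq_abs]
    · simp only [hh₀, indicator_of_notMem hyΩ, zero_mul]
  rw [← ofReal_integral_norm_eq_lintegral_enorm hk.integrable.integrableOn,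
    ← ofReal_integral_norm_eq_lintegral_enorm hgi, hki, ← ENNReal.ofReal_coe_nnreal,
    ← ENNReal.ofReal_mul C.coe_nonneg]
  refine ENNReal.ofReal_le_ofReal ((Real.le_norm_self _).trans (hbound.trans ?_))
  gcongr ?_ * ?_
  exact setIntegral_le_integral hgi.norm (Eventually.of_forall fun x => norm_nonneg _)

end WeakType

/-! ### Weak type `(1, 1)` of the adjoint -/

section WeakType

open Filter Topology

section

variable {X : Type*} [MeasurableSpace X] {μ : Measure X}

theorem integrable_of_bounded_of_support_subset {H : Type*} [NormedAddCommGroup H] {V : Set X}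
    [IsFiniteMeasure (μ.restrict V)] {g : X → H} (hg : StronglyMeasurable g) {M : ℝ}
    (hM : ∀ x, ‖g x‖ ≤ M) (hsupp : ∀ x ∉ V, g x = 0) : Integrable g μ := by
  rw [← integrableOn_iff_integrable_of_support_subset (s := V)
    (fun x hx => by_contra fun h => hx (hsupp x h))]
  exact memLp_one_iff_integrable.1 (memLp_of_stronglyMeasurable_of_forall_norm_le hg hM 1)

theorem lintegral_enorm_indicator_add_le {H : Type*} [NormedAddCommGroup H] {S : Set X}
    (hS : MeasurableSet S) {g : X → H} (hg : StronglyMeasurable g) (β : X → H) :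
    ∫⁻ x, ‖(S.indicator g + β) x‖ₑ ∂μ ≤ ∫⁻ x in S, ‖g x‖ₑ ∂μ + ∫⁻ x, ‖β x‖ₑ ∂μ := by
  calc ∫⁻ x, ‖(S.indicator g + β) x‖ₑ ∂μ ≤ ∫⁻ x, ‖S.indicator g x‖ₑ + ‖β x‖ₑ ∂μ :=
        lintegral_mono fun x => enorm_add_le _ _
    _ = _ := by
        rw [lintegral_add_left (hg.indicator hS).enorm, ← lintegral_indicator hS]
        simp only [enorm_indicator_eq_indicator_enorm]

end

variable {X : Type*} [MetricSpace X] [MeasurableSpace X] [BorelSpace X]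
  {μ ν : Measure X} {B : Type*} [NormedAddCommGroup B] [NormedSpace ℝ B] {r : ℝ≥0∞} [Fact (1 ≤ r)]

/-- The operator `U` maps bounded functions vanishing near a ball centred in `E` to functions that
oscillate by at most `C` on a smaller concentric ball. -/
def HasSmallOscillation (E : Set X) (R : ℝ) {V : Set X} (C : ℝ≥0)
    (U : Lp ℝ r ν →L[ℝ] Lp B r (μ.restrict V)) : Prop :=
  ∀ c ∈ E, ∀ δ : ℝ, 0 < δ → 8 * δ ≤ R → ∀ h : Lp ℝ r ν, (∀ᵐ y ∂ν, ‖h y‖ ≤ 1) →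
    (∀ᵐ y ∂ν, y ∈ Metric.ball c (16 * δ) → h y = 0) →
    ∀ᵐ x ∂μ.restrict (Metric.closedBall c (2 * δ)),
      ∀ᵐ x' ∂μ.restrict (Metric.closedBall c (2 * δ)), ‖U h x - U h x'‖ ≤ C

/-- **Weak type `(1, 1)`** of the adjoint of an operator that is bounded on `L^r` and has small
oscillation. The height of the Calderón–Zygmund decomposition is chosen as `t / (2 D² A)`, so that
the adjoint of the good part, bounded by `D²` times the height, is controlled at level `t / 2`; the
doubling constant then multiplies only `A`. -/
theorem IsDualDensity.mul_measure_le [SecondCountableTopology X]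
    [IsLocallyFiniteMeasure μ] [μ.IsOpenPosMeasure] [CompleteSpace B]
    {R : ℝ} (hR : 0 < R) {D : ℝ≥0} (hD1 : 1 ≤ D)
    (hdbl : ∀ (x : X) (s : ℝ), 0 < s → s ≤ R →
      μ (Metric.ball x (2 * s)) ≤ D * μ (Metric.ball x s))
    {E V : Set X} (hdiam : ∀ x ∈ E, ∀ y ∈ E, dist x y < R) (hν : ν = μ.restrict E)
    (hV : MeasurableSet V) (hEV : ∀ c ∈ E, Metric.ball c (R / 2) ⊆ V)
    [IsFiniteMeasure (μ.restrict V)] [IsFiniteMeasure ν]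
    (hr : r ≠ ∞) {s : ℝ≥0∞} [hrs : ENNReal.HolderConjugate r s]
    {U : Lp ℝ r ν →L[ℝ] Lp B r (μ.restrict V)} {A : ℝ≥0} (hA : 0 < A)
    (hU : ∀ h, ‖U h‖ ≤ A * ‖h‖) {C : ℝ≥0} (hosc : HasSmallOscillation E R C U)
    {g : X → StrongDual ℝ B} (hg : StronglyMeasurable g) {M : ℝ} (hM : ∀ x, ‖g x‖ ≤ M)
    (hsupp : ∀ x ∉ E, g x = 0) {k : X → ℝ} (hk : IsDualDensity U g k) {t : ℝ≥0} (ht : 0 < t) :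
    t * ν {x | (t : ℝ≥0∞) < ‖k x‖ₑ} ≤ (4 * D ^ 6 * A + 2 * C : ℝ≥0) * ∫⁻ x, ‖g x‖ₑ ∂μ := by
  have hD0 : 0 < D := one_pos.trans_le hD1
  have hEsub : E ⊆ V := fun c hc => hEV c hc (Metric.mem_ball_self (by linarith))
  have hgi : Integrable g μ := integrable_of_bounded_of_support_subset (V := V) hg hM
    fun x hx => hsupp x fun h => hx (hEsub h)
  have hDB : IsUnifLocDoublingMeasure μ := isUnifLocDoublingMeasure_of_doubling hR hdbl
  have hfin : ∀ x, μ (Metric.closedBall x (R / 4)) < ∞ := fun x =>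
    (measure_mono (Metric.closedBall_subset_ball (by linarith))).trans_lt
      (measure_ball_lt_top_of_doubling hdbl x (s := R) (by linarith))
  set N : ℝ≥0∞ := ∫⁻ x, ‖g x‖ₑ ∂μ with hN
  set l : ℝ≥0 := t / (2 * D ^ 2 * A) with hl
  have htl : t = 2 * D ^ 2 * A * l := by
    rw [hl]
    field_simp
  by_cases hbig : ∃ x ∈ E, l * μ (Metric.closedBall x (R / 4)) <
      ∫⁻ y in Metric.closedBall x (R / 4), ‖g y‖ₑ ∂μ
  · -- The height is below the mean of `g` at the scale of `E`, and the trivial bound suffices.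
    obtain ⟨x, hx, hlt⟩ := hbig
    have h1 : ν univ ≤ D ^ 2 * μ (Metric.closedBall x (R / 4)) := by
      rw [hν, Measure.restrict_apply_univ]
      calc μ E ≤ μ (Metric.ball x (2 ^ 2 * (R / 4))) := measure_mono fun y hy => by
            rw [Metric.mem_ball]
            linarith [hdiam y hy x hx]
        _ ≤ D ^ 2 * μ (Metric.ball x (R / 4)) :=
            measure_ball_two_pow_le hdbl x 2 _ (by linarith) (by linarith)
        _ ≤ _ := by gcongr; exact Metric.ball_subset_closedBall
    calc (t : ℝ≥0∞) * ν {x | (t : ℝ≥0∞) < ‖k x‖ₑ}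
        ≤ t * (D ^ 2 * μ (Metric.closedBall x (R / 4))) := by
          gcongr
          exact (measure_mono (subset_univ _)).trans h1
      _ = (2 * D ^ 4 * A : ℝ≥0) * (l * μ (Metric.closedBall x (R / 4))) := by
          rw [htl]
          push_cast
          ring
      _ ≤ (2 * D ^ 4 * A : ℝ≥0) * N := by
          gcongr
          exact hlt.le.trans (setLIntegral_le_lintegral _ _)
      _ ≤ _ := by
          gcongr
          calc 2 * D ^ 4 * A ≤ 4 * D ^ 6 * A := by
                gcongr
                · norm_num
                · norm_num
            _ ≤ _ := le_self_add
  push Not at hbig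
  obtain ⟨u, δ, huE, huc, hδ, hdisj, hlow, hhigh, hsmall⟩ :=
    exists_calderonZygmund_balls hgi (show (0 : ℝ) < R / 4 by positivity) l hfin E hbig
  have : Countable u := huc.to_subtype
  set P : u → Set X := fun c => Metric.closedBall c (δ c) with hP
  set S : u → Set X := fun c => Metric.closedBall c (2 * δ c) with hS
  have hPm : ∀ c, MeasurableSet (P c) := fun c => Metric.isClosed_closedBall.measurableSet
  have hSm : ∀ c, MeasurableSet (S c) := fun c => Metric.isClosed_closedBall.measurableSet
  have hPd : Pairwise (Function.onFun Disjoint P) := fun a b hab =>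
    hdisj a.2 b.2 fun h => hab (Subtype.ext h)
  obtain ⟨Q, hQm, hQS, hQd, hQU⟩ := exists_disjoint_measurable_subsets S hSm
  have hPS : ∀ c, P c ⊆ S c := fun c => Metric.closedBall_subset_closedBall (by
    linarith [(hδ c c.2).1])
  have hSV : ∀ c, S c ⊆ V := fun c => (Metric.closedBall_subset_ball (by
    linarith [(hδ c c.2).1, (hδ c c.2).2])).trans (hEV c (huE c.2))
  have hP0 : ∀ c, μ (P c) ≠ 0 := fun c => ((Metric.measure_ball_pos μ _ (hδ c c.2).1).trans_le
    (measure_mono Metric.ball_subset_closedBall)).ne'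
  have hVfin : μ V ≠ ∞ := by
    have := measure_ne_top (μ.restrict V) univ
    rwa [Measure.restrict_apply_univ] at this
  have hPt : ∀ c, μ (P c) ≠ ∞ := fun c =>
    measure_ne_top_of_subset ((hPS c).trans (hSV c)) hVfin
  set α : u → StrongDual ℝ B := fun c => (μ.real (P c))⁻¹ • ∫ y in Q c, g y ∂μ with hα
  set β : X → StrongDual ℝ B := fun x => ∑' c, (P c).indicator (fun _ => α c) x with hβ
  have hαμ : ∀ c, ‖α c‖ₑ * μ (P c) ≤ ∫⁻ y in Q c, ‖g y‖ₑ ∂μ := by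
    intro c
    have hr0 : 0 < μ.real (P c) := ENNReal.toReal_pos (hP0 c) (hPt c)
    have e : μ (P c) = ‖μ.real (P c)‖ₑ := by
      rw [Real.enorm_eq_ofReal hr0.le, Measure.real, ENNReal.ofReal_toReal (hPt c)]
    rw [e, hα, mul_comm, enorm_smul, ← mul_assoc, ← enorm_mul, mul_inv_cancel₀ hr0.ne',
      enorm_one, one_mul]
    exact enorm_integral_le_lintegral_enorm _
  have hαle : ∀ c, ‖α c‖ₑ ≤ (D ^ 2 * l : ℝ≥0) := by
    intro c
    refine (ENNReal.mul_le_mul_iff_left (hP0 c) (hPt c)).1 ((hαμ c).trans ?_)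
    calc ∫⁻ y in Q c, ‖g y‖ₑ ∂μ ≤ ∫⁻ y in S c, ‖g y‖ₑ ∂μ := lintegral_mono_set (hQS c)
      _ ≤ l * μ (S c) := hhigh c c.2
      _ ≤ l * (D ^ 2 * μ (P c)) := by
          gcongr
          exact measure_closedBall_two_mul_le hdbl _ (hδ c c.2).1 (by
            linarith [(hδ c c.2).2])
      _ = _ := by
          push_cast
          ring
  have hβle : ∀ x, ‖β x‖ₑ ≤ (D ^ 2 * l : ℝ≥0) := by
    intro x
    by_cases hx : x ∈ ⋃ c, P c
    · obtain ⟨c, hc⟩ := mem_iUnion.1 hx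
      simp only [hβ, tsum_indicator_const_eq hPd _ hc]
      exact hαle c
    · simp only [hβ, tsum_indicator_const_eq_zero _ hx]
      rw [enorm_eq_nnnorm, nnnorm_zero]
      simp
  have hβM : ∀ x, ‖β x‖ ≤ (D ^ 2 * l : ℝ≥0) := fun x => by
    have := hβle x
    rw [enorm_eq_nnnorm, ENNReal.coe_le_coe] at this
    exact_mod_cast this
  have hβm : StronglyMeasurable β := stronglyMeasurable_tsum_indicator hPm hPd α
  have hUQ : MeasurableSet (⋃ c, Q c) := MeasurableSet.iUnion hQm
  have hPQ : ⋃ c, P c ⊆ ⋃ c, Q c := hQU ▸ iUnion_mono hPS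
  set good : X → StrongDual ℝ B := (⋃ c, Q c)ᶜ.indicator g + β with hgood
  set bad : X → StrongDual ℝ B := (⋃ c, Q c).indicator g - β with hbad
  have hsum : g = good + bad := by
    rw [hgood, hbad, add_add_sub_cancel, indicator_compl_add_self]
  have hind : ∀ (S : Set X) x, ‖S.indicator g x‖ ≤ M := fun S x =>
    (norm_indicator_le_norm_self _ _).trans (hM x)
  have hgoodm : StronglyMeasurable good := (hg.indicator hUQ.compl).add hβm
  have hgoodT : MemLp good ∞ (μ.restrict V) :=
    (memLp_of_stronglyMeasurable_of_forall_norm_le (hg.indicator hUQ.compl) (hind _) _).add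
      (memLp_of_stronglyMeasurable_of_forall_norm_le hβm hβM _)
  have hbadT : MemLp bad ∞ (μ.restrict V) :=
    (memLp_of_stronglyMeasurable_of_forall_norm_le (hg.indicator hUQ) (hind _) _).sub
      (memLp_of_stronglyMeasurable_of_forall_norm_le hβm hβM _)
  obtain ⟨k₁, hk₁⟩ := exists_isDualDensity hr (s := s) U (hgoodT.mono_exponent le_top)
  obtain ⟨k₂, hk₂⟩ := exists_isDualDensity hr (s := s) U (hbadT.mono_exponent le_top)
  have hkeq := (hsum ▸ hk : IsDualDensity U (good + bad) k).add_ae_eq hgoodT hbadT hk₁ hk₂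
  -- The good part.
  have hgoodle : ∀ᵐ x ∂μ.restrict V, ‖good x‖ₑ ≤ (D ^ 2 * l : ℝ≥0) := by
    refine ae_restrict_of_ae ?_
    filter_upwards [hsmall] with x hx
    by_cases hxQ : x ∈ ⋃ c, Q c
    · rw [hgood, Pi.add_apply, indicator_of_notMem (notMem_compl_iff.2 hxQ), zero_add]
      exact hβle x
    · have hxP : x ∉ ⋃ c, P c := fun h => hxQ (hPQ h)
      have e : β x = 0 := tsum_indicator_const_eq_zero _ hxP
      rw [hgood, Pi.add_apply, indicator_of_mem (mem_compl hxQ), e, add_zero]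
      by_cases hxE : x ∈ E
      · refine (hx hxE ?_).trans ?_
        · rwa [biUnion_eq_iUnion, ← hQU]
        · exact_mod_cast le_mul_of_one_le_left zero_le (one_le_pow₀ hD1)
      · rw [hsupp x hxE, enorm_eq_nnnorm, nnnorm_zero]
        simp
  have hgoodN : ∫⁻ x, ‖good x‖ₑ ∂μ.restrict V ≤ N := by
    calc ∫⁻ x, ‖good x‖ₑ ∂μ.restrict V ≤ ∫⁻ x, ‖good x‖ₑ ∂μ := setLIntegral_le_lintegral _ _
      _ ≤ ∫⁻ x in (⋃ c, Q c)ᶜ, ‖g x‖ₑ ∂μ + ∫⁻ x, ‖β x‖ₑ ∂μ :=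
          lintegral_enorm_indicator_add_le hUQ.compl hg β
      _ ≤ ∫⁻ x in (⋃ c, Q c)ᶜ, ‖g x‖ₑ ∂μ + ∫⁻ x in ⋃ c, Q c, ‖g x‖ₑ ∂μ := by
          refine add_le_add le_rfl ?_
          rw [lintegral_iUnion hQm hQd]
          exact (lintegral_enorm_tsum_indicator_le hPm hPd α).trans (ENNReal.tsum_le_tsum hαμ)
      _ = N := by rw [add_comm, lintegral_add_compl _ hUQ]
  have hτ : 0 < t / 2 := by positivity
  have hgood_weak : ((t / 2 : ℝ≥0) : ℝ≥0∞) * ν {x | ((t / 2 : ℝ≥0) : ℝ≥0∞) < ‖k₁ x‖ₑ} ≤ A * N := by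
    refine (hk₁.mul_measure_le_of_bounded hr (s := s) hU hgoodm.aestronglyMeasurable hgoodle hτ
      (le_of_eq ?_)).trans (by gcongr)
    rw [htl]
    field_simp
  -- The bad part.
  set Ω : Set X := ⋃ c : u, Metric.ball (c : X) (16 * δ c) with hΩdef
  have hΩ : MeasurableSet Ω := MeasurableSet.iUnion fun c => Metric.isOpen_ball.measurableSet
  have hbadL : ∫⁻ x in Ωᶜ, ‖k₂ x‖ₑ ∂ν ≤ C * N := by
    refine setLIntegral_compl_enorm_le_of_oscillation hV hPm hPd hQm hQd hQS hPS hSV hP0 hg hM hgi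
      hβ hβM hΩ (fun c h hb hz => ?_) hk₂
    refine hosc c (huE c.2) (δ c) (hδ c c.2).1 (by linarith [(hδ c c.2).2]) h hb ?_
    filter_upwards [hz] with y hy hyc using hy (mem_iUnion.2 ⟨c, hyc⟩)
  have hbad_weak : ((t / 2 : ℝ≥0) : ℝ≥0∞) *
      ν ({x | ((t / 2 : ℝ≥0) : ℝ≥0∞) < ‖k₂ x‖ₑ} ∩ Ωᶜ) ≤ C * N := by
    refine le_trans ?_ hbadL
    rw [← Measure.restrict_apply (measurableSet_lt measurable_const hk₂.measurable.enorm)]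
    refine le_trans ?_ (mul_meas_ge_le_lintegral hk₂.measurable.enorm ((t / 2 : ℝ≥0) : ℝ≥0∞))
    gcongr with x
    exact fun hx => le_of_lt hx
  have hΩle : l * ν Ω ≤ D ^ 4 * N := by
    calc l * ν Ω ≤ l * ∑' c : u, μ (Metric.ball (c : X) (16 * δ c)) := by
          gcongr
          rw [hν]
          exact (Measure.restrict_apply_le _ _).trans (measure_iUnion_le _)
      _ ≤ l * ∑' c : u, D ^ 4 * μ (P c) := by
          gcongr with c
          rw [show (16 : ℝ) = 2 ^ 4 by norm_num]
          refine (measure_ball_two_pow_le hdbl _ 4 _ (hδ c c.2).1 ?_).trans ?_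
          · linarith [(hδ c c.2).2]
          · gcongr
            exact Metric.ball_subset_closedBall
      _ = D ^ 4 * ∑' c : u, l * μ (P c) := by
          rw [ENNReal.tsum_mul_left, ENNReal.tsum_mul_left]
          ring
      _ ≤ D ^ 4 * ∑' c : u, ∫⁻ y in P c, ‖g y‖ₑ ∂μ := by
          gcongr with c
          exact hlow c c.2
      _ = D ^ 4 * ∫⁻ y in ⋃ c, P c, ‖g y‖ₑ ∂μ := by rw [lintegral_iUnion hPm hPd]
      _ ≤ D ^ 4 * N := by
          gcongr
          exact setLIntegral_le_lintegral _ _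
  have hcover : ν {x | (t : ℝ≥0∞) < ‖k x‖ₑ} ≤ ν {x | ((t / 2 : ℝ≥0) : ℝ≥0∞) < ‖k₁ x‖ₑ} +
      (ν ({x | ((t / 2 : ℝ≥0) : ℝ≥0∞) < ‖k₂ x‖ₑ} ∩ Ωᶜ) + ν Ω) := by
    refine le_trans (measure_mono_ae ?_) ((measure_union_le _ _).trans (by
      gcongr; exact measure_union_le _ _))
    filter_upwards [hkeq] with x hx (hxt : (t : ℝ≥0∞) < ‖k x‖ₑ)
    by_cases h1 : ((t / 2 : ℝ≥0) : ℝ≥0∞) < ‖k₁ x‖ₑ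
    · exact Or.inl h1
    by_cases h2 : x ∈ Ω
    · exact Or.inr (Or.inr h2)
    refine Or.inr (Or.inl ⟨?_, h2⟩)
    by_contra h3
    have h3' : ‖k₂ x‖ₑ ≤ ((t / 2 : ℝ≥0) : ℝ≥0∞) := not_lt.1 h3
    refine absurd hxt (not_lt.2 ?_)
    rw [hx]
    refine (enorm_add_le _ _).trans ((add_le_add (not_lt.1 h1) h3').trans_eq ?_)
    rw [← ENNReal.coe_add, add_halves]
  have ht2 : (t : ℝ≥0∞) = 2 * ((t / 2 : ℝ≥0) : ℝ≥0∞) := by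
    rw [← ENNReal.coe_ofNat, ← ENNReal.coe_mul, mul_div_cancel₀ _ two_ne_zero]
  calc (t : ℝ≥0∞) * ν {x | (t : ℝ≥0∞) < ‖k x‖ₑ}
      ≤ t * (ν {x | ((t / 2 : ℝ≥0) : ℝ≥0∞) < ‖k₁ x‖ₑ} +
        (ν ({x | ((t / 2 : ℝ≥0) : ℝ≥0∞) < ‖k₂ x‖ₑ} ∩ Ωᶜ) + ν Ω)) := by gcongr
    _ = 2 * (((t / 2 : ℝ≥0) : ℝ≥0∞) * ν {x | ((t / 2 : ℝ≥0) : ℝ≥0∞) < ‖k₁ x‖ₑ}) +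
        (2 * (((t / 2 : ℝ≥0) : ℝ≥0∞) * ν ({x | ((t / 2 : ℝ≥0) : ℝ≥0∞) < ‖k₂ x‖ₑ} ∩ Ωᶜ)) +
          2 * D ^ 2 * A * (l * ν Ω)) := by
        have e : (t : ℝ≥0∞) = 2 * D ^ 2 * A * l := by
          rw [htl]
          push_cast
          rfl
        rw [mul_add, mul_add, ← mul_assoc, ← mul_assoc, ← ht2, ← mul_assoc, ← e]
    _ ≤ 2 * (A * N) + (2 * (C * N) + 2 * D ^ 2 * A * (D ^ 4 * N)) := by gcongr
    _ = ((2 * 1 * A + 2 * D ^ 6 * A + 2 * C : ℝ≥0) : ℝ≥0∞) * N := by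
        push_cast
        ring
    _ ≤ _ := by
        gcongr
        calc 2 * 1 * A + 2 * D ^ 6 * A ≤ 2 * D ^ 6 * A + 2 * D ^ 6 * A := by
              gcongr
              exact one_le_pow₀ hD1
          _ = 4 * D ^ 6 * A := by ring

end WeakType

/-! ### Layer-cake identities -/

section Interpolation

theorem setLIntegral_Ioo_ofReal_rpow {a b : ℝ} (ha : 0 < a) (hb : 0 ≤ b) :
    ∫⁻ τ in Ioo 0 b, ENNReal.ofReal (τ ^ (a - 1)) = ENNReal.ofReal (b ^ a / a) := by
  have hint : IntegrableOn (fun τ : ℝ => τ ^ (a - 1)) (Ioo 0 b) :=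
    ((intervalIntegrable_iff_integrableOn_Ioc_of_le hb).1
      (intervalIntegral.intervalIntegrable_rpow' (by linarith))).mono_set Ioo_subset_Ioc_self
  rw [← ofReal_integral_eq_lintegral_ofReal hint, ← integral_Ioc_eq_integral_Ioo,
    ← intervalIntegral.integral_of_le hb, integral_rpow (Or.inl (by linarith))]
  · rw [sub_add_cancel, Real.zero_rpow ha.ne', sub_zero]
  · filter_upwards [ae_restrict_mem measurableSet_Ioo] with τ hτ
    exact Real.rpow_nonneg hτ.1.le _

theorem setLIntegral_Ici_ofReal_rpow {a b : ℝ} (ha : 0 < a) (hb : 0 < b) :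
    ∫⁻ τ in Ici b, ENNReal.ofReal (τ ^ (-a - 1)) = ENNReal.ofReal (b ^ (-a) / a) := by
  have hint : IntegrableOn (fun τ : ℝ => τ ^ (-a - 1)) (Ioi b) :=
    integrableOn_Ioi_rpow_of_lt (by linarith) hb
  rw [setLIntegral_congr Ioi_ae_eq_Ici.symm, ← ofReal_integral_eq_lintegral_ofReal hint,
    integral_Ioi_rpow_of_lt (by linarith) hb]
  · rw [sub_add_cancel, neg_div_neg_eq]
  · filter_upwards [ae_restrict_mem measurableSet_Ioi] with τ hτ
    exact Real.rpow_nonneg (hb.trans hτ).le _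

variable {X : Type*} [MeasurableSpace X] {μ : Measure X}

theorem lintegral_mul_setLIntegral_swap {Y : Type*} [MeasurableSpace Y] {κ : Measure Y}
    [SFinite κ] [SFinite μ] {W : Set (Y × X)} (hW : MeasurableSet W) {w : Y → ℝ≥0∞}
    (hw : Measurable w) {f : X → ℝ≥0∞} (hf : Measurable f) :
    ∫⁻ y, w y * ∫⁻ x in {x | (y, x) ∈ W}, f x ∂μ ∂κ =
      ∫⁻ x, f x * ∫⁻ y in {y | (y, x) ∈ W}, w y ∂κ ∂μ := by
  have h1 : ∀ y, MeasurableSet {x | (y, x) ∈ W} := fun y => measurable_prodMk_left hW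
  have h2 : ∀ x, MeasurableSet {y | (y, x) ∈ W} := fun x => measurable_prodMk_right hW
  have e1 : ∀ y, w y * ∫⁻ x in {x | (y, x) ∈ W}, f x ∂μ
      = ∫⁻ x, W.indicator (fun z => w z.1 * f z.2) (y, x) ∂μ := fun y => by
    rw [← lintegral_indicator (h1 y), ← lintegral_const_mul _ (hf.indicator (h1 y))]
    refine lintegral_congr fun x => ?_
    by_cases hx : (y, x) ∈ W <;> simp [indicator, hx]
  have e2 : ∀ x, f x * ∫⁻ y in {y | (y, x) ∈ W}, w y ∂κ
      = ∫⁻ y, W.indicator (fun z => w z.1 * f z.2) (y, x) ∂κ := fun x => by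
    rw [← lintegral_indicator (h2 x), ← lintegral_const_mul _ (hw.indicator (h2 x))]
    refine lintegral_congr fun y => ?_
    by_cases hx : (y, x) ∈ W <;> simp [indicator, hx, mul_comm]
  simp only [e1, e2]
  refine lintegral_lintegral_swap (Measurable.aemeasurable ?_)
  exact ((hw.comp measurable_fst).mul (hf.comp measurable_snd)).indicator hW

/-- Integrating the truncations of `F` from below against a power of the level; for `q = 0` this is
the layer cake formula. -/
theorem lintegral_rpow_mul_setLIntegral_lt [SFinite μ] {F : X → ℝ≥0∞} (hF : Measurable F)
    (hFt : ∀ x, F x ≠ ∞) {p q c : ℝ} (hq : 0 ≤ q) (hqp : q < p) (hc : 0 < c) :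
    ∫⁻ τ in Ioi (0 : ℝ), ENNReal.ofReal (τ ^ (p - q - 1)) *
        ∫⁻ x in {x | ENNReal.ofReal (c * τ) < F x}, F x ^ q ∂μ =
      ENNReal.ofReal (c ^ (q - p) / (p - q)) * ∫⁻ x, F x ^ p ∂μ := by
  have hW : MeasurableSet {z : ℝ × X | ENNReal.ofReal (c * z.1) < F z.2} :=
    measurableSet_lt (by fun_prop) (hF.comp measurable_snd)
  have hswap := lintegral_mul_setLIntegral_swap (κ := volume.restrict (Ioi (0 : ℝ))) (μ := μ) hW
    (w := fun τ => ENNReal.ofReal (τ ^ (p - q - 1))) (by fun_prop) (f := fun x => F x ^ q)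
    (hF.pow_const _)
  simp only [mem_ofPred_eq] at hswap
  rw [hswap, ← lintegral_const_mul _ (hF.pow_const _)]
  refine lintegral_congr fun x => ?_
  set a := (F x).toReal with ha
  have ha0 : 0 ≤ a := ENNReal.toReal_nonneg
  have hFa : F x = ENNReal.ofReal a := (ENNReal.ofReal_toReal (hFt x)).symm
  have hset : {τ : ℝ | ENNReal.ofReal (c * τ) < F x} ∩ Ioi 0 = Ioo 0 (a / c) := by
    ext τ
    simp only [mem_inter_iff, mem_ofPred_eq, mem_Ioi, mem_Ioo, lt_div_iff₀ hc]
    constructor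
    · rintro ⟨h1, h2⟩
      rw [hFa] at h1
      exact ⟨h2, by linarith [(ENNReal.ofReal_lt_ofReal_iff_of_nonneg (by positivity)).1 h1]⟩
    · rintro ⟨h1, h2⟩
      refine ⟨?_, h1⟩
      rw [hFa]
      exact (ENNReal.ofReal_lt_ofReal_iff_of_nonneg (by positivity)).2 (by linarith)
  have hmeas : MeasurableSet {τ : ℝ | ENNReal.ofReal (c * τ) < F x} :=
    measurable_prodMk_right (y := x) hW
  rw [Measure.restrict_restrict hmeas, hset, setLIntegral_Ioo_ofReal_rpow (by linarith)
    (by positivity), hFa, ENNReal.ofReal_rpow_of_nonneg ha0 hq,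
    ENNReal.ofReal_rpow_of_nonneg ha0 (hq.trans hqp.le), ← ENNReal.ofReal_mul (by positivity),
    ← ENNReal.ofReal_mul (div_nonneg (by positivity) (by linarith))]
  congr 1
  rcases ha0.eq_or_lt with h0 | h0
  · rw [← h0, zero_div, Real.zero_rpow (sub_pos.2 hqp).ne', Real.zero_rpow (hq.trans_lt hqp).ne']
    simp
  · rw [Real.div_rpow h0.le hc.le, show q - p = -(p - q) by ring, Real.rpow_neg hc.le]
    have : a ^ p = a ^ q * a ^ (p - q) := by rw [← Real.rpow_add h0]; ring_nf
    rw [this]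
    ring

/-- Integrating the truncations of `F` from above against a power of the level. -/
theorem lintegral_rpow_mul_setLIntegral_le [SFinite μ] {F : X → ℝ≥0∞} (hF : Measurable F)
    (hFt : ∀ x, F x ≠ ∞) {p s c : ℝ} (hp : 0 < p) (hps : p < s) (hc : 0 < c) :
    ∫⁻ τ in Ioi (0 : ℝ), ENNReal.ofReal (τ ^ (p - s - 1)) *
        ∫⁻ x in {x | F x ≤ ENNReal.ofReal (c * τ)}, F x ^ s ∂μ =
      ENNReal.ofReal (c ^ (s - p) / (s - p)) * ∫⁻ x, F x ^ p ∂μ := by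
  have hW : MeasurableSet {z : ℝ × X | F z.2 ≤ ENNReal.ofReal (c * z.1)} :=
    measurableSet_le (hF.comp measurable_snd) (by fun_prop)
  have hswap := lintegral_mul_setLIntegral_swap (κ := volume.restrict (Ioi (0 : ℝ))) (μ := μ) hW
    (w := fun τ => ENNReal.ofReal (τ ^ (p - s - 1))) (by fun_prop) (f := fun x => F x ^ s)
    (hF.pow_const _)
  simp only [mem_ofPred_eq] at hswap
  rw [hswap, ← lintegral_const_mul _ (hF.pow_const _)]
  refine lintegral_congr fun x => ?_
  set a := (F x).toReal with ha
  have ha0 : 0 ≤ a := ENNReal.toReal_nonneg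
  have hFa : F x = ENNReal.ofReal a := (ENNReal.ofReal_toReal (hFt x)).symm
  rcases ha0.eq_or_lt with h0 | h0
  · rw [hFa, ← h0, ENNReal.ofReal_zero, ENNReal.zero_rpow_of_pos (hp.trans hps),
      ENNReal.zero_rpow_of_pos hp, zero_mul, mul_zero]
  have hset : {τ : ℝ | F x ≤ ENNReal.ofReal (c * τ)} ∩ Ioi 0 = Ici (a / c) := by
    ext τ
    simp only [mem_inter_iff, mem_ofPred_eq, mem_Ioi, mem_Ici, div_le_iff₀ hc]
    constructor
    · rintro ⟨h1, h2⟩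
      rw [hFa] at h1
      linarith [(ENNReal.ofReal_le_ofReal_iff (by positivity)).1 h1]
    · intro h1
      have hτ : 0 < τ := by
        by_contra! h
        nlinarith
      refine ⟨?_, hτ⟩
      rw [hFa]
      exact ENNReal.ofReal_le_ofReal (by linarith)
  have hmeas : MeasurableSet {τ : ℝ | F x ≤ ENNReal.ofReal (c * τ)} :=
    measurable_prodMk_right (y := x) hW
  rw [Measure.restrict_restrict hmeas, hset, show p - s - 1 = -(s - p) - 1 by ring,
    setLIntegral_Ici_ofReal_rpow (by linarith) (by positivity), hFa,
    ENNReal.ofReal_rpow_of_nonneg ha0 (hp.trans hps).le,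
    ENNReal.ofReal_rpow_of_nonneg ha0 hp.le, ← ENNReal.ofReal_mul (by positivity),
    ← ENNReal.ofReal_mul (div_nonneg (by positivity) (by linarith))]
  congr 1
  rw [Real.div_rpow h0.le hc.le, Real.rpow_neg hc.le, Real.rpow_neg h0.le]
  have : a ^ s = a ^ p * a ^ (s - p) := by rw [← Real.rpow_add h0]; ring_nf
  rw [this]
  have h1 : 0 < a ^ (s - p) := by positivity
  have h2 : 0 < c ^ (s - p) := by positivity
  field_simp

end Interpolation

/-! ### Real interpolation -/

section Interpolation

variable {X : Type*} [MeasurableSpace X] {μ ν : Measure X} {H : Type*} [NormedAddCommGroup H]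

/-- `S` maps functions of a class `G`, stable under truncation, to nonnegative functions, and is
subadditive along truncations. This is all that real interpolation needs. -/
structure IsSublinearOn (ν : Measure X) (G : (X → H) → Prop) (S : (X → H) → X → ℝ≥0∞) :
    Prop where
  stronglyMeasurable : ∀ g, G g → StronglyMeasurable g
  indicator_mem : ∀ g, G g → ∀ A, MeasurableSet A → G (A.indicator g)
  measurable : ∀ g, G g → Measurable (S g)
  ne_top : ∀ g, G g → ∀ x, S g x ≠ ∞
  le_add : ∀ g, G g → ∀ A, MeasurableSet A →
    ∀ᵐ x ∂ν, S g x ≤ S (A.indicator g) x + S (Aᶜ.indicator g) x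

theorem lintegral_enorm_indicator_rpow {A : Set X} (hA : MeasurableSet A) (g : X → H) {q : ℝ}
    (hq : 0 < q) : ∫⁻ x, ‖A.indicator g x‖ₑ ^ q ∂μ = ∫⁻ x in A, ‖g x‖ₑ ^ q ∂μ := by
  rw [← lintegral_indicator hA]
  refine lintegral_congr fun x => ?_
  by_cases hx : x ∈ A
  · simp [hx]
  · simp [hx, hq]

/-- The part of the **Marcinkiewicz** argument that comes from the weak type `(1, 1)` bound: at
level `τ` the function is truncated at height `τ / (2 n)`. -/
theorem IsSublinearOn.lintegral_rpow_le_add [SFinite μ] [SFinite ν] {G : (X → H) → Prop}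
    {S : (X → H) → X → ℝ≥0∞} (hS : IsSublinearOn ν G S) {n : ℝ} (hn : 0 < n)
    (hweak : ∀ g, G g → ∀ t : ℝ, 0 < t →
      ENNReal.ofReal t * ν {x | ENNReal.ofReal t < S g x} ≤ ENNReal.ofReal n * ∫⁻ x, ‖g x‖ₑ ∂μ)
    {q : ℝ} (hq : 1 < q) {g : X → H} (hg : G g) :
    ∫⁻ x, S g x ^ q ∂ν ≤ ENNReal.ofReal q *
      (ENNReal.ofReal ((2 * n) ^ q / (q - 1)) * ∫⁻ x, ‖g x‖ₑ ^ q ∂μ +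
        ∫⁻ τ in Ioi (0 : ℝ), ENNReal.ofReal (τ ^ (q - 1)) *
          ν {x | ENNReal.ofReal (τ / 2) <
            S ({x | ‖g x‖ₑ ≤ ENNReal.ofReal (1 / (2 * n) * τ)}.indicator g) x}) := by
  have hgm : Measurable fun x => ‖g x‖ₑ := (hS.stronglyMeasurable g hg).enorm
  have hq0 : 0 < q := by linarith
  set A : ℝ → Set X := fun τ => {x | ENNReal.ofReal (1 / (2 * n) * τ) < ‖g x‖ₑ} with hA
  have hAm : ∀ τ, MeasurableSet (A τ) := fun τ => measurableSet_lt measurable_const hgm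
  have hAc : ∀ τ, {x | ‖g x‖ₑ ≤ ENNReal.ofReal (1 / (2 * n) * τ)} = (A τ)ᶜ := fun τ => by
    ext x
    simp [hA]
  simp only [hAc]
  have hcake := lintegral_rpow_mul_setLIntegral_lt (μ := ν) (hS.measurable g hg) (hS.ne_top g hg)
    le_rfl hq0 one_pos
  have hlow := lintegral_rpow_mul_setLIntegral_lt (μ := μ) hgm (fun x => enorm_ne_top) (p := q)
    zero_le_one hq (show 0 < 1 / (2 * n) by positivity)
  simp only [sub_zero, one_mul, ENNReal.rpow_zero, lintegral_one, Measure.restrict_apply_univ,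
    Real.one_rpow] at hcake
  simp only [ENNReal.rpow_one] at hlow
  have e : ∫⁻ x, S g x ^ q ∂ν = ENNReal.ofReal q *
      ∫⁻ τ in Ioi (0 : ℝ), ENNReal.ofReal (τ ^ (q - 1)) * ν {x | ENNReal.ofReal τ < S g x} := by
    rw [hcake, ← mul_assoc, ← ENNReal.ofReal_mul hq0.le, mul_one_div_cancel hq0.ne',
      ENNReal.ofReal_one, one_mul]
  have hlow' : ENNReal.ofReal ((2 * n) ^ q / (q - 1)) * ∫⁻ x, ‖g x‖ₑ ^ q ∂μ =
      ∫⁻ τ in Ioi (0 : ℝ), ENNReal.ofReal (2 * n) * (ENNReal.ofReal (τ ^ (q - 1 - 1)) *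
        ∫⁻ x in A τ, ‖g x‖ₑ ∂μ) := by
    rw [lintegral_const_mul' _ _ ENNReal.ofReal_ne_top, hlow, ← mul_assoc,
      ← ENNReal.ofReal_mul (by positivity)]
    congr 2
    rw [one_div, Real.inv_rpow (by positivity), ← Real.rpow_neg (by positivity), neg_sub,
      ← mul_div_assoc]
    congr 1
    conv_rhs => rw [← Real.rpow_one_add' (by positivity) (by linarith)]
    ring_nf
  rw [e, hlow']
  gcongr
  rw [← lintegral_add_left']
  · refine setLIntegral_mono' measurableSet_Ioi fun τ (hτ : 0 < τ) => ?_
    have hcover : ν {x | ENNReal.ofReal τ < S g x} ≤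
        ν {x | ENNReal.ofReal (τ / 2) < S ((A τ).indicator g) x} +
          ν {x | ENNReal.ofReal (τ / 2) < S ((A τ)ᶜ.indicator g) x} := by
      refine le_trans (measure_mono_ae ?_) (measure_union_le _ _)
      filter_upwards [hS.le_add g hg (A τ) (hAm τ)] with x hx (hxτ : ENNReal.ofReal τ < S g x)
      by_contra h
      have h1 : S ((A τ).indicator g) x ≤ ENNReal.ofReal (τ / 2) :=
        not_lt.1 fun h1 => h (Or.inl h1)
      have h2 : S ((A τ)ᶜ.indicator g) x ≤ ENNReal.ofReal (τ / 2) :=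
        not_lt.1 fun h2 => h (Or.inr h2)
      refine absurd hxτ (not_lt.2 (hx.trans ((add_le_add h1 h2).trans_eq ?_)))
      rw [← ENNReal.ofReal_add (by positivity) (by positivity), add_halves]
    have hw := hweak _ (hS.indicator_mem g hg (A τ) (hAm τ)) (τ / 2) (by positivity)
    have hind : ∫⁻ x, ‖(A τ).indicator g x‖ₑ ∂μ = ∫⁻ x in A τ, ‖g x‖ₑ ∂μ := by
      have := lintegral_enorm_indicator_rpow (μ := μ) (hAm τ) g one_pos
      simpa only [ENNReal.rpow_one] using this
    rw [hind] at hw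
    have hsplit : ENNReal.ofReal (τ ^ (q - 1)) =
        2 * ENNReal.ofReal (τ ^ (q - 1 - 1)) * ENNReal.ofReal (τ / 2) := by
      rw [← ENNReal.ofReal_ofNat, ← ENNReal.ofReal_mul (by positivity),
        ← ENNReal.ofReal_mul (by positivity)]
      congr 1
      rw [Real.rpow_sub_one hτ.ne' (q - 1)]
      field_simp
    calc ENNReal.ofReal (τ ^ (q - 1)) * ν {x | ENNReal.ofReal τ < S g x}
        ≤ ENNReal.ofReal (τ ^ (q - 1)) *
          ν {x | ENNReal.ofReal (τ / 2) < S ((A τ).indicator g) x} +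
          ENNReal.ofReal (τ ^ (q - 1)) *
            ν {x | ENNReal.ofReal (τ / 2) < S ((A τ)ᶜ.indicator g) x} := by
          rw [← mul_add]
          gcongr
      _ ≤ _ := by
          refine add_le_add ?_ le_rfl
          rw [hsplit, mul_assoc]
          refine (mul_le_mul_right hw _).trans_eq ?_
          rw [ENNReal.ofReal_mul zero_le_two, ENNReal.ofReal_ofNat]
          ring
  · have hW : MeasurableSet {z : ℝ × X | ENNReal.ofReal (1 / (2 * n) * z.1) < ‖g z.2‖ₑ} :=
      measurableSet_lt (by fun_prop) (hgm.comp measurable_snd)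
    have : Measurable fun τ => ∫⁻ x in A τ, ‖g x‖ₑ ∂μ := by
      have e2 : ∀ τ, ∫⁻ x in A τ, ‖g x‖ₑ ∂μ = ∫⁻ x, {z : ℝ × X |
          ENNReal.ofReal (1 / (2 * n) * z.1) < ‖g z.2‖ₑ}.indicator (fun z => ‖g z.2‖ₑ) (τ, x) ∂μ :=
        fun τ => by
          rw [← lintegral_indicator (hAm τ)]
          rfl
      simp only [e2]
      exact Measurable.lintegral_prod_right' ((hgm.comp measurable_snd).indicator hW)
    fun_prop

/-- **Marcinkiewicz interpolation** between weak type `(1, 1)` and strong type `(s, s)`. -/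
theorem IsSublinearOn.lintegral_rpow_le_of_weak_of_strong [SFinite μ] [SFinite ν]
    {G : (X → H) → Prop} {S : (X → H) → X → ℝ≥0∞} (hS : IsSublinearOn ν G S) {n : ℝ} (hn : 0 < n)
    (hweak : ∀ g, G g → ∀ t : ℝ, 0 < t →
      ENNReal.ofReal t * ν {x | ENNReal.ofReal t < S g x} ≤ ENNReal.ofReal n * ∫⁻ x, ‖g x‖ₑ ∂μ)
    {q s : ℝ} (hq : 1 < q) (hqs : q < s)
    (hstrong : ∀ g, G g →
      ∫⁻ x, S g x ^ s ∂ν ≤ ENNReal.ofReal (n ^ s) * ∫⁻ x, ‖g x‖ₑ ^ s ∂μ)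
    {g : X → H} (hg : G g) :
    ∫⁻ x, S g x ^ q ∂ν ≤
      ENNReal.ofReal ((2 * n) ^ q * (q / (q - 1) + q / (s - q))) * ∫⁻ x, ‖g x‖ₑ ^ q ∂μ := by
  have hgm : Measurable fun x => ‖g x‖ₑ := (hS.stronglyMeasurable g hg).enorm
  have hq0 : 0 < q := by linarith
  have hs0 : 0 < s := by linarith
  refine (hS.lintegral_rpow_le_add hn hweak hq hg).trans ?_
  set A : ℝ → Set X := fun τ => {x | ‖g x‖ₑ ≤ ENNReal.ofReal (1 / (2 * n) * τ)} with hA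
  have hAm : ∀ τ, MeasurableSet (A τ) := fun τ => measurableSet_le hgm measurable_const
  have hhigh := lintegral_rpow_mul_setLIntegral_le (μ := μ) hgm (fun x => enorm_ne_top) hq0 hqs
    (show 0 < 1 / (2 * n) by positivity)
  have key : ∫⁻ τ in Ioi (0 : ℝ), ENNReal.ofReal (τ ^ (q - 1)) *
      ν {x | ENNReal.ofReal (τ / 2) < S ((A τ).indicator g) x} ≤
      ENNReal.ofReal ((2 * n) ^ q / (s - q)) * ∫⁻ x, ‖g x‖ₑ ^ q ∂μ := by
    calc _ ≤ ∫⁻ τ in Ioi (0 : ℝ), ENNReal.ofReal ((2 * n) ^ s) *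
          (ENNReal.ofReal (τ ^ (q - s - 1)) * ∫⁻ x in A τ, ‖g x‖ₑ ^ s ∂μ) := by
          refine setLIntegral_mono' measurableSet_Ioi fun τ (hτ : 0 < τ) => ?_
          have hGA := hS.indicator_mem g hg (A τ) (hAm τ)
          have h1 : ENNReal.ofReal ((τ / 2) ^ s) *
              ν {x | ENNReal.ofReal (τ / 2) < S ((A τ).indicator g) x} ≤
              ENNReal.ofReal (n ^ s) * ∫⁻ x in A τ, ‖g x‖ₑ ^ s ∂μ := by
            rw [← lintegral_enorm_indicator_rpow (hAm τ) g hs0]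
            refine le_trans ?_ (hstrong _ hGA)
            refine le_trans ?_ (mul_meas_ge_le_lintegral ((hS.measurable _ hGA).pow_const s)
              (ENNReal.ofReal ((τ / 2) ^ s)))
            gcongr with x
            intro hx
            rw [← ENNReal.ofReal_rpow_of_nonneg (by positivity) hs0.le]
            exact ENNReal.rpow_le_rpow (le_of_lt hx) hs0.le
          have h2 : ENNReal.ofReal (τ ^ (q - 1)) =
              ENNReal.ofReal (2 ^ s * τ ^ (q - s - 1)) * ENNReal.ofReal ((τ / 2) ^ s) := by
            rw [← ENNReal.ofReal_mul (by positivity)]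
            congr 1
            rw [Real.div_rpow hτ.le zero_le_two, show q - 1 = (q - s - 1) + s by ring,
              Real.rpow_add hτ]
            have : (0 : ℝ) < 2 ^ s := by positivity
            field_simp
          rw [h2, mul_assoc]
          refine (mul_le_mul_right h1 _).trans_eq ?_
          rw [Real.mul_rpow zero_le_two hn.le, ENNReal.ofReal_mul (by positivity),
            ENNReal.ofReal_mul (by positivity)]
          ring
      _ = _ := by
          rw [lintegral_const_mul' _ _ ENNReal.ofReal_ne_top, hhigh, ← mul_assoc,
            ← ENNReal.ofReal_mul (by positivity)]
          congr 2
          rw [one_div, Real.inv_rpow (by positivity), ← Real.rpow_neg (by positivity), neg_sub,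
            ← mul_div_assoc]
          congr 1
          rw [← Real.rpow_add (by positivity)]
          ring_nf
  calc _ ≤ ENNReal.ofReal q * (ENNReal.ofReal ((2 * n) ^ q / (q - 1)) * ∫⁻ x, ‖g x‖ₑ ^ q ∂μ +
        ENNReal.ofReal ((2 * n) ^ q / (s - q)) * ∫⁻ x, ‖g x‖ₑ ^ q ∂μ) := by gcongr
    _ = _ := by
        have h1 : 0 < q - 1 := by linarith
        have h2 : 0 < s - q := by linarith
        rw [← add_mul, ← ENNReal.ofReal_add (by positivity) (by positivity), ← mul_assoc,
          ← ENNReal.ofReal_mul hq0.le]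
        congr 2
        ring

/-- **Marcinkiewicz interpolation** between weak type `(1, 1)` and a bound on `L^∞`. -/
theorem IsSublinearOn.lintegral_rpow_le_of_weak_of_bounded [SFinite μ] [SFinite ν]
    {G : (X → H) → Prop} {S : (X → H) → X → ℝ≥0∞} (hS : IsSublinearOn ν G S) {n : ℝ} (hn : 0 < n)
    (hweak : ∀ g, G g → ∀ t : ℝ, 0 < t →
      ENNReal.ofReal t * ν {x | ENNReal.ofReal t < S g x} ≤ ENNReal.ofReal n * ∫⁻ x, ‖g x‖ₑ ∂μ)
    {q : ℝ} (hq : 1 < q)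
    (hbdd : ∀ g, G g → ∀ m : ℝ, 0 < m → (∀ x, ‖g x‖ₑ ≤ ENNReal.ofReal m) →
      ∀ᵐ x ∂ν, S g x ≤ ENNReal.ofReal (n * m))
    {g : X → H} (hg : G g) :
    ∫⁻ x, S g x ^ q ∂ν ≤
      ENNReal.ofReal ((2 * n) ^ q * (q / (q - 1))) * ∫⁻ x, ‖g x‖ₑ ^ q ∂μ := by
  have hgm : Measurable fun x => ‖g x‖ₑ := (hS.stronglyMeasurable g hg).enorm
  have hq0 : 0 < q := by linarith
  refine (hS.lintegral_rpow_le_add hn hweak hq hg).trans_eq ?_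
  set A : ℝ → Set X := fun τ => {x | ‖g x‖ₑ ≤ ENNReal.ofReal (1 / (2 * n) * τ)} with hA
  have hAm : ∀ τ, MeasurableSet (A τ) := fun τ => measurableSet_le hgm measurable_const
  have key : ∫⁻ τ in Ioi (0 : ℝ), ENNReal.ofReal (τ ^ (q - 1)) *
      ν {x | ENNReal.ofReal (τ / 2) < S ((A τ).indicator g) x} = 0 := by
    rw [← lintegral_zero (μ := volume.restrict (Ioi (0 : ℝ)))]
    refine setLIntegral_congr_fun measurableSet_Ioi fun τ (hτ : 0 < τ) => ?_
    have h1 := hbdd _ (hS.indicator_mem g hg (A τ) (hAm τ)) (1 / (2 * n) * τ) (by positivity)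
      fun x => by
        by_cases hx : x ∈ A τ
        · rw [indicator_of_mem hx]
          exact hx
        · rw [indicator_of_notMem hx, enorm_zero]
          exact zero_le
    rw [show n * (1 / (2 * n) * τ) = τ / 2 by field_simp] at h1
    have h2 := ae_iff.1 h1
    simp only [not_le] at h2
    simp only [h2, mul_zero]
  rw [key, add_zero, ← mul_assoc, ← ENNReal.ofReal_mul hq0.le]
  congr 2
  ring

/-- Real interpolation between two strong type bounds, with the norms `N b ^ (1 / q)` on `L^q` and
`N` on `L^s`. The constant is twice that of the Riesz–Thorin theorem. To achieve this, the level sets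
of `S g` are compared not by a weak type inequality but through the function
`min (a ^ q) (τ ^ (q - s) * a ^ s)` of `a = S g x`; its integral against `τ ^ (p - q - 1)` is a
multiple of `a ^ p`, and the truncations of `g` on the other side give the same multiple of
`‖g x‖ ^ p`, which cancels. -/
theorem IsSublinearOn.lintegral_rpow_le_of_strong_of_strong [SFinite μ] [SFinite ν]
    {G : (X → H) → Prop} {S : (X → H) → X → ℝ≥0∞} (hS : IsSublinearOn ν G S) {N b : ℝ}
    (hN : 0 < N) (hb : 0 < b) {q p s : ℝ} (hq : 0 < q) (hqp : q < p) (hps : p < s)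
    (hq_strong : ∀ g, G g →
      ∫⁻ x, S g x ^ q ∂ν ≤ ENNReal.ofReal (N ^ q * b) * ∫⁻ x, ‖g x‖ₑ ^ q ∂μ)
    (hs_strong : ∀ g, G g →
      ∫⁻ x, S g x ^ s ∂ν ≤ ENNReal.ofReal (N ^ s) * ∫⁻ x, ‖g x‖ₑ ^ s ∂μ)
    {g : X → H} (hg : G g) :
    ∫⁻ x, S g x ^ p ∂ν ≤
      ENNReal.ofReal ((2 * N) ^ p * b ^ ((s - p) / (s - q))) * ∫⁻ x, ‖g x‖ₑ ^ p ∂μ := by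
  have hgm : Measurable fun x => ‖g x‖ₑ := (hS.stronglyMeasurable g hg).enorm
  have hSm := hS.measurable g hg
  have hp0 : 0 < p := hq.trans hqp
  have hs0 : 0 < s := hp0.trans hps
  have hsq : 0 < s - q := by linarith
  set c : ℝ := b ^ (1 / (s - q)) / (2 * N) with hc
  have hc0 : 0 < c := by positivity
  set K : ℝ := (2 * N) ^ p * b ^ ((s - p) / (s - q)) with hK
  have hK0 : 0 < K := by positivity
  -- With the truncation at height `c τ`, the bounds at `q` and at `s` contribute the same constant.
  have hKq : (2 : ℝ) ^ q * (N ^ q * b) * c ^ (q - p) = K := by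
    rw [hc, Real.div_rpow (by positivity) (by positivity), ← Real.rpow_mul hb.le, hK,
      ← mul_assoc, ← Real.mul_rpow zero_le_two hN.le, show (s - p) / (s - q) = 1 +
      1 / (s - q) * (q - p) by field_simp; ring, Real.rpow_add hb, Real.rpow_one]
    have e : (2 * N) ^ q / (2 * N) ^ (q - p) = (2 * N) ^ p := by
      rw [← Real.rpow_sub (by positivity), sub_sub_cancel]
    rw [← e]
    ring
  have hKs : (2 : ℝ) ^ s * N ^ s * c ^ (s - p) = K := by
    rw [hc, Real.div_rpow (by positivity) (by positivity), ← Real.rpow_mul hb.le, hK,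
      ← Real.mul_rpow zero_le_two hN.le, show (s - p) / (s - q) = 1 / (s - q) * (s - p) by ring]
    have e : (2 * N) ^ s / (2 * N) ^ (s - p) = (2 * N) ^ p := by
      rw [← Real.rpow_sub (by positivity), sub_sub_cancel]
    rw [← e]
    ring
  set A : ℝ → Set X := fun τ => {x | ENNReal.ofReal (c * τ) < ‖g x‖ₑ} with hA
  have hAm : ∀ τ, MeasurableSet (A τ) := fun τ => measurableSet_lt measurable_const hgm
  have hAc : ∀ τ, (A τ)ᶜ = {x | ‖g x‖ₑ ≤ ENNReal.ofReal (c * τ)} := fun τ => by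
    ext x
    simp [hA]
  have hL1 := lintegral_rpow_mul_setLIntegral_lt (μ := ν) hSm (hS.ne_top g hg) hq.le hqp one_pos
  have hL2 := lintegral_rpow_mul_setLIntegral_le (μ := ν) hSm (hS.ne_top g hg) hp0 hps one_pos
  have hR1 := lintegral_rpow_mul_setLIntegral_lt (μ := μ) hgm (fun x => enorm_ne_top) hq.le hqp hc0
  have hR2 := lintegral_rpow_mul_setLIntegral_le (μ := μ) hgm (fun x => enorm_ne_top) hp0 hps hc0
  simp only [one_mul, Real.one_rpow] at hL1 hL2
  have hmeas_lt : ∀ (Y : Type _) [MeasurableSpace Y] (κ : Measure Y) [SFinite κ] (F : Y → ℝ≥0∞)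
      (_ : Measurable F) (d e e' : ℝ), Measurable fun τ : ℝ => ENNReal.ofReal (τ ^ e) *
        ∫⁻ x in {x | ENNReal.ofReal (d * τ) < F x}, F x ^ e' ∂κ := by
    intro Y _ κ _ F hF d e e'
    have hW : MeasurableSet {z : ℝ × Y | ENNReal.ofReal (d * z.1) < F z.2} :=
      measurableSet_lt (by fun_prop) (hF.comp measurable_snd)
    have e2 : ∀ τ, ∫⁻ x in {x | ENNReal.ofReal (d * τ) < F x}, F x ^ e' ∂κ =
        ∫⁻ x, {z : ℝ × Y | ENNReal.ofReal (d * z.1) < F z.2}.indicator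
          (fun z => F z.2 ^ e') (τ, x) ∂κ := fun τ => by
      rw [← lintegral_indicator (measurableSet_lt measurable_const hF)]
      rfl
    simp only [e2]
    refine Measurable.mul (by fun_prop) ?_
    exact Measurable.lintegral_prod_right'
      (((hF.comp measurable_snd).pow_const e').indicator hW)
  have hmS := hmeas_lt X ν (S g) hSm 1 (p - q - 1) q
  have hmg := hmeas_lt X μ (fun x => ‖g x‖ₑ) hgm c (p - q - 1) q
  simp only [one_mul] at hmS
  -- The left-hand side is the integral of `min (a ^ q) (τ ^ (q - s) * a ^ s)`, times a power of `τ`.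
  have hlevel : ∀ τ : ℝ, 0 < τ →
      ENNReal.ofReal (τ ^ (p - q - 1)) * ∫⁻ x in {x | ENNReal.ofReal τ < S g x}, S g x ^ q ∂ν +
        ENNReal.ofReal (τ ^ (p - s - 1)) * ∫⁻ x in {x | S g x ≤ ENNReal.ofReal τ}, S g x ^ s ∂ν ≤
      ENNReal.ofReal (2 ^ q * (N ^ q * b)) * (ENNReal.ofReal (τ ^ (p - q - 1)) *
        ∫⁻ x in A τ, ‖g x‖ₑ ^ q ∂μ) +
      ENNReal.ofReal (2 ^ s * N ^ s) * (ENNReal.ofReal (τ ^ (p - s - 1)) *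
        ∫⁻ x in (A τ)ᶜ, ‖g x‖ₑ ^ s ∂μ) := by
    intro τ hτ
    have hG1 := hS.indicator_mem g hg (A τ) (hAm τ)
    have hG2 := hS.indicator_mem g hg (A τ)ᶜ (hAm τ).compl
    have hlt : MeasurableSet {x | ENNReal.ofReal τ < S g x} :=
      measurableSet_lt measurable_const hSm
    have hcompl : {x | S g x ≤ ENNReal.ofReal τ} = {x | ENNReal.ofReal τ < S g x}ᶜ := by
      ext x
      simp
    have hq1 := hq_strong _ hG1
    have hs1 := hs_strong _ hG2
    rw [lintegral_enorm_indicator_rpow (hAm τ) g hq] at hq1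
    rw [lintegral_enorm_indicator_rpow (hAm τ).compl g hs0] at hs1
    have hpow : ∀ a : ℝ≥0∞, a ^ s = a ^ q * a ^ (s - q) := fun a => by
      rw [← ENNReal.rpow_add_of_nonneg _ _ hq.le hsq.le, add_sub_cancel]
    have hτpow : ENNReal.ofReal (τ ^ (p - q - 1)) =
        ENNReal.ofReal (τ ^ (p - s - 1)) * ENNReal.ofReal τ ^ (s - q) := by
      rw [ENNReal.ofReal_rpow_of_pos hτ, ← ENNReal.ofReal_mul (by positivity),
        ← Real.rpow_add hτ]
      ring_nf
    calc ENNReal.ofReal (τ ^ (p - q - 1)) *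
          ∫⁻ x in {x | ENNReal.ofReal τ < S g x}, S g x ^ q ∂ν +
        ENNReal.ofReal (τ ^ (p - s - 1)) *
          ∫⁻ x in {x | S g x ≤ ENNReal.ofReal τ}, S g x ^ s ∂ν
        = ∫⁻ x in {x | ENNReal.ofReal τ < S g x},
            ENNReal.ofReal (τ ^ (p - q - 1)) * S g x ^ q ∂ν +
          ∫⁻ x in {x | ENNReal.ofReal τ < S g x}ᶜ,
            ENNReal.ofReal (τ ^ (p - s - 1)) * S g x ^ s ∂ν := by
          rw [lintegral_const_mul' _ _ ENNReal.ofReal_ne_top,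
            lintegral_const_mul' _ _ ENNReal.ofReal_ne_top, hcompl]
      _ ≤ ∫⁻ x in {x | ENNReal.ofReal τ < S g x},
            (ENNReal.ofReal (τ ^ (p - q - 1)) * (2 * S ((A τ).indicator g) x) ^ q +
              ENNReal.ofReal (τ ^ (p - s - 1)) * (2 * S ((A τ)ᶜ.indicator g) x) ^ s) ∂ν +
          ∫⁻ x in {x | ENNReal.ofReal τ < S g x}ᶜ,
            (ENNReal.ofReal (τ ^ (p - q - 1)) * (2 * S ((A τ).indicator g) x) ^ q +
              ENNReal.ofReal (τ ^ (p - s - 1)) * (2 * S ((A τ)ᶜ.indicator g) x) ^ s) ∂ν := by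
          have hae := hS.le_add g hg (A τ) (hAm τ)
          refine add_le_add (lintegral_mono_ae ?_) (lintegral_mono_ae ?_)
          · filter_upwards [ae_restrict_of_ae hae, ae_restrict_mem hlt] with x hx
              (hxτ : ENNReal.ofReal τ < S g x)
            rcases le_total (S ((A τ)ᶜ.indicator g) x) (S ((A τ).indicator g) x) with h | h
            · refine le_add_right ?_
              gcongr
              exact hx.trans (by rw [two_mul]; gcongr)
            · refine le_add_left ?_
              calc ENNReal.ofReal (τ ^ (p - q - 1)) * S g x ^ q
                  = ENNReal.ofReal (τ ^ (p - s - 1)) *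
                    (S g x ^ q * ENNReal.ofReal τ ^ (s - q)) := by
                    rw [hτpow]
                    ring
                _ ≤ ENNReal.ofReal (τ ^ (p - s - 1)) * (S g x ^ q * S g x ^ (s - q)) := by
                    gcongr
                _ ≤ _ := by
                    rw [← hpow]
                    gcongr
                    exact hx.trans (by rw [two_mul]; gcongr)
          · filter_upwards [ae_restrict_of_ae hae, ae_restrict_mem hlt.compl] with x hx hxτ
            have hxτ' : S g x ≤ ENNReal.ofReal τ := not_lt.1 hxτ
            rcases le_total (S ((A τ)ᶜ.indicator g) x) (S ((A τ).indicator g) x) with h | h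
            · refine le_add_right ?_
              calc ENNReal.ofReal (τ ^ (p - s - 1)) * S g x ^ s
                  = ENNReal.ofReal (τ ^ (p - s - 1)) * (S g x ^ q * S g x ^ (s - q)) := by
                    rw [← hpow]
                _ ≤ ENNReal.ofReal (τ ^ (p - s - 1)) *
                    (S g x ^ q * ENNReal.ofReal τ ^ (s - q)) := by
                    gcongr
                _ = ENNReal.ofReal (τ ^ (p - q - 1)) * S g x ^ q := by
                    rw [hτpow]
                    ring
                _ ≤ _ := by
                    gcongr
                    exact hx.trans (by rw [two_mul]; gcongr)
            · refine le_add_left ?_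
              gcongr
              exact hx.trans (by rw [two_mul]; gcongr)
      _ = ENNReal.ofReal (τ ^ (p - q - 1)) * (ENNReal.ofReal (2 ^ q) *
            ∫⁻ x, S ((A τ).indicator g) x ^ q ∂ν) +
          ENNReal.ofReal (τ ^ (p - s - 1)) * (ENNReal.ofReal (2 ^ s) *
            ∫⁻ x, S ((A τ)ᶜ.indicator g) x ^ s ∂ν) := by
          have e : ∀ (a : ℝ≥0∞) {w : ℝ}, 0 < w → (2 * a) ^ w = ENNReal.ofReal (2 ^ w) * a ^ w :=
            fun a w hw => by
              rw [ENNReal.mul_rpow_of_nonneg _ _ hw.le, ← ENNReal.ofReal_rpow_of_pos zero_lt_two,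
                ENNReal.ofReal_ofNat]
          rw [lintegral_add_compl _ hlt, lintegral_add_left
            ((((hS.measurable _ hG1).const_mul _).pow_const _).const_mul _)]
          simp only [e _ hq, e _ hs0]
          simp only [lintegral_const_mul' _ _ ENNReal.ofReal_ne_top]
      _ ≤ ENNReal.ofReal (τ ^ (p - q - 1)) * (ENNReal.ofReal (2 ^ q) *
            (ENNReal.ofReal (N ^ q * b) * ∫⁻ x in A τ, ‖g x‖ₑ ^ q ∂μ)) +
          ENNReal.ofReal (τ ^ (p - s - 1)) * (ENNReal.ofReal (2 ^ s) *
            (ENNReal.ofReal (N ^ s) * ∫⁻ x in (A τ)ᶜ, ‖g x‖ₑ ^ s ∂μ)) := by gcongr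
      _ = _ := by
          rw [ENNReal.ofReal_mul (p := 2 ^ q) (by positivity),
            ENNReal.ofReal_mul (p := 2 ^ s) (by positivity)]
          ring
  have hpq : 0 < p - q := by linarith
  have hsp : 0 < s - p := by linarith
  set L : ℝ := 1 / (p - q) + 1 / (s - p) with hL
  have hL0 : 0 < L := by positivity
  have hfinal : ENNReal.ofReal L * ∫⁻ x, S g x ^ p ∂ν ≤
      ENNReal.ofReal L * (ENNReal.ofReal K * ∫⁻ x, ‖g x‖ₑ ^ p ∂μ) := by
    calc ENNReal.ofReal L * ∫⁻ x, S g x ^ p ∂ν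
        = ∫⁻ τ in Ioi (0 : ℝ), (ENNReal.ofReal (τ ^ (p - q - 1)) *
            ∫⁻ x in {x | ENNReal.ofReal τ < S g x}, S g x ^ q ∂ν +
          ENNReal.ofReal (τ ^ (p - s - 1)) *
            ∫⁻ x in {x | S g x ≤ ENNReal.ofReal τ}, S g x ^ s ∂ν) := by
          rw [lintegral_add_left hmS, hL1, hL2, ← add_mul, ← ENNReal.ofReal_add (by positivity)
            (by positivity)]
      _ ≤ ∫⁻ τ in Ioi (0 : ℝ), (ENNReal.ofReal (2 ^ q * (N ^ q * b)) *
            (ENNReal.ofReal (τ ^ (p - q - 1)) * ∫⁻ x in A τ, ‖g x‖ₑ ^ q ∂μ) +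
          ENNReal.ofReal (2 ^ s * N ^ s) * (ENNReal.ofReal (τ ^ (p - s - 1)) *
            ∫⁻ x in (A τ)ᶜ, ‖g x‖ₑ ^ s ∂μ)) :=
          setLIntegral_mono' measurableSet_Ioi fun τ hτ => hlevel τ hτ
      _ = ENNReal.ofReal (2 ^ q * (N ^ q * b)) * (ENNReal.ofReal (c ^ (q - p) / (p - q)) *
            ∫⁻ x, ‖g x‖ₑ ^ p ∂μ) +
          ENNReal.ofReal (2 ^ s * N ^ s) * (ENNReal.ofReal (c ^ (s - p) / (s - p)) *
            ∫⁻ x, ‖g x‖ₑ ^ p ∂μ) := by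
          rw [lintegral_add_left (hmg.const_mul _), lintegral_const_mul' _ _ ENNReal.ofReal_ne_top,
            lintegral_const_mul' _ _ ENNReal.ofReal_ne_top, hR1]
          simp only [hAc, hR2]
      _ = _ := by
          rw [← mul_assoc (ENNReal.ofReal _) (ENNReal.ofReal (c ^ (q - p) / (p - q))),
            ← mul_assoc (ENNReal.ofReal _) (ENNReal.ofReal (c ^ (s - p) / (s - p))),
            ← mul_assoc (ENNReal.ofReal L), ← ENNReal.ofReal_mul (by positivity),
            ← ENNReal.ofReal_mul (by positivity), ← ENNReal.ofReal_mul (by positivity),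
            ← add_mul, ← ENNReal.ofReal_add (by positivity) (by positivity),
            ← mul_div_assoc, ← mul_div_assoc, hKq, hKs]
          congr 2
          rw [hL]
          ring
  exact (ENNReal.mul_le_mul_iff_right (by simpa using hL0) ENNReal.ofReal_ne_top).1 hfinal

end Interpolation

/-! ### Strong type of the adjoint and duality -/

section DualOperator

open Filter Topology

/-- Bounded strongly measurable functions vanishing outside `E`. -/
structure IsBoundedOn {X H : Type*} [MeasurableSpace X] [NormedAddCommGroup H] (E : Set X)
    (g : X → H) : Prop where
  stronglyMeasurable : StronglyMeasurable g
  exists_bound : ∃ M : ℝ, ∀ x, ‖g x‖ ≤ M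
  eq_zero : ∀ x ∉ E, g x = 0

variable {X : Type*} [MeasurableSpace X] {μ ν : Measure X} {E V : Set X}

theorem IsBoundedOn.indicator {H : Type*} [NormedAddCommGroup H] {g : X → H}
    (hg : IsBoundedOn E g) {S : Set X} (hS : MeasurableSet S) : IsBoundedOn E (S.indicator g) where
  stronglyMeasurable := hg.stronglyMeasurable.indicator hS
  exists_bound := hg.exists_bound.imp fun _ hM x => (norm_indicator_le_norm_self _ _).trans (hM x)
  eq_zero x hx := by
    rw [indicator_apply_eq_zero]
    exact fun _ => hg.eq_zero x hx

theorem IsBoundedOn.memLp {H : Type*} [NormedAddCommGroup H] {g : X → H} (hg : IsBoundedOn E g)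
    {σ : Measure X} [IsFiniteMeasure σ] (p : ℝ≥0∞) : MemLp g p σ :=
  memLp_of_stronglyMeasurable_of_forall_norm_le hg.stronglyMeasurable hg.exists_bound.choose_spec p

variable {B : Type*} [NormedAddCommGroup B] [NormedSpace ℝ B] {r : ℝ≥0∞} [Fact (1 ≤ r)]
  {σ : Measure X}

open Classical in
/-- The absolute value of the adjoint of `U` at `g`, for a chosen representative; zero if the
adjoint has no density. -/
noncomputable def dualEnorm (U : Lp ℝ r ν →L[ℝ] Lp B r σ) (g : X → StrongDual ℝ B) (x : X) :
    ℝ≥0∞ :=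
  if h : ∃ k, IsDualDensity U g k then ‖h.choose x‖ₑ else 0

theorem exists_isDualDensity_dualEnorm_eq [IsFiniteMeasure ν] [IsFiniteMeasure σ] (hr : r ≠ ∞)
    {s : ℝ≥0∞} [hrs : ENNReal.HolderConjugate r s] (U : Lp ℝ r ν →L[ℝ] Lp B r σ)
    {g : X → StrongDual ℝ B} (hg : IsBoundedOn E g) :
    ∃ k, IsDualDensity U g k ∧ dualEnorm U g = fun x => ‖k x‖ₑ := by
  have h := exists_isDualDensity hr (s := s) U (hg.memLp (σ := σ) s)
  refine ⟨h.choose, h.choose_spec, ?_⟩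
  funext x
  rw [dualEnorm, dif_pos h]

theorem IsDualDensity.ae_eq [IsFiniteMeasure ν] [IsFiniteMeasure σ]
    {U : Lp ℝ r ν →L[ℝ] Lp B r σ} {g : X → StrongDual ℝ B} (hg : MemLp g ∞ σ) {k k' : X → ℝ}
    (hk : IsDualDensity U g k) (hk' : IsDualDensity U g k') : k =ᵐ[ν] k' := by
  have h0 : IsDualDensity U (0 : X → StrongDual ℝ B) 0 :=
    ⟨measurable_const, integrable_zero _ _ _, fun h _ => by simp⟩
  have hz : IsDualDensity U (g + 0) k := by rwa [add_zero]
  have h0T : MemLp (0 : X → StrongDual ℝ B) ∞ σ := by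
    simpa only [sub_self] using hg.sub hg
  have := IsDualDensity.add_ae_eq (g₁ := g) (g₂ := 0) hg h0T hz hk' h0
  rwa [add_zero] at this

theorem isSublinearOn_dualEnorm [IsFiniteMeasure ν] [IsFiniteMeasure σ] (hr : r ≠ ∞)
    {s : ℝ≥0∞} [hrs : ENNReal.HolderConjugate r s] (U : Lp ℝ r ν →L[ℝ] Lp B r σ) :
    IsSublinearOn ν (IsBoundedOn E) (dualEnorm U) where
  stronglyMeasurable _ hg := hg.stronglyMeasurable
  indicator_mem _ hg _ hS := hg.indicator hS
  measurable g hg := by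
    obtain ⟨k, hk, e⟩ := exists_isDualDensity_dualEnorm_eq hr (s := s) U hg
    rw [e]
    exact hk.measurable.enorm
  ne_top g hg x := by
    obtain ⟨k, hk, e⟩ := exists_isDualDensity_dualEnorm_eq hr (s := s) U hg
    rw [e]
    exact enorm_ne_top
  le_add g hg S hS := by
    obtain ⟨k, hk, e⟩ := exists_isDualDensity_dualEnorm_eq hr (s := s) U hg
    obtain ⟨k₁, hk₁, e₁⟩ := exists_isDualDensity_dualEnorm_eq hr (s := s) U (hg.indicator hS)
    obtain ⟨k₂, hk₂, e₂⟩ := exists_isDualDensity_dualEnorm_eq hr (s := s) U (hg.indicator hS.compl)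
    rw [e, e₁, e₂]
    have hk' : IsDualDensity U (S.indicator g + Sᶜ.indicator g) k := by
      rwa [indicator_self_add_compl]
    filter_upwards [hk'.add_ae_eq ((hg.indicator hS).memLp ∞) ((hg.indicator hS.compl).memLp ∞)
      hk₁ hk₂] with x hx
    rw [hx]
    exact enorm_add_le _ _

section Bounds

variable [IsFiniteMeasure (μ.restrict V)] [IsFiniteMeasure ν]
  (hr : r ≠ ∞) {s : ℝ≥0∞} [hrs : ENNReal.HolderConjugate r s]
  {U : Lp ℝ r ν →L[ℝ] Lp B r (μ.restrict V)} {n : ℝ≥0} (hn : 0 < n)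
  (hU : ∀ h, ‖U h‖ ≤ n * ‖h‖)
  (hweak : ∀ (g : X → StrongDual ℝ B) (k : X → ℝ), IsBoundedOn E g → IsDualDensity U g k →
    ∀ t : ℝ≥0, 0 < t → t * ν {x | (t : ℝ≥0∞) < ‖k x‖ₑ} ≤ n * ∫⁻ x, ‖g x‖ₑ ∂μ)

include hrs hr hweak in
/-- The weak type bound, in terms of `dualEnorm`. -/
theorem ofReal_mul_measure_dualEnorm_le (g : X → StrongDual ℝ B) (hg : IsBoundedOn E g) (t : ℝ)
    (ht : 0 < t) : ENNReal.ofReal t * ν {x | ENNReal.ofReal t < dualEnorm U g x} ≤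
      ENNReal.ofReal n * ∫⁻ x, ‖g x‖ₑ ∂μ := by
  obtain ⟨k, hk, e⟩ := exists_isDualDensity_dualEnorm_eq hr (s := s) U hg
  rw [e, ENNReal.ofReal_coe_nnreal]
  exact hweak g k hg hk t.toNNReal (Real.toNNReal_pos.2 ht)

include hrs hr hU in
/-- The bound at the exponent `s` conjugate to `r`, dual to that of `U`. -/
theorem lintegral_dualEnorm_rpow_le (hs : s ≠ ∞) (g : X → StrongDual ℝ B)
    (hg : IsBoundedOn E g) {N : ℝ} (hnN : n ≤ N) : ∫⁻ x, dualEnorm U g x ^ s.toReal ∂ν ≤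
      ENNReal.ofReal (N ^ s.toReal) * ∫⁻ x, ‖g x‖ₑ ^ s.toReal ∂μ := by
  obtain ⟨k, hk, e⟩ := exists_isDualDensity_dualEnorm_eq hr (s := s) U hg
  have hs0 : s ≠ 0 := (ENNReal.HolderConjugate.pos s r).ne'
  have hspos : 0 < s.toReal := ENNReal.toReal_pos hs0 hs
  have h1 := hk.eLpNorm_le hr hU (hg.memLp s)
  rw [eLpNorm_eq_lintegral_rpow_enorm_toReal hs0 hs,
    eLpNorm_eq_lintegral_rpow_enorm_toReal hs0 hs] at h1
  have h2 := ENNReal.rpow_le_rpow h1 hspos.le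
  rw [ENNReal.mul_rpow_of_nonneg _ _ hspos.le, ← ENNReal.rpow_mul, ← ENNReal.rpow_mul,
    one_div_mul_cancel hspos.ne', ENNReal.rpow_one, ENNReal.rpow_one] at h2
  rw [e]
  refine h2.trans (mul_le_mul' ?_ (setLIntegral_le_lintegral _ _))
  rw [← ENNReal.ofReal_coe_nnreal, ENNReal.ofReal_rpow_of_nonneg n.coe_nonneg hspos.le]
  gcongr

include hrs hr hn hU hweak in
/-- The bound for the adjoint between `L^1` and `L^s`, `s < ∞`: the Marcinkiewicz bound at the
exponent `q` is interpolated with the bound at `s`. -/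
theorem IsDualDensity.lintegral_rpow_le_of_lt [SFinite μ] (hs : s ≠ ∞) {q p : ℝ} (hq : 1 < q) (hqp : q < p)
    (hps : p < s.toReal) {g : X → StrongDual ℝ B} (hg : IsBoundedOn E g) {k : X → ℝ}
    (hk : IsDualDensity U g k) :
    ∫⁻ x, ‖k x‖ₑ ^ p ∂ν ≤ ENNReal.ofReal ((2 * (2 * n)) ^ p *
      (q / (q - 1) + q / (s.toReal - q)) ^ ((s.toReal - p) / (s.toReal - q))) *
        ∫⁻ x, ‖g x‖ₑ ^ p ∂μ := by
  obtain ⟨k', hk', e⟩ := exists_isDualDensity_dualEnorm_eq hr (s := s) U hg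
  have hS := isSublinearOn_dualEnorm (E := E) hr (s := s) U
  have hn' : (0 : ℝ) < n := by exact_mod_cast hn
  have hsq : 0 < s.toReal - q := by linarith
  have hq1 : 0 < q - 1 := by linarith
  have hq0 : 0 < q := by linarith
  have h1 : ∫⁻ x, ‖k x‖ₑ ^ p ∂ν = ∫⁻ x, dualEnorm U g x ^ p ∂ν := by
    rw [e]
    refine lintegral_congr_ae ?_
    filter_upwards [hk.ae_eq (hg.memLp ∞) hk'] with x hx
    rw [hx]
  rw [h1]
  refine hS.lintegral_rpow_le_of_strong_of_strong (N := 2 * n) (by positivity) (by positivity)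
    hq0 hqp hps (fun g hg => ?_) (fun g hg => ?_) hg
  · exact hS.lintegral_rpow_le_of_weak_of_strong hn'
      (ofReal_mul_measure_dualEnorm_le hr (s := s) hweak) hq (hqp.trans hps)
      (fun g hg => lintegral_dualEnorm_rpow_le hr hU hs g hg le_rfl) hg
  · exact lintegral_dualEnorm_rpow_le hr hU hs g hg (by linarith)

include hr hn hU hweak in
/-- The bound for the adjoint between `L^1` and `L^∞`. -/
theorem IsDualDensity.lintegral_rpow_le_of_top [SFinite μ] [hrs' : ENNReal.HolderConjugate r ∞] {p : ℝ}
    (hp : 1 < p) {g : X → StrongDual ℝ B} (hg : IsBoundedOn E g) {k : X → ℝ}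
    (hk : IsDualDensity U g k) :
    ∫⁻ x, ‖k x‖ₑ ^ p ∂ν ≤ ENNReal.ofReal ((2 * n) ^ p * (p / (p - 1))) *
        ∫⁻ x, ‖g x‖ₑ ^ p ∂μ := by
  obtain ⟨k', hk', e⟩ := exists_isDualDensity_dualEnorm_eq hr (s := ∞) U hg
  have hS := isSublinearOn_dualEnorm (E := E) hr (s := ∞) U
  have h1 : ∫⁻ x, ‖k x‖ₑ ^ p ∂ν = ∫⁻ x, dualEnorm U g x ^ p ∂ν := by
    rw [e]
    refine lintegral_congr_ae ?_
    filter_upwards [hk.ae_eq (hg.memLp ∞) hk'] with x hx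
    rw [hx]
  rw [h1]
  refine hS.lintegral_rpow_le_of_weak_of_bounded (by exact_mod_cast hn)
    (ofReal_mul_measure_dualEnorm_le hr (s := ∞) hweak) hp (fun g hg m hm hgm => ?_) hg
  obtain ⟨k, hk, e⟩ := exists_isDualDensity_dualEnorm_eq hr (s := ∞) U hg
  have h1 := hk.eLpNorm_le hr (s := ∞) hU (hg.memLp ∞)
  rw [eLpNorm_exponent_top, eLpNorm_exponent_top] at h1
  rw [e]
  filter_upwards [enorm_ae_le_eLpNormEssSup k ν] with x hx
  refine hx.trans (h1.trans ?_)
  rw [ENNReal.ofReal_mul n.coe_nonneg, ENNReal.ofReal_coe_nnreal]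
  gcongr
  exact essSup_le_of_ae_le _ (Eventually.of_forall hgm)

end Bounds

/-- A bound on the adjoint gives the dual bound on the operator. The functional that norms `U h` is
approximated by one that norms a simple function close to `U h`, so that it is strongly
measurable even if the dual space is not separable. -/
theorem lintegral_enorm_rpow_le_of_dual [IsFiniteMeasure (μ.restrict V)] [IsFiniteMeasure ν]
    (hE : MeasurableSet E) (hEV : E ⊆ V) (hν : ν = μ.restrict E) (hr : r ≠ ∞) {s : ℝ≥0∞}
    [hrs : ENNReal.HolderConjugate r s] {U : Lp ℝ r ν →L[ℝ] Lp B r (μ.restrict V)} {p q : ℝ}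
    (hpq : p.HolderConjugate q) {c : ℝ≥0}
    (hdual : ∀ (g : X → StrongDual ℝ B) (k : X → ℝ), IsBoundedOn E g → IsDualDensity U g k →
      ∫⁻ x, ‖k x‖ₑ ^ q ∂ν ≤ c ^ q * ∫⁻ x, ‖g x‖ₑ ^ q ∂μ)
    (h : Lp ℝ r ν) {M : ℝ} (hM : ∀ᵐ x ∂ν, ‖h x‖ ≤ M) :
    ∫⁻ x, ‖U h x‖ₑ ^ p ∂ν ≤ c ^ p * ∫⁻ x, ‖h x‖ₑ ^ p ∂ν := by
  have hp0 : 0 < p := hpq.pos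
  have hq0 : 0 < q := hpq.symm.pos
  have hfin : (∫⁻ x, ‖h x‖ₑ ^ p ∂ν) ^ (1 / p) ≠ ∞ := by
    have h1 : MemLp h (ENNReal.ofReal p) ν :=
      MemLp.of_bound (Lp.aestronglyMeasurable h) M hM
    have h2 := h1.2.ne
    rwa [eLpNorm_eq_lintegral_rpow_enorm_toReal (by simpa using hp0) ENNReal.ofReal_ne_top,
      ENNReal.toReal_ofReal hp0.le] at h2
  have hu : StronglyMeasurable (U h) := Lp.stronglyMeasurable _
  have hui : Integrable (U h) (μ.restrict V) := memLp_one_iff_integrable.1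
    ((Lp.memLp (U h)).mono_exponent Fact.out)
  have hνσ : ν = (μ.restrict V).restrict E := by
    rw [Measure.restrict_restrict_of_subset hEV, hν]
  have hνint : ∀ f : X → ℝ, ∫ x, f x ∂ν = ∫ x in E, f x ∂μ.restrict V := fun f => by rw [hνσ]
  have hνintegrable : ∀ f : X → ℝ, Integrable f ν ↔ IntegrableOn f E (μ.restrict V) :=
    fun f => by rw [hνσ, IntegrableOn]
  have hle : ν ≤ μ.restrict V := hνσ ▸ Measure.restrict_le_self
  have key := lintegral_rpow_le_of_forall_bounded (ν := ν) hpq hu.enorm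
    (c * ((∫⁻ x, ‖h x‖ₑ ^ p ∂ν) ^ (1 / p)).toNNReal) fun w hw ⟨m, hm⟩ => by
      refine ENNReal.le_of_forall_pos_le_add fun ε hε _ => ?_
      have hε' : (0 : ℝ) < ε / (2 * (m + 1)) := by positivity
      obtain ⟨φ, hφ, hφm⟩ := (memLp_one_iff_integrable.2 hui).exists_simpleFunc_eLpNorm_sub_lt
        ENNReal.one_ne_top (ENNReal.ofReal_pos.2 hε').ne'
      have hφi : Integrable φ (μ.restrict V) := memLp_one_iff_integrable.1 hφm
      have hφ' : ∫ x, ‖U h x - φ x‖ ∂ν < ε / (2 * (m + 1)) := by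
        have e1 := ofReal_integral_norm_eq_lintegral_enorm (hui.sub hφi)
        rw [eLpNorm_one_eq_lintegral_enorm, ← e1, ENNReal.ofReal_lt_ofReal_iff hε'] at hφ
        exact (integral_mono_measure hle (Eventually.of_forall fun x => norm_nonneg _)
          (hui.sub hφi).norm).trans_lt hφ
      -- `ξ v` norms `v`; no measurability of `ξ` is needed, since it is composed with `φ`.
      choose ξ hξ1 hξ using fun v : B => exists_dual_vector'' ℝ v
      set g : X → StrongDual ℝ B := E.indicator fun x => (w x : ℝ) • (φ.map ξ) x with hg
      have hgB : IsBoundedOn E g := by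
        refine ⟨StronglyMeasurable.indicator (StronglyMeasurable.smul
          (measurable_coe_nnreal_real.comp hw).stronglyMeasurable
          (φ.map ξ).stronglyMeasurable) hE, ⟨m, fun x => ?_⟩, fun x hx => indicator_of_notMem hx _⟩
        refine (norm_indicator_le_norm_self _ _).trans ?_
        rw [norm_smul, Real.norm_of_nonneg (w x).coe_nonneg, SimpleFunc.map_apply]
        calc (w x : ℝ) * ‖ξ (φ x)‖ ≤ m * 1 := by
              gcongr
              · exact hm x
              · exact hξ1 _
          _ = m := mul_one _
      obtain ⟨k, hk⟩ := exists_isDualDensity hr (s := s) U (hgB.memLp (σ := μ.restrict V) s)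
      have hgu : ∀ x, w x * ‖U h x‖ ≤ (w x : ℝ) * ξ (φ x) (U h x) + 2 * m * ‖U h x - φ x‖ := by
        intro x
        have e1 : ξ (φ x) (U h x) = ‖φ x‖ + ξ (φ x) (U h x - φ x) := by
          rw [map_sub, hξ]
          simp
        have e2 : |ξ (φ x) (U h x - φ x)| ≤ ‖U h x - φ x‖ := by
          refine ((ξ (φ x)).le_opNorm _).trans ?_
          exact mul_le_of_le_one_left (norm_nonneg _) (hξ1 _)
        have e3 : ‖U h x‖ ≤ ‖φ x‖ + ‖U h x - φ x‖ := norm_le_norm_add_norm_sub' _ _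
        have e4 : ‖U h x‖ ≤ ξ (φ x) (U h x) + 2 * ‖U h x - φ x‖ := by
          rw [e1]
          linarith [neg_abs_le (ξ (φ x) (U h x - φ x))]
        calc w x * ‖U h x‖ ≤ w x * (ξ (φ x) (U h x) + 2 * ‖U h x - φ x‖) := by gcongr
          _ = w x * ξ (φ x) (U h x) + w x * (2 * ‖U h x - φ x‖) := by ring
          _ ≤ w x * ξ (φ x) (U h x) + m * (2 * ‖U h x - φ x‖) := by
              gcongr
              exact hm x
          _ = _ := by ring
      have hgi : Integrable (fun x => g x (U h x)) (μ.restrict V) :=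
        integrable_apply_of_memLp_top (hgB.memLp ∞) (Lp.memLp _)
      have hgint : ∫ x, g x (U h x) ∂μ.restrict V = ∫ x, (w x : ℝ) * ξ (φ x) (U h x) ∂ν := by
        rw [hνint, ← integral_indicator hE]
        refine integral_congr_ae (Eventually.of_forall fun x => ?_)
        by_cases hx : x ∈ E <;> simp [hg, hx]
      have hgi' : Integrable (fun x => (w x : ℝ) * ξ (φ x) (U h x)) ν := by
        rw [hνintegrable, ← integrable_indicator_iff hE]
        refine hgi.congr (Eventually.of_forall fun x => ?_)
        by_cases hx : x ∈ E <;> simp [hg, hx]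
      have hdi : Integrable (fun x => ‖U h x - φ x‖) ν := ((hui.sub hφi).mono_measure hle).norm
      have hwu : Integrable (fun x => w x * ‖U h x‖) ν := by
        refine (hui.mono_measure hle).norm.bdd_mul (c := m)
          (measurable_coe_nnreal_real.comp hw).aestronglyMeasurable
          (Eventually.of_forall fun x => ?_)
        rw [Real.norm_of_nonneg (w x).coe_nonneg]
        exact hm x
      have hreal : ∫ x, w x * ‖U h x‖ ∂ν ≤ ∫ x, h x * k x ∂ν + ε := by
        calc ∫ x, w x * ‖U h x‖ ∂ν
            ≤ ∫ x, ((w x : ℝ) * ξ (φ x) (U h x) + 2 * m * ‖U h x - φ x‖) ∂ν :=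
              integral_mono hwu (hgi'.add (hdi.const_mul _)) hgu
          _ = ∫ x, h x * k x ∂ν + 2 * m * ∫ x, ‖U h x - φ x‖ ∂ν := by
              rw [integral_add hgi' (hdi.const_mul _), integral_const_mul, ← hgint,
                hk.integral_eq h ⟨M, hM⟩]
          _ ≤ ∫ x, h x * k x ∂ν + 2 * m * (ε / (2 * (m + 1))) := by gcongr
          _ ≤ _ := by
              gcongr
              rw [← mul_div_assoc, div_le_iff₀ (by positivity)]
              have := ε.2
              nlinarith [m.2]
      have hkint : ENNReal.ofReal (∫ x, h x * k x ∂ν) ≤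
          c * (∫⁻ x, ‖h x‖ₑ ^ p ∂ν) ^ (1 / p) * (∫⁻ x, (w x : ℝ≥0∞) ^ q ∂ν) ^ (1 / q) := by
        calc ENNReal.ofReal (∫ x, h x * k x ∂ν) ≤ ‖∫ x, h x * k x ∂ν‖ₑ :=
              Real.ofReal_le_enorm _
          _ ≤ ∫⁻ x, ‖h x * k x‖ₑ ∂ν := enorm_integral_le_lintegral_enorm _
          _ = ∫⁻ x, ((fun x => ‖h x‖ₑ) * fun x => ‖k x‖ₑ) x ∂ν := by
              simp only [enorm_mul, Pi.mul_apply]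
          _ ≤ (∫⁻ x, ‖h x‖ₑ ^ p ∂ν) ^ (1 / p) * (∫⁻ x, ‖k x‖ₑ ^ q ∂ν) ^ (1 / q) :=
              ENNReal.lintegral_mul_le_Lp_mul_Lq ν hpq (Lp.stronglyMeasurable h).enorm.aemeasurable
                hk.measurable.enorm.aemeasurable
          _ ≤ (∫⁻ x, ‖h x‖ₑ ^ p ∂ν) ^ (1 / p) *
              (c ^ q * ∫⁻ x, (w x : ℝ≥0∞) ^ q ∂ν) ^ (1 / q) := by
              gcongr
              refine (hdual g k hgB hk).trans ?_
              refine mul_le_mul_right ?_ _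
              have hνl : ∀ f : X → ℝ≥0∞, ∫⁻ x, f x ∂ν = ∫⁻ x in E, f x ∂μ := fun f => by rw [hν]
              rw [hνl, ← lintegral_indicator hE]
              refine lintegral_mono fun x => ?_
              by_cases hx : x ∈ E
              · simp only [hg, indicator_of_mem hx]
                gcongr
                rw [enorm_smul, SimpleFunc.map_apply, Real.enorm_eq_ofReal (w x).coe_nonneg,
                  ENNReal.ofReal_coe_nnreal]
                refine mul_le_of_le_one_right zero_le ?_
                rw [← enorm_norm, Real.enorm_eq_ofReal (norm_nonneg _)]
                exact ENNReal.ofReal_le_one.2 (hξ1 _)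
              · simp only [hg, indicator_of_notMem hx]
                rw [enorm_eq_nnnorm, nnnorm_zero, ENNReal.coe_zero, ENNReal.zero_rpow_of_pos hq0]
          _ = _ := by
              rw [ENNReal.mul_rpow_of_nonneg _ _ (by positivity), ← ENNReal.rpow_mul,
                mul_one_div_cancel hq0.ne', ENNReal.rpow_one]
              ring
      calc ∫⁻ x, w x * ‖U h x‖ₑ ∂ν = ENNReal.ofReal (∫ x, w x * ‖U h x‖ ∂ν) := by
            rw [ofReal_integral_eq_lintegral_ofReal hwu
              (Eventually.of_forall fun x => mul_nonneg (w x).coe_nonneg (norm_nonneg _))]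
            refine lintegral_congr fun x => ?_
            rw [ENNReal.ofReal_mul (w x).coe_nonneg, ENNReal.ofReal_coe_nnreal, ofReal_norm]
        _ ≤ ENNReal.ofReal (∫ x, h x * k x ∂ν + ε) := ENNReal.ofReal_le_ofReal hreal
        _ ≤ ENNReal.ofReal (∫ x, h x * k x ∂ν) + ε := by
            refine ENNReal.ofReal_add_le.trans ?_
            rw [ENNReal.ofReal_coe_nnreal]
        _ ≤ _ := by
            rw [ENNReal.coe_toNNReal hfin]
            gcongr
  rwa [ENNReal.coe_toNNReal hfin, ENNReal.mul_rpow_of_nonneg _ _ hp0.le, ← ENNReal.rpow_mul,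
    one_div_mul_cancel hp0.ne', ENNReal.rpow_one] at key

end DualOperator

/-! ### The function `φ` -/

section PhiConst

open Filter Topology

theorem conjExponent_ofReal {q : ℝ} (hq : 1 < q) :
    (ENNReal.ofReal q).conjExponent = ENNReal.ofReal (q / (q - 1)) := by
  have h1 : 0 < q - 1 := by linarith
  rw [ENNReal.conjExponent, ← ENNReal.ofReal_one, ← ENNReal.ofReal_sub _ zero_le_one,
    ← ENNReal.ofReal_inv_of_pos h1, ← ENNReal.ofReal_add zero_le_one (by positivity)]
  congr 1
  field_simp
  ring

/-- The quantity minimised in `phiLow s p`, for a finite exponent `s`. -/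
theorem phiLow_term_of_lt {q p s : ℝ} (hq : 1 < q) (hqp : q < p) (hps : p < s) :
    ((ENNReal.ofReal q).conjExponent + (ENNReal.ofReal s / ENNReal.ofReal q - 1)⁻¹) ^
      (((1 / ENNReal.ofReal p).toReal - (1 / ENNReal.ofReal s).toReal) /
        (1 - (ENNReal.ofReal q / ENNReal.ofReal s).toReal)) =
      ENNReal.ofReal ((q / (q - 1) + q / (s - q)) ^ ((s - p) / (s - q) / p)) := by
  have h1 : 0 < q - 1 := by linarith
  have hq0 : 0 < q := by linarith
  have hp0 : 0 < p := by linarith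
  have hs0 : 0 < s := by linarith
  have hsq : 0 < s - q := by linarith
  have hd : 0 < s / q - 1 := by
    rw [sub_pos, one_lt_div hq0]
    linarith
  rw [conjExponent_ofReal hq, ← ENNReal.ofReal_div_of_pos hq0, ← ENNReal.ofReal_one,
    ← ENNReal.ofReal_sub _ zero_le_one, ← ENNReal.ofReal_inv_of_pos hd,
    ← ENNReal.ofReal_add (by positivity) (by positivity), ← ENNReal.ofReal_div_of_pos hs0,
    ← ENNReal.ofReal_div_of_pos hs0, ← ENNReal.ofReal_div_of_pos hp0,
    ENNReal.toReal_ofReal (by positivity), ENNReal.toReal_ofReal (by positivity),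
    ENNReal.toReal_ofReal (by positivity), ENNReal.ofReal_rpow_of_pos (by positivity)]
  have e : (1 / p - 1 / s) / (1 - q / s) = (s - p) / (s - q) / p := by
    have : 1 - q / s = (s - q) / s := by field_simp
    rw [this]
    field_simp
  have e' : (s / q - 1)⁻¹ = q / (s - q) := by
    rw [div_sub_one hq0.ne', inv_div]
  rw [e, e']

/-- The quantity minimised in `phiLow ∞ p`. -/
theorem phiLow_term_of_top {q p : ℝ} (hq : 1 < q) (hp : 0 < p) :
    ((ENNReal.ofReal q).conjExponent + ((∞ : ℝ≥0∞) / ENNReal.ofReal q - 1)⁻¹) ^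
      (((1 / ENNReal.ofReal p).toReal - (1 / (∞ : ℝ≥0∞)).toReal) /
        (1 - (ENNReal.ofReal q / ∞).toReal)) =
      ENNReal.ofReal ((q / (q - 1)) ^ (1 / p)) := by
  have h1 : 0 < q - 1 := by linarith
  have hq0 : 0 < q := by linarith
  rw [conjExponent_ofReal hq, ENNReal.top_div_of_ne_top ENNReal.ofReal_ne_top,
    ENNReal.top_sub ENNReal.one_ne_top, ENNReal.inv_top, add_zero, ENNReal.div_top,
    ENNReal.div_top, ENNReal.toReal_zero, sub_zero, sub_zero, div_one, ← ENNReal.ofReal_one,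
    ← ENNReal.ofReal_div_of_pos hp, ENNReal.toReal_ofReal (by positivity),
    ENNReal.ofReal_rpow_of_pos (by positivity)]

theorem phiConst_of_lt {r p : ℝ≥0∞} (h : r < p) :
    phiConst r p = phiLow r.conjExponent p.conjExponent :=
  if_neg fun hh => hh.2.not_gt h

variable {X : Type*} [MeasurableSpace X] {μ ν : Measure X} {E V : Set X}
  {B : Type*} [NormedAddCommGroup B] [NormedSpace ℝ B] {r : ℝ≥0∞} [Fact (1 ≤ r)]

/-- An operator whose adjoint is of weak type `(1, 1)` is bounded on `L^p`, `r < p < ∞`. The factor `4`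
comes from the two interpolations, and for `r = 1` from one of them, with room to spare. -/
theorem eLpNorm_le_phiConst_of_weak [SFinite μ] [IsFiniteMeasure (μ.restrict V)]
    [IsFiniteMeasure ν] (hE : MeasurableSet E) (hEV : E ⊆ V) (hν : ν = μ.restrict E) (hr : r ≠ ∞)
    {U : Lp ℝ r ν →L[ℝ] Lp B r (μ.restrict V)} {n : ℝ≥0} (hn : 0 < n)
    (hU : ∀ h, ‖U h‖ ≤ n * ‖h‖)
    (hweak : ∀ (g : X → StrongDual ℝ B) (k : X → ℝ), IsBoundedOn E g → IsDualDensity U g k →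
      ∀ t : ℝ≥0, 0 < t → t * ν {x | (t : ℝ≥0∞) < ‖k x‖ₑ} ≤ n * ∫⁻ x, ‖g x‖ₑ ∂μ)
    {p : ℝ≥0∞} (hrp : r < p) (hp : p ≠ ∞) (h : Lp ℝ r ν) {M : ℝ} (hM : ∀ᵐ x ∂ν, ‖h x‖ ≤ M) :
    eLpNorm (U h) p ν ≤ 4 * n * phiConst r p * eLpNorm h p ν := by
  have hr1 : 1 ≤ r := Fact.out
  have hp1 : 1 < p := hr1.trans_lt hrp
  obtain ⟨P, hP, rfl⟩ : ∃ P : ℝ, 1 < P ∧ p = ENNReal.ofReal P := by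
    refine ⟨p.toReal, ?_, (ENNReal.ofReal_toReal hp).symm⟩
    rw [← ENNReal.toReal_one]
    exact (ENNReal.toReal_lt_toReal ENNReal.one_ne_top hp).2 hp1
  have hP0 : 0 < P := by linarith
  set Q : ℝ := P / (P - 1) with hQ
  have hPQ : P.HolderConjugate Q := Real.HolderConjugate.conjExponent hP
  have hQ1 : 1 < Q := hPQ.symm.lt
  set s := r.conjExponent with hs
  have hrs : ENNReal.HolderConjugate r s := ENNReal.HolderConjugate.conjExponent hr1
  have hcq : (ENNReal.ofReal P).conjExponent = ENNReal.ofReal Q := conjExponent_ofReal hP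
  have hQs : ENNReal.ofReal Q < s := by
    rw [← hcq, hs, ENNReal.conjExponent, ENNReal.conjExponent]
    refine ENNReal.add_lt_add_left ENNReal.one_ne_top (ENNReal.inv_lt_inv.2 ?_)
    exact ENNReal.sub_lt_of_lt_add hr1 (by rwa [tsub_add_cancel_of_le hp1.le])
  -- The bound for a fixed `q`.
  have key : ∀ q ∈ Ioo 1 (ENNReal.ofReal Q), eLpNorm (U h) (ENNReal.ofReal P) ν ≤ 4 * n *
      eLpNorm h (ENNReal.ofReal P) ν * (q.conjExponent + (s / q - 1)⁻¹) ^
        (((1 / ENNReal.ofReal Q).toReal - (1 / s).toReal) / (1 - (q / s).toReal)) := by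
    rintro q ⟨hq1, hqQ⟩
    obtain ⟨x, hx1, rfl⟩ : ∃ x : ℝ, 1 < x ∧ q = ENNReal.ofReal x := by
      refine ⟨q.toReal, ?_, (ENNReal.ofReal_toReal hqQ.ne_top).symm⟩
      rw [← ENNReal.toReal_one]
      exact (ENNReal.toReal_lt_toReal ENNReal.one_ne_top hqQ.ne_top).2 hq1
    have hxQ : x < Q := (ENNReal.ofReal_lt_ofReal_iff (by linarith)).1 hqQ
    have hx : 0 < x - 1 := by linarith
    have hQ0 : 0 < Q := by linarith
    obtain ⟨β, hβ, hβe, H⟩ : ∃ β : ℝ, 0 < β ∧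
        ((ENNReal.ofReal x).conjExponent + (s / ENNReal.ofReal x - 1)⁻¹) ^
          (((1 / ENNReal.ofReal Q).toReal - (1 / s).toReal) /
            (1 - (ENNReal.ofReal x / s).toReal)) = ENNReal.ofReal β ∧
        ∀ (g : X → StrongDual ℝ B) (k : X → ℝ), IsBoundedOn E g → IsDualDensity U g k →
          ∫⁻ y, ‖k y‖ₑ ^ Q ∂ν ≤ ENNReal.ofReal ((4 * n * β) ^ Q) * ∫⁻ y, ‖g y‖ₑ ^ Q ∂μ := by
      rcases eq_or_ne s ∞ with hst | hst
      · rw [hst] at hrs ⊢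
        refine ⟨_, ?_, phiLow_term_of_top hx1 hQ0, fun g k hg hk => ?_⟩
        · positivity
        refine (hk.lintegral_rpow_le_of_top hr hn hU hweak hQ1 hg).trans ?_
        gcongr
        rw [Real.mul_rpow (x := 4 * n) (by positivity) (by positivity),
          ← Real.rpow_mul (by positivity), one_div_mul_cancel hQ0.ne', Real.rpow_one]
        -- Interpolating directly at `Q` is better than at `x`: the exponent `x'` exceeds `Q'`.
        have hQ1' : 0 < Q - 1 := by linarith
        gcongr ?_ ^ Q * ?_
        · linarith [n.coe_nonneg]
        · rw [div_le_div_iff₀ hQ1' hx]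
          linarith
      · have hS : s = ENNReal.ofReal s.toReal := (ENNReal.ofReal_toReal hst).symm
        have hQS : Q < s.toReal := (ENNReal.ofReal_lt_iff_lt_toReal hQ0.le hst).1 hQs
        have hxS : 0 < s.toReal - x := by linarith
        refine ⟨_, ?_, by rw [hS]; exact phiLow_term_of_lt hx1 hxQ hQS, fun g k hg hk => ?_⟩
        · positivity
        refine (hk.lintegral_rpow_le_of_lt hr (s := s) hn hU hweak hst hx1 hxQ hQS hg).trans
          (le_of_eq ?_)
        rw [Real.mul_rpow (x := 4 * n) (by positivity) (by positivity),
          ← Real.rpow_mul (by positivity), div_mul_cancel₀ _ hQ0.ne']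
        ring_nf
    rw [hβe]
    have hc : (0 : ℝ) < 4 * n * β := by positivity
    have hmain := lintegral_enorm_rpow_le_of_dual hE hEV hν hr (s := s) hPQ
      (c := (4 * n * β).toNNReal) (fun g k hg hk => (H g k hg hk).trans_eq (by
        rw [← ENNReal.ofReal_rpow_of_pos hc, ENNReal.ofReal])) h hM
    have h1 := ENNReal.rpow_le_rpow hmain (one_div_nonneg.2 hP0.le)
    rw [ENNReal.mul_rpow_of_nonneg _ _ (by positivity), ← ENNReal.rpow_mul,
      mul_one_div_cancel hP0.ne', ENNReal.rpow_one] at h1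
    rw [eLpNorm_eq_lintegral_rpow_enorm_toReal (by simpa using hP0) hp,
      eLpNorm_eq_lintegral_rpow_enorm_toReal (by simpa using hP0) hp, ENNReal.toReal_ofReal hP0.le]
    refine h1.trans_eq ?_
    rw [← ENNReal.ofReal, ENNReal.ofReal_mul (by positivity), ENNReal.ofReal_mul (by norm_num),
      ENNReal.ofReal_coe_nnreal, ENNReal.ofReal_ofNat]
    ring
  have hhp : MemLp h (ENNReal.ofReal P) ν := MemLp.of_bound (Lp.aestronglyMeasurable h) M hM
  rw [phiConst_of_lt hrp, hcq, phiLow, mul_right_comm]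
  rcases eq_or_ne (eLpNorm h (ENNReal.ofReal P) ν) 0 with h0 | h0
  · have h1 := key (ENNReal.ofReal ((1 + Q) / 2)) ⟨by
      rw [ENNReal.one_lt_ofReal]; linarith, by
      rw [ENNReal.ofReal_lt_ofReal_iff (by linarith)]; linarith⟩
    rw [h0, mul_zero, zero_mul] at h1 ⊢
    exact h1
  have ha0 : 4 * n * eLpNorm h (ENNReal.ofReal P) ν ≠ 0 :=
    mul_ne_zero (mul_ne_zero four_ne_zero (by exact_mod_cast hn.ne')) h0
  have hat : 4 * n * eLpNorm h (ENNReal.ofReal P) ν ≠ ∞ :=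
    ENNReal.mul_ne_top (ENNReal.mul_ne_top ENNReal.ofNat_ne_top ENNReal.coe_ne_top) hhp.2.ne
  rw [mul_comm, ← ENNReal.div_le_iff ha0 hat]
  refine le_iInf₂ fun q hq => ?_
  rw [ENNReal.div_le_iff ha0 hat, mul_comm]
  exact key q hq

end PhiConst

/-! ### Reduction to scalar input -/

section Reduction

open Filter Topology

/-- An operator on vector-valued functions, restricted to the functions pointing in a fixed
direction `u`, is an operator on scalar functions. -/
theorem exists_scalar_operator {X 𝕜 B₁ B₂ : Type*} [MeasurableSpace X] {ν σ : Measure X}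
    [RCLike 𝕜] [NormedAddCommGroup B₁] [NormedSpace 𝕜 B₁] [NormedAddCommGroup B₂]
    [NormedSpace 𝕜 B₂] [NormedSpace ℝ B₂] {r : ℝ≥0∞} [Fact (1 ≤ r)]
    (T : Lp B₁ r ν →L[𝕜] Lp B₂ r σ) {A : ℝ≥0} (hT : ∀ f, ‖T f‖ ≤ A * ‖f‖) {u : X → B₁}
    (hu : StronglyMeasurable u) (hu1 : ∀ x, ‖u x‖ ≤ 1) :
    ∃ (U : Lp ℝ r ν →L[ℝ] Lp B₂ r σ) (L : Lp ℝ r ν → Lp B₁ r ν),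
      (∀ h, U h = T (L h)) ∧ (∀ h, L h =ᵐ[ν] fun x => ((h x : ℝ) : 𝕜) • u x) ∧
        ∀ h, ‖U h‖ ≤ A * ‖h‖ := by
  have hle : ∀ (h : Lp ℝ r ν) x, ‖((h x : ℝ) : 𝕜) • u x‖ ≤ ‖h x‖ := fun h x => by
    rw [norm_smul, RCLike.norm_ofReal, ← Real.norm_eq_abs]
    exact mul_le_of_le_one_right (norm_nonneg _) (hu1 x)
  have hmem : ∀ h : Lp ℝ r ν, MemLp (fun x => ((h x : ℝ) : 𝕜) • u x) r ν := fun h =>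
    (Lp.memLp h).of_le ((RCLike.continuous_ofReal.comp_stronglyMeasurable
      (Lp.stronglyMeasurable h)).smul hu).aestronglyMeasurable (Eventually.of_forall (hle h))
  set L : Lp ℝ r ν →+ Lp B₁ r ν := AddMonoidHom.mk' (fun h => (hmem h).toLp _) fun h h' => by
    rw [← MemLp.toLp_add]
    refine MemLp.toLp_congr _ _ ?_
    filter_upwards [Lp.coeFn_add h h'] with x hx
    rw [hx, Pi.add_apply, Pi.add_apply, RCLike.ofReal_add, add_smul] with hL
  have hLae : ∀ h, L h =ᵐ[ν] fun x => ((h x : ℝ) : 𝕜) • u x := fun h => (hmem h).coeFn_toLp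
  have hLnorm : ∀ h, ‖L h‖ ≤ ‖h‖ := fun h => by
    refine Lp.norm_le_norm_of_ae_le ?_
    filter_upwards [hLae h] with x hx
    rw [hx]
    exact hle h x
  have hTL : ∀ h, ‖T (L h)‖ ≤ A * ‖h‖ := fun h => (hT _).trans (by gcongr; exact hLnorm h)
  refine ⟨((T : Lp B₁ r ν →ₗ[𝕜] Lp B₂ r σ).toAddMonoidHom.comp L).toRealLinearMap ?_, L,
    fun h => rfl, hLae, hTL⟩
  exact AddMonoidHomClass.continuous_of_bound _ A hTL

variable {X : Type*} [MetricSpace X] [MeasurableSpace X] [BorelSpace X] {μ : Measure X}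

/-- The scalar case: boundedness on `L^p` of an operator with small oscillation. -/
theorem eLpNorm_le_of_hasSmallOscillation [SecondCountableTopology X]
    [IsLocallyFiniteMeasure μ] [μ.IsOpenPosMeasure] {B : Type*} [NormedAddCommGroup B]
    [NormedSpace ℝ B] [CompleteSpace B] {r : ℝ≥0∞} [Fact (1 ≤ r)] {ν : Measure X}
    {R : ℝ} (hR : 0 < R) {D : ℝ≥0} (hD1 : 1 ≤ D)
    (hdbl : ∀ (x : X) (s : ℝ), 0 < s → s ≤ R →
      μ (Metric.ball x (2 * s)) ≤ D * μ (Metric.ball x s))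
    {E V : Set X} (hE : MeasurableSet E) (hdiam : ∀ x ∈ E, ∀ y ∈ E, dist x y < R)
    (hν : ν = μ.restrict E) (hV : MeasurableSet V) (hEV : ∀ c ∈ E, Metric.ball c (R / 2) ⊆ V)
    [IsFiniteMeasure (μ.restrict V)] [IsFiniteMeasure ν] (hr : r ≠ ∞)
    {U : Lp ℝ r ν →L[ℝ] Lp B r (μ.restrict V)} {A : ℝ≥0} (hA : 0 < A)
    (hU : ∀ h, ‖U h‖ ≤ A * ‖h‖) {C : ℝ≥0} (hosc : HasSmallOscillation E R C U)
    {p : ℝ≥0∞} (hrp : r < p) (hp : p ≠ ∞) (h : Lp ℝ r ν) {M : ℝ} (hM : ∀ᵐ x ∂ν, ‖h x‖ ≤ M) :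
    eLpNorm (U h) p ν ≤ 16 * phiConst r p * (D ^ 9 * A + C) * eLpNorm h p ν := by
  have hD0 : 0 < D := one_pos.trans_le hD1
  set n : ℝ≥0 := 4 * D ^ 6 * A + 2 * C with hn
  have hAn : A ≤ n := by
    calc A = 1 * 1 * A + 0 := by ring
      _ ≤ n := by
          rw [hn]
          gcongr
          · norm_num
          · exact one_le_pow₀ hD1
          · exact zero_le
  have h1 := eLpNorm_le_phiConst_of_weak hE
    (fun c hc => hEV c hc (Metric.mem_ball_self (by linarith))) hν hr (hA.trans_le hAn)
    (fun h => (hU h).trans (by gcongr))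
    (fun g k hg hk t ht => hk.mul_measure_le hR hD1 hdbl hdiam hν hV hEV hr
      (s := r.conjExponent) hA hU hosc hg.stronglyMeasurable hg.exists_bound.choose_spec
      hg.eq_zero ht) hrp hp h hM
  refine h1.trans ?_
  have h2 : 4 * n ≤ 16 * (D ^ 9 * A + C) := by
    calc 4 * n = 16 * (D ^ 6 * A) + 8 * C := by rw [hn]; ring
      _ ≤ 16 * (D ^ 9 * A) + 16 * C := by
          gcongr ?_ + ?_
          · gcongr 16 * (?_ * A)
            exact pow_le_pow_right₀ hD1 (by norm_num)
          · gcongr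
            norm_num
      _ = _ := by ring
  rw [mul_right_comm 16]
  refine mul_le_mul_left (mul_le_mul_left ?_ _) _
  exact_mod_cast h2

/-- The operator restricted to one direction inherits the kernel representation, and the regularity
of the kernel bounds its oscillation: if `h` vanishes on `B(c, 16 δ)` and `x`, `x'` are within
`2 δ` of `c`, then `2 d(x, x') ≤ 8 δ`, which is less than the distance from `x` to the support of
`h`. -/
theorem hasSmallOscillation_of_kernel {𝕜 B₁ B₂ : Type*} [RCLike 𝕜] [NormedAddCommGroup B₁]
    [NormedSpace 𝕜 B₁] [NormedAddCommGroup B₂] [NormedSpace 𝕜 B₂] [NormedSpace ℝ B₂]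
    [IsLocallyFiniteMeasure μ] [SecondCountableTopology X]
    {r : ℝ≥0∞} [Fact (1 ≤ r)] {R : ℝ} {E E₀ V : Set X} (hE₀ : E₀ ⊆ E)
    (hEV : ∀ c ∈ E, Metric.ball c (R / 2) ⊆ V)
    {T : Lp B₁ r (μ.restrict E) →L[𝕜] Lp B₂ r (μ.restrict V)} {K : X → X → B₁ →L[𝕜] B₂}
    (hi : ∀ F : Set X, IsOpen F → F ⊆ V →
      Integrable (fun z : X × X => K z.1 z.2) ((μ.restrict F).prod (μ.restrict (E \ F))) ∧
      ∀ f : Lp B₁ r (μ.restrict E), MemLp f ∞ (μ.restrict E) →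
        (∀ᵐ y ∂μ.restrict (E ∩ F), f y = 0) →
        ∀ᵐ x ∂μ.restrict F, T f x = ∫ y in E \ F, K x y (f y) ∂μ)
    {C : ℝ≥0}
    (hiii : ∀ᵐ x ∂μ.restrict V, ∀ᵐ x' ∂μ.restrict V, dist x x' < R →
      ∫⁻ y in E \ Metric.ball x (2 * dist x x'), ‖K x y - K x' y‖ₑ ∂μ ≤ C)
    {u : X → B₁} (hu1 : ∀ x, ‖u x‖ ≤ 1)
    {U : Lp ℝ r (μ.restrict E) →L[ℝ] Lp B₂ r (μ.restrict V)}
    {L : Lp ℝ r (μ.restrict E) → Lp B₁ r (μ.restrict E)} (hUL : ∀ h, U h = T (L h))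
    (hL : ∀ h, L h =ᵐ[μ.restrict E] fun x => ((h x : ℝ) : 𝕜) • u x) :
    HasSmallOscillation E₀ R C U := by
  intro c hc δ hδ hδR h h1 h0
  set F := Metric.ball c (3 * δ) with hF
  have hFV : F ⊆ V := (Metric.ball_subset_ball (by linarith)).trans (hEV c (hE₀ hc))
  have hBF : Metric.closedBall c (2 * δ) ⊆ F := Metric.closedBall_subset_ball (by linarith)
  have hL1 : ∀ᵐ y ∂μ.restrict E, ‖L h y‖ ≤ 1 := by
    filter_upwards [hL h, h1] with y hy hy1
    rw [hy, norm_smul, RCLike.norm_ofReal, ← Real.norm_eq_abs]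
    exact mul_le_one₀ hy1 (norm_nonneg _) (hu1 y)
  have hL0 : ∀ᵐ y ∂μ.restrict E, y ∈ Metric.ball c (16 * δ) → L h y = 0 := by
    filter_upwards [hL h, h0] with y hy hy0 hyc
    rw [hy, hy0 hyc, RCLike.ofReal_zero, zero_smul]
  have hLm : AEStronglyMeasurable (L h) (μ.restrict E) := Lp.aestronglyMeasurable _
  have hEF : μ.restrict (E \ F) ≤ μ.restrict E := Measure.restrict_mono sdiff_subset le_rfl
  obtain ⟨hint, hrep⟩ := hi F Metric.isOpen_ball hFV
  have hrep' := hrep (L h) (memLp_top_of_bound hLm 1 hL1) (by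
    have h2 : ∀ᵐ y ∂μ.restrict (E ∩ F), y ∈ Metric.ball c (16 * δ) → L h y = 0 :=
      ae_mono (Measure.restrict_mono inter_subset_left le_rfl) hL0
    have h3 : ∀ᵐ y ∂μ.restrict (E ∩ F), y ∈ F :=
      ae_mono (Measure.restrict_mono inter_subset_right le_rfl)
        (ae_restrict_mem Metric.isOpen_ball.measurableSet)
    filter_upwards [h2, h3] with y hy hyF
    exact hy (Metric.ball_subset_ball (by linarith) hyF))
  -- The properties of a generic point of the ball.
  have hgood : ∀ᵐ x ∂μ.restrict (Metric.closedBall c (2 * δ)),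
      U h x = ∫ y in E \ F, K x y (L h y) ∂μ ∧
        Integrable (fun y => K x y (L h y)) (μ.restrict (E \ F)) := by
    refine ae_mono (Measure.restrict_mono hBF le_rfl) ?_
    filter_upwards [hrep', hint.prod_right_ae] with x hx hKx
    refine ⟨by rw [hUL, hx], ?_⟩
    refine hKx.norm.mono' (isBoundedBilinearMap_apply.continuous.comp_aestronglyMeasurable₂
      hKx.1 (hLm.mono_measure hEF)) ?_
    filter_upwards [ae_mono hEF hL1] with y hy
    exact (K x y).le_of_opNorm_le_of_le le_rfl hy |>.trans_eq (mul_one _)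
  have hBV : μ.restrict (Metric.closedBall c (2 * δ)) ≤ μ.restrict V :=
    Measure.restrict_mono (hBF.trans hFV) le_rfl
  have hmem : ∀ᵐ x ∂μ.restrict (Metric.closedBall c (2 * δ)), x ∈ Metric.closedBall c (2 * δ) :=
    ae_restrict_mem Metric.isClosed_closedBall.measurableSet
  filter_upwards [hgood, hmem, ae_mono hBV hiii] with x ⟨hx, hxi⟩ hxc hx3
  filter_upwards [hgood, hmem, ae_mono hBV hx3] with x' ⟨hx', hxi'⟩ hxc' hC
  rw [Metric.mem_closedBall] at hxc hxc'
  have hd : dist x x' ≤ 4 * δ := by linarith [dist_triangle_right x x' c]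
  have hC' := hC (by linarith)
  set S := (Metric.ball c (16 * δ))ᶜ with hS
  have hSm : MeasurableSet S := Metric.isOpen_ball.measurableSet.compl
  have hsub : S ∩ (E \ F) ⊆ E \ Metric.ball x (2 * dist x x') := by
    rintro y ⟨hyS, hyE, -⟩
    refine ⟨hyE, fun hy => hyS ?_⟩
    rw [Metric.mem_ball] at hy ⊢
    linarith [dist_triangle y x c]
  have hle : ‖U h x - U h x'‖ₑ ≤ C := by
    rw [hx, hx', ← integral_sub hxi hxi']
    calc ‖∫ y in E \ F, (K x y (L h y) - K x' y (L h y)) ∂μ‖ₑ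
        ≤ ∫⁻ y in E \ F, ‖K x y (L h y) - K x' y (L h y)‖ₑ ∂μ :=
          enorm_integral_le_lintegral_enorm _
      _ ≤ ∫⁻ y in E \ F, S.indicator (fun y => ‖K x y - K x' y‖ₑ) y ∂μ := by
          refine lintegral_mono_ae ?_
          filter_upwards [ae_mono hEF hL1, ae_mono hEF hL0] with y hy1 hy0
          by_cases hy : y ∈ Metric.ball c (16 * δ)
          · rw [hy0 hy, map_zero, map_zero, sub_zero, enorm_zero]
            exact zero_le
          · rw [indicator_of_mem (mem_compl hy), ← sub_apply]
            refine enorm_le_iff_norm_le.2 ?_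
            exact ((K x y - K x' y).le_of_opNorm_le_of_le le_rfl hy1).trans_eq (mul_one _)
      _ = ∫⁻ y in S ∩ (E \ F), ‖K x y - K x' y‖ₑ ∂μ := by
          rw [lintegral_indicator hSm, Measure.restrict_restrict hSm]
      _ ≤ C := (lintegral_mono_set hsub).trans hC'
  rw [enorm_eq_nnnorm, ENNReal.coe_le_coe] at hle
  exact_mod_cast hle

end Reduction

/-! ### The bound -/

section Main

open Filter Topology

/-- At the exponent `r` itself the exponents in `phiLow` vanish, also for `r = 1`, where the
conjugate exponent is `∞`. -/
theorem one_le_phiConst_self (r : ℝ≥0∞) : 1 ≤ phiConst r r := by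
  have h : ∀ s : ℝ≥0∞, 1 ≤ phiLow s s := fun s => le_iInf₂ fun q _ => by
    rw [sub_self, zero_div, ENNReal.rpow_zero]
  unfold phiConst
  split_ifs
  exacts [h r, h _]

/-- The norm of a function times its direction recovers the function, so that `T f` is the
value at the scalar function `‖f‖` of an operator on scalar functions. -/
theorem exists_scalar_operator_apply_eq {X 𝕜 B₁ B₂ : Type*} [MeasurableSpace X] {ν σ : Measure X}
    [RCLike 𝕜] [NormedAddCommGroup B₁] [NormedSpace 𝕜 B₁] [NormedAddCommGroup B₂]
    [NormedSpace 𝕜 B₂] [NormedSpace ℝ B₂] {r : ℝ≥0∞} [Fact (1 ≤ r)]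
    (T : Lp B₁ r ν →L[𝕜] Lp B₂ r σ) {A : ℝ≥0} (hT : ∀ f, ‖T f‖ ≤ A * ‖f‖) (f : Lp B₁ r ν) :
    ∃ (u : X → B₁) (U : Lp ℝ r ν →L[ℝ] Lp B₂ r σ) (L : Lp ℝ r ν → Lp B₁ r ν) (h : Lp ℝ r ν),
      (∀ x, ‖u x‖ ≤ 1) ∧ (∀ h, U h = T (L h)) ∧
      (∀ h, L h =ᵐ[ν] fun x => ((h x : ℝ) : 𝕜) • u x) ∧ (∀ h, ‖U h‖ ≤ A * ‖h‖) ∧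
      h =ᵐ[ν] (fun x => ‖f x‖) ∧ U h = T f := by
  have hf : StronglyMeasurable f := Lp.stronglyMeasurable f
  set u : X → B₁ := fun x => ((‖f x‖⁻¹ : ℝ) : 𝕜) • f x with hu
  have hum : StronglyMeasurable u := (RCLike.continuous_ofReal.comp_stronglyMeasurable
    hf.norm.measurable.inv.stronglyMeasurable).smul hf
  have hu1 : ∀ x, ‖u x‖ ≤ 1 := fun x => by
    rw [hu, norm_smul, RCLike.norm_ofReal, abs_of_nonneg (by positivity)]
    exact inv_mul_le_one
  obtain ⟨U, L, hUL, hL, hU⟩ := exists_scalar_operator T hT hum hu1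
  have hh := (Lp.memLp f).norm.coeFn_toLp
  refine ⟨u, U, L, (Lp.memLp f).norm.toLp _, hu1, hUL, hL, hU, hh, ?_⟩
  rw [hUL]
  congr 1
  refine Lp.ext ((hL _).trans ?_)
  filter_upwards [hh] with x hx
  rw [hx, hu, smul_smul, ← RCLike.ofReal_mul]
  by_cases h0 : f x = 0
  · rw [h0, smul_zero]
  · rw [mul_inv_cancel₀ (norm_ne_zero_iff.2 h0), RCLike.ofReal_one, one_smul]

end Main

theorem corollary15
    {X : Type*} [MetricSpace X] [LocallyCompactSpace X] [ConnectedSpace X]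
    [MeasurableSpace X] [BorelSpace X]
    (μ : Measure X) [μ.InnerRegular] [IsLocallyFiniteMeasure μ] [μ.IsOpenPosMeasure]
    {𝕜 : Type*} [RCLike 𝕜]
    {B₁ : Type*} [NormedAddCommGroup B₁] [NormedSpace 𝕜 B₁] [CompleteSpace B₁]
    {B₂ : Type*} [NormedAddCommGroup B₂] [NormedSpace 𝕜 B₂] [NormedSpace ℝ B₂]
    [IsScalarTower ℝ 𝕜 B₂] [CompleteSpace B₂]
    (R : ℝ) (hR : 0 < R) (κ : ℝ) (hκ : 2 < κ)
    (hD : localDoublingConst μ (3 * κ * R) < ∞)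
    (r : ℝ≥0∞) [Fact (1 ≤ r)] (hr : r < ∞)
    (E : Set X) (hE : NullMeasurableSet E μ) (hdiam : Metric.ediam E < ENNReal.ofReal R)
    (T : Lp B₁ r (μ.restrict E) →L[𝕜] Lp B₂ r (μ.restrict (Metric.thickening (R / 2) E)))
    (K : X → X → B₁ →L[𝕜] B₂)
    (hK : AEStronglyMeasurable (fun z : X × X => K z.1 z.2)
      ((μ.restrict (Metric.thickening (R / 2) E)).prod (μ.restrict E)))
    (hi : ∀ F : Set X, IsOpen F → F ⊆ Metric.thickening (R / 2) E →
      Integrable (fun z : X × X => K z.1 z.2) ((μ.restrict F).prod (μ.restrict (E \ F))) ∧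
      ∀ f : Lp B₁ r (μ.restrict E), MemLp f ∞ (μ.restrict E) →
        (∀ᵐ y ∂μ.restrict (E ∩ F), f y = 0) →
        ∀ᵐ x ∂μ.restrict F, T f x = ∫ y in E \ F, K x y (f y) ∂μ)
    (A : ℝ≥0) (hA : 0 < A)
    (hii : ∀ f : Lp B₁ r (μ.restrict E), ‖T f‖ ≤ A * ‖f‖)
    (C : ℝ≥0) (hC : 0 < C)
    (hiii : ∀ᵐ x ∂μ.restrict (Metric.thickening (R / 2) E),
      ∀ᵐ x' ∂μ.restrict (Metric.thickening (R / 2) E), dist x x' < R →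
        ∫⁻ y in E \ Metric.ball x (2 * dist x x'), ‖K x y - K x' y‖ₑ ∂μ ≤ C) :
    ∀ p : ℝ≥0∞, r ≤ p → p < ∞ →
      ∀ f : Lp B₁ r (μ.restrict E), MemLp f ∞ (μ.restrict E) →
        eLpNorm (T f) p (μ.restrict E) ≤
          16 * phiConst r p * (localDoublingConst μ (3 * κ * R) ^ 9 * A + C) *
            eLpNorm f p (μ.restrict E) := by
  intro p hrp hp f hf
  rcases E.eq_empty_or_nonempty with rfl | ⟨x₀, hx₀⟩
  · simp
  have hρ : 3 * κ * R = 3 * (κ * R) := by ring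
  have hκR : 2 * R < κ * R := by gcongr
  obtain ⟨D, hDeq, hD1, hdbl'⟩ := exists_nnreal_localDoublingConst hD
  have hdbl : ∀ (x : X) (s : ℝ), 0 < s → s ≤ R →
      μ (Metric.ball x (2 * s)) ≤ D * μ (Metric.ball x s) :=
    fun x s hs hsR => hdbl' x s hs (by linarith)
  have hball : ∀ x : X, μ (Metric.ball x (3 * R)) < ∞ := fun x =>
    measure_ball_lt_top_of_doubling hdbl' x (by linarith)
  have : SecondCountableTopology X := secondCountableTopology_of_measure_ball_lt_top hR hball
  have hdist : ∀ x ∈ E, ∀ y ∈ E, dist x y < R := fun x hx y hy => by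
    rw [← ENNReal.ofReal_lt_ofReal_iff hR, ← edist_dist]
    exact (Metric.edist_le_ediam_of_mem hx hy).trans_lt hdiam
  have hEV : ∀ c ∈ E, Metric.ball c (R / 2) ⊆ Metric.thickening (R / 2) E := fun c hc =>
    Metric.ball_subset_thickening hc _
  have hEsub : E ⊆ Metric.thickening (R / 2) E := Metric.self_subset_thickening (by positivity) _
  have hVfin : μ (Metric.thickening (R / 2) E) < ∞ := by
    refine (measure_mono fun y hy => ?_).trans_lt (hball x₀)
    obtain ⟨z, hz, hyz⟩ := Metric.mem_thickening_iff.1 hy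
    rw [Metric.mem_ball]
    linarith [dist_triangle y z x₀, hdist z hz x₀ hx₀]
  have : IsFiniteMeasure (μ.restrict (Metric.thickening (R / 2) E)) := isFiniteMeasure_restrict.2 hVfin.ne
  have : IsFiniteMeasure (μ.restrict E) :=
    isFiniteMeasure_restrict.2 (measure_ne_top_of_subset hEsub hVfin.ne)
  have hle : μ.restrict E ≤ μ.restrict (Metric.thickening (R / 2) E) := Measure.restrict_mono hEsub le_rfl
  rw [← hDeq]
  rcases hrp.eq_or_lt with rfl | hrp
  · have h1 : eLpNorm (T f) r (μ.restrict (Metric.thickening (R / 2) E)) ≤ A * eLpNorm f r (μ.restrict E) := by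
      have h2 := hii f
      rw [Lp.norm_def, Lp.norm_def] at h2
      rw [← ENNReal.toReal_le_toReal (Lp.eLpNorm_ne_top _)
        (ENNReal.mul_ne_top ENNReal.coe_ne_top (Lp.eLpNorm_ne_top _)), ENNReal.toReal_mul]
      exact h2
    refine (eLpNorm_mono_measure _ hle).trans (h1.trans (mul_le_mul_left ?_ _))
    calc (A : ℝ≥0∞) = 1 * 1 * (1 * A + 0) := by ring
      _ ≤ 16 * phiConst r r * (D ^ 9 * A + C) := by
          gcongr
          · norm_num
          · exact one_le_phiConst_self r
          · exact_mod_cast one_le_pow₀ hD1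
          · exact zero_le
  -- The weak type bound is proved for a measurable set, and `E` is only null-measurable.
  obtain ⟨E₀, hE₀, hE₀m, hE₀E⟩ := hE.exists_measurable_subset_ae_eq
  have hν : μ.restrict E = μ.restrict E₀ := (Measure.restrict_congr_set hE₀E).symm
  obtain ⟨u, U, L, h, hu1, hUL, hL, hU, hh, hUh⟩ := exists_scalar_operator_apply_eq T hii f
  have hosc : HasSmallOscillation E₀ R C U :=
    hasSmallOscillation_of_kernel hE₀ hEV hi hiii hu1 hUL hL
  obtain ⟨M, hM⟩ : ∃ M : ℝ, ∀ᵐ x ∂μ.restrict E, ‖h x‖ ≤ M := by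
    refine ⟨(eLpNormEssSup f (μ.restrict E)).toReal, ?_⟩
    have hfin : eLpNormEssSup f (μ.restrict E) ≠ ∞ := by
      rw [← eLpNorm_exponent_top]
      exact hf.2.ne
    filter_upwards [hh, enorm_ae_le_eLpNormEssSup f (μ.restrict E)] with x hx hfx
    rw [hx, norm_norm, ← toReal_enorm]
    exact ENNReal.toReal_mono hfin hfx
  have hmain := eLpNorm_le_of_hasSmallOscillation hR hD1 hdbl hE₀m
    (fun x hx y hy => hdist x (hE₀ hx) y (hE₀ hy)) hν Metric.isOpen_thickening.measurableSet
    (fun c hc => hEV c (hE₀ hc)) hr.ne hA hU hosc hrp hp.ne h hM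
  rwa [hUh, eLpNorm_congr_ae hh, eLpNorm_norm] at hmain
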